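/- Let $n\ge 1$ be odd, let $\Bbbk$ be a field whose characteristic does not divide $2n$ and which contains a primitive $2n$-th root of unity $\omega$, let $1\le s<2n$ be odd, and let $\beta\in\Bbbk$. Radford's Hopf algebra $H_n$ is the $\Bbbk$-algebra generated by $a,x$ with relations $a^{2n}=1$, $x^2=0$, $ax=-xa$, and with $$\Delta(a)=a\otimes a,\quad \Delta(x)=x\otimes a^n+1\otimes x,\quad \varepsilon(a)=1,\quad \varepsilon(x)=0,\quad S(a)=a^{-1},\quad S(x)=a^nx$$ (for $n=1$ this is Sweedler's algebra). Put $e_l=\frac1{2n}\sum_{0\le i<2n}\omega^{-il}a^i$ and $$R=\frac1{2n}\sum_{0\le i,l<2n}\omega^{-il}\,a^i\otimes a^{sl}+\frac{\beta}{2n}\sum_{0\le i,l<2n}\omega^{-il}\,a^ix\otimes a^{sl+n}x,\qquad \theta=a^n\sum_{0\le l<2n}\omega^{s l^2}e_l .$$ **Notation for a finite-dimensional ribbon Hopf algebra $(H,R,\theta)$** (with $R\Delta=\Delta^{op}R$, $(\mathrm{id}\otimes\Delta)(R)=R_{13}R_{12}$, $(\Delta\otimes\mathrm{id})(R)=R_{13}R_{23}$,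 $\theta$ central and invertible, $S(\theta)=\theta$, $\Delta(\theta)=(\theta\otimes\theta)R_{21}R$). Let $\lambda\neq0$ be a right integral for $H^*$, i.e. $\lambda(x_{(1)})x_{(2)}=\lambda(x)1$. Let $\nu:H\to\Bbbk$ be the distinguished grouplike element of $H^*$, i.e. the algebra map with $\Lambda x=\nu(x)\Lambda$ for every left integral $\Lambda$ of $H$. Let $Z(H)$ be the centre of $H$ and $$L(H)=\{z\in H: \nu(x_{(1)})x_{(2)}z=zx\ \ \forall x\in H\},\qquad N(H)=\{z\in L(H): \lambda(zc)=0\ \ \forall c\in Z(H)\}.$$ The category $\mathrm{rep}_H$ of finite-dimensional left $H$-modules is ribbon, and $A=H^*$ with the coadjoint action $(hf)(x)=f(S(h_{(1)})xh_{(2)})$ and the maps $i_M:M^*\otimes M\to A$, $i_M(l\otimes m)(x)=l(xm)$, is the coend of $(M,N)\mapsto M^*\otimes N$. The Hopf algebra $A$ in $\mathrm{rep}_H$ has comultiplication, product and antipode determined by $\Delta_Ai_M=(i_M\otimes i_M)(\mathrm{id}\otimes\mathrm{coev}_M\otimes\mathrm{id})$; $m_A(i_M\otimes i_N)=i_{N\otimes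 M}\circ(\mathrm{id}_{M^*}\otimes c_{M,N^*\otimes N})$, with $M^*\otimes N^*\simeq(N\otimes M)^*$; $S_Ai_M=i_{M^*}\circ(\mathrm{id}_M\otimes\theta_{M^*})\circ c_{M^*,M}$, with $M\simeq M^{**}$. Also $\Theta_\pm i_M=\mathrm{ev}_M(\mathrm{id}\otimes\theta_M^{\pm1})$. Put $\Gamma_l=(\mathrm{id}\otimes m_A)(\Delta_A\otimes\mathrm{id})$. A morphism $f:M\to N$ is negligible if $\mathrm{tr}_q(gf)=0$ for all morphisms $g:N\to M$. For $z\in H$ let $\phi_z:\Bbbk\to A$ be $t\mapsto t\,\lambda(z\,\cdot)$. Then $\mathcal I(H)$ is the set of $z\in H$ such that $\phi_z$ is $H$-linear and both $S_A\phi_z-\phi_z$ and $\Gamma_l(\phi_z\otimes\phi_z)-\phi_z\otimes\phi_z$ are negligible, and $\mathcal I(H)^{\mathrm{norm}}$ is the set of those $z\in\mathcal I(H)$ with $\Theta_+\phi_z\ne0$ and $\Theta_-\phi_z\neq0$. For a framed link $L\subset S^3$ with $n_L$ components, presented as the closure of a framed braid, let $\tau(L;\phi_z)$ be the scalar obtained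 by colouring $L$ with the coend: colour all strands with the regular module, cut each component once, and insert there the element $\lambda(z\,\cdot)\otimes1\in H^*\otimes H$ (which $i_H$ sends to $\phi_z(1)$). With $b_-(L)$ the number of negative eigenvalues of the linking matrix of $L$, put $$\tau_{(H,z)}(L)=\lambda(z\theta)^{b_-(L)-n_L}\,\lambda(z\theta^{-1})^{-b_-(L)}\,\tau(L;\phi_z).$$ Regard closed connected oriented 3-manifolds as surgery presentations (framed links, as closures of framed braids) modulo isotopy and Kirby moves, and write $M_L$ for the manifold presented by $L$. An HKR-type invariant with values in $\Bbbk$ is a function $I$ of 3-manifolds for which there are a finite-dimensional ribbon Hopf algebra $H$ over $\Bbbk$, a right integral $\lambda\neq0$ for $H^*$ and an element $z\in\mathcal I(H)^{\mathrm{norm}}$ with $I(M_L)=\tau_{(H,z)}(L)$ for all $L$. **Statement.** $(H_n,R,\theta)$ is a ribbon Hopf algebra; $H_n$ is not unimodular (its left and right integrals do not coincide); $H_n^*$ has a nonzero right integral, and $\nu$ exists and is unique. For every nonzero right integral $\lambda$ for $H_n^*$, with $z_d=\sum_{0\le k<n/d}a^{2dk+n}x$ for each positive divisor $d$ of $n$: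 1. $\displaystyle \mathcal I(H_n)=\bigcup_{d\mid n}\{\alpha z_d+w:\alpha\in\Bbbk,\ w\in N(H_n)\}$. 2. $\displaystyle \mathcal I(H_n)^{\mathrm{norm}}=\bigcup_{d\mid n}\{\alpha z_d+w:\alpha\in\Bbbk^*,\ w\in N(H_n)\}$, and every $z\in\mathcal I(H_n)^{\mathrm{norm}}$ lies in the set on the right for exactly one $d\mid n$. So $\mathcal I(H_n)^{\mathrm{norm}}$ consists of exactly $D(n)$ classes modulo nonzero scalars and $N(H_n)$, where $D(n)$ is the number of positive divisors of $n$. 3. For $d\mid n$, $\alpha\in\Bbbk^*$ and $w\in N(H_n)$, one has $\tau_{(H_n,\alpha z_d+w)}(L)=\tau_{(H_n,z_d)}(L)$ for all $L$; and $\tau_{(H_n,z_d)}$ is a well-defined HKR-type invariant of 3-manifolds. Thus $H_n$ leads to the family of HKR-type invariants $\tau_{(H_n,z_d)}$ indexed by the $D(n)$ divisors $d$ of $n$. 4. $1\notin\mathcal I(H_n)$. -/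

import Mathlib

open scoped TensorProduct

universe u

/-- The generators of Radford's Hopf algebra. -/
inductive RadfordGen where
  | a
  | x

/-- The relations `a^(2n) = 1`, `x² = 0`, `a x = -x a`. -/
inductive RadfordRel (k : Type u) [Field k] (n : ℕ) :
    FreeAlgebra k RadfordGen → FreeAlgebra k RadfordGen → Prop
  | a_pow : RadfordRel k n (FreeAlgebra.ι k RadfordGen.a ^ (2 * n)) 1
  | x_sq : RadfordRel k n (FreeAlgebra.ι k RadfordGen.x ^ 2) 0
  | anticomm : RadfordRel k n
      (FreeAlgebra.ι k RadfordGen.a * FreeAlgebra.ι k RadfordGen.x)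
      (-(FreeAlgebra.ι k RadfordGen.x * FreeAlgebra.ι k RadfordGen.a))

/-- Radford's algebra `H_n`, given by generators and relations. -/
def Radford (k : Type u) [Field k] (n : ℕ) : Type u := RingQuot (RadfordRel k n)

namespace Radford

variable (k : Type u) [Field k] (n : ℕ)

instance : Ring (Radford k n) := inferInstanceAs (Ring (RingQuot (RadfordRel k n)))
instance : Algebra k (Radford k n) := inferInstanceAs (Algebra k (RingQuot (RadfordRel k n)))

def mk : FreeAlgebra k RadfordGen →ₐ[k] Radford k n := RingQuot.mkAlgHom k (RadfordRel k n)
def a : Radford k n := mk k n (FreeAlgebra.ι k RadfordGen.a)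
def x : Radford k n := mk k n (FreeAlgebra.ι k RadfordGen.x)

theorem a_pow : a k n ^ (2 * n) = 1 := by
  have h : mk k n _ = mk k n _ := RingQuot.mkAlgHom_rel k (RadfordRel.a_pow (k := k) (n := n))
  simpa [a] using h

theorem x_sq : x k n ^ 2 = 0 := by
  have h : mk k n _ = mk k n _ := RingQuot.mkAlgHom_rel k (RadfordRel.x_sq (k := k) (n := n))
  simpa [x] using h

theorem a_mul_x : a k n * x k n = -(x k n * a k n) := by
  have h : mk k n _ = mk k n _ := RingQuot.mkAlgHom_rel k (RadfordRel.anticomm (k := k) (n := n))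
  simpa [a, x] using h

variable {k n}

/-- The universal property of `H_n`. -/
def lift {B : Type*} [Ring B] [Algebra k B] (α ξ : B) (h₁ : α ^ (2 * n) = 1) (h₂ : ξ ^ 2 = 0)
    (h₃ : α * ξ = -(ξ * α)) : Radford k n →ₐ[k] B :=
  RingQuot.liftAlgHom k ⟨FreeAlgebra.lift k (fun g => RadfordGen.casesOn g α ξ), by
    rintro _ _ (_ | _ | _) <;> simp [h₁, h₂, h₃]⟩

section
variable {B : Type*} [Ring B] [Algebra k B] (α ξ : B) (h₁ : α ^ (2 * n) = 1) (h₂ : ξ ^ 2 = 0)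
    (h₃ : α * ξ = -(ξ * α))

@[simp] theorem lift_a : lift α ξ h₁ h₂ h₃ (a k n) = α := by
  unfold lift a mk
  erw [RingQuot.liftAlgHom_mkAlgHom_apply]
  simp

@[simp] theorem lift_x : lift α ξ h₁ h₂ h₃ (x k n) = ξ := by
  unfold lift x mk
  erw [RingQuot.liftAlgHom_mkAlgHom_apply]
  simp
end

theorem hom_ext {B : Type*} [Semiring B] [Algebra k B] {f g : Radford k n →ₐ[k] B}
    (ha : f (a k n) = g (a k n)) (hx : f (x k n) = g (x k n)) : f = g := by
  refine RingQuot.ringQuot_ext' k _ _ (FreeAlgebra.hom_ext ?_)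
  funext i
  cases i
  · exact ha
  · exact hx

theorem induction {P : Radford k n → Prop} (hadd : ∀ u v, P u → P v → P (u + v))
   (halg : ∀ r : k, P (algebraMap k _ r)) (hmul : ∀ u v, P u → P v → P (u * v))
   (ha : P (a k n)) (hx : P (x k n)) (h : Radford k n) : P h := by
  have key : ∀ f : FreeAlgebra k RadfordGen, P (mk k n f) := fun f => by
    induction f using FreeAlgebra.induction with
    | grade0 r => simpa using halg r
    | grade1 g => cases g; exacts [ha, hx]
    | mul u v hu hv => simpa using hmul _ _ hu hv
    | add u v hu hv => simpa using hadd _ _ hu hv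
  obtain ⟨f, rfl⟩ := RingQuot.mkAlgHom_surjective k (RadfordRel k n) h
  exact key f

theorem x_mul_a_pow (i : ℕ) : x k n * a k n ^ i = (-1 : Radford k n) ^ i * (a k n ^ i * x k n) := by
  induction i with
  | zero => simp
  | succ i ih =>
    have h : x k n * a k n = -(a k n * x k n) := by rw [a_mul_x]; simp
    rw [pow_succ (a k n), ← mul_assoc, ih, mul_assoc, mul_assoc, h, pow_succ (-1 : Radford k n)]
    simp [mul_assoc]

section Hopf
variable [hn : Fact (Odd n)]

theorem x_mul_a_pow_n : x k n * a k n ^ n = -(a k n ^ n * x k n) := by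
  rw [x_mul_a_pow, hn.out.neg_one_pow]; simp

variable (k n) in
/-- `Δ(a) = a ⊗ a`, `Δ(x) = x ⊗ a^n + 1 ⊗ x`. -/
def comulHom : Radford k n →ₐ[k] Radford k n ⊗[k] Radford k n :=
  lift (a k n ⊗ₜ a k n) (x k n ⊗ₜ (a k n ^ n) + 1 ⊗ₜ x k n)
    (by simp [Algebra.TensorProduct.tmul_pow, a_pow, Algebra.TensorProduct.one_def])
    (by
      have h := x_mul_a_pow_n (k := k) (n := n)
      have hx := x_sq k n
      rw [sq] at hx ⊢
      simp [add_mul, mul_add, hx, h, TensorProduct.tmul_neg])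
    (by
      have h := a_mul_x k n
      simp only [mul_add, add_mul, Algebra.TensorProduct.tmul_mul_tmul, h, mul_one, one_mul,
        TensorProduct.neg_tmul, TensorProduct.tmul_neg, ← pow_succ, ← pow_succ']
      abel)

variable (k n) in
/-- `ε(a) = 1`, `ε(x) = 0`. -/
def counitHom : Radford k n →ₐ[k] k := lift 1 0 (by simp) (by simp) (by simp)

variable (k n) in
/-- `S(a) = a^(2n-1) = a⁻¹`, `S(x) = a^n x`, as a homomorphism to the opposite algebra. -/
def antipodeHom : Radford k n →ₐ[k] (Radford k n)ᵐᵒᵖ :=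
  lift (MulOpposite.op (a k n ^ (2 * n - 1))) (MulOpposite.op (a k n ^ n * x k n))
    (by
      rw [← MulOpposite.op_pow, ← pow_mul, mul_comm, pow_mul, a_pow, one_pow, MulOpposite.op_one])
    (by
      have h := x_mul_a_pow_n (k := k) (n := n)
      have hx := x_sq k n
      rw [← MulOpposite.op_pow, sq, mul_assoc, ← mul_assoc (x k n), h]
      rw [sq] at hx
      simp [mul_assoc, hx])
    (by
      rw [← MulOpposite.op_mul, ← MulOpposite.op_mul, ← MulOpposite.op_neg]
      congr 1
      rw [mul_assoc, x_mul_a_pow, Odd.neg_one_pow]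
      · simp only [neg_mul, one_mul, mul_neg, ← mul_assoc, ← pow_add]
        rw [add_comm]
      · obtain ⟨m, hm⟩ := hn.out
        exact ⟨2 * m, by omega⟩)

instance : Bialgebra k (Radford k n) :=
  Bialgebra.ofAlgHom (comulHom k n) (counitHom k n)
    (by
      apply hom_ext
      · simp [comulHom]
      · simp [comulHom, TensorProduct.add_tmul, TensorProduct.tmul_add, Algebra.TensorProduct.one_def, add_assoc])
    (by
      apply hom_ext
      · simp [comulHom, counitHom]
      · simp [comulHom, counitHom])
    (by
      apply hom_ext
      · simp [comulHom, counitHom]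
      · simp [comulHom, counitHom])

variable (k n) in
/-- The antipode as a linear endomorphism. -/
def antipodeLin : Radford k n →ₗ[k] Radford k n :=
  (MulOpposite.opLinearEquiv k).symm.toLinearMap ∘ₗ (antipodeHom k n).toLinearMap

instance : HopfAlgebraStruct k (Radford k n) where
  antipode := antipodeLin k n

theorem antipodeLin_mul (u v : Radford k n) :
   antipodeLin k n (u * v) = antipodeLin k n v * antipodeLin k n u := by
  simp [antipodeLin]
theorem antipodeLin_algebraMap (r : k) :
   antipodeLin k n (algebraMap k _ r) = algebraMap k _ r := by
  simp [antipodeLin]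
theorem antipodeLin_a : antipodeLin k n (a k n) = a k n ^ (2 * n - 1) := by
  simp [antipodeLin, antipodeHom]
theorem antipodeLin_x : antipodeLin k n (x k n) = a k n ^ n * x k n := by
  simp [antipodeLin, antipodeHom]

theorem two_n_ne : 2 * n - 1 + 1 = 2 * n := by
  obtain ⟨m, hm⟩ := hn.out
  omega

theorem antipode_left (h : Radford k n) :
    LinearMap.mul' k _ ((antipodeLin k n).rTensor _ (comulHom k n h)) =
      algebraMap k _ (counitHom k n h) := by
  induction h using induction with
  | hadd u v hu hv => simp [hu, hv]
  | halg r => simp [Algebra.TensorProduct.algebraMap_apply, antipodeLin_algebraMap]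
  | hmul u v hu hv =>
    have key : ∀ q : Radford k n ⊗[k] Radford k n,
        LinearMap.mul' k _ ((antipodeLin k n).rTensor _ (comulHom k n u * q)) =
          algebraMap k _ (counitHom k n u) * LinearMap.mul' k _ ((antipodeLin k n).rTensor _ q) := by
      intro q
      induction q with
      | zero => simp
      | add q r hq hr => simp [mul_add, hq, hr]
      | tmul c d =>
        have : ∀ p : Radford k n ⊗[k] Radford k n,
            LinearMap.mul' k _ ((antipodeLin k n).rTensor _ (p * c ⊗ₜ d)) =
            antipodeLin k n c * LinearMap.mul' k _ ((antipodeLin k n).rTensor _ p) * d := by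
          intro p
          induction p with
          | zero => simp
          | add q r hq hr => simp [mul_add, add_mul, hq, hr]
          | tmul e f => simp [antipodeLin_mul, mul_assoc]
        rw [this, hu, ← Algebra.commutes]
        simp [mul_assoc]
    rw [map_mul, key, hv, ← map_mul, ← map_mul]
  | ha =>
    simp [comulHom, counitHom, antipodeLin_a, ← pow_succ, two_n_ne, a_pow]
  | hx =>
    have h1 : antipodeLin k n 1 = 1 := by simpa using antipodeLin_algebraMap (k := k) (n := n) 1
    simp [comulHom, counitHom, antipodeLin_x, h1, mul_assoc, x_mul_a_pow_n]
    rw [← mul_assoc, ← pow_add, ← two_mul, a_pow]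
    simp

theorem antipode_right (h : Radford k n) :
    LinearMap.mul' k _ ((antipodeLin k n).lTensor _ (comulHom k n h)) =
      algebraMap k _ (counitHom k n h) := by
  induction h using induction with
  | hadd u v hu hv => simp [hu, hv]
  | halg r =>
    have h1 : antipodeLin k n 1 = 1 := by simpa using antipodeLin_algebraMap (k := k) (n := n) 1
    simp [Algebra.TensorProduct.algebraMap_apply, h1]
  | hmul u v hu hv =>
    have key : ∀ q : Radford k n ⊗[k] Radford k n,
        LinearMap.mul' k _ ((antipodeLin k n).lTensor _ (q * comulHom k n v)) =
          algebraMap k _ (counitHom k n v) * LinearMap.mul' k _ ((antipodeLin k n).lTensor _ q) := by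
      intro q
      induction q with
      | zero => simp
      | add q r hq hr => simp [mul_add, add_mul, hq, hr]
      | tmul c d =>
        have : ∀ p : Radford k n ⊗[k] Radford k n,
            LinearMap.mul' k _ ((antipodeLin k n).lTensor _ (c ⊗ₜ d * p)) =
            c * LinearMap.mul' k _ ((antipodeLin k n).lTensor _ p) * antipodeLin k n d := by
          intro p
          induction p with
          | zero => simp
          | add q r hq hr => simp [mul_add, add_mul, hq, hr]
          | tmul e f => simp [antipodeLin_mul, mul_assoc]
        rw [this, hv, ← Algebra.commutes]
        simp [mul_assoc]
    rw [map_mul, key, hu, ← map_mul, mul_comm, ← map_mul]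
  | ha =>
    simp [comulHom, counitHom, antipodeLin_a, ← pow_succ', two_n_ne, a_pow]
  | hx =>
    have hp : ∀ i : ℕ, antipodeLin k n (a k n ^ i) = (a k n ^ (2 * n - 1)) ^ i := by
      intro i
      simp [antipodeLin, antipodeHom]
    have h2 : (a k n ^ (2 * n - 1)) ^ n = a k n ^ n := by
      obtain ⟨m, hm⟩ := hn.out
      have : (2 * n - 1) * n = 2 * n * (n - 1) + n := by
        subst hm
        simp only [Nat.add_sub_cancel, show 2 * (2 * m + 1) - 1 = 4 * m + 1 by omega]
        ring
      rw [← pow_mul, this, pow_add, pow_mul, a_pow, one_pow, one_mul]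
    simp [comulHom, counitHom, antipodeLin_x, hp, h2, x_mul_a_pow_n]

instance : HopfAlgebra k (Radford k n) where
  mul_antipode_rTensor_comul := LinearMap.ext fun h => antipode_left h
  mul_antipode_lTensor_comul := LinearMap.ext fun h => antipode_right h

end Hopf

theorem mem_span (hn : 0 < n) (h : Radford k n) :
    h ∈ Submodule.span k ((fun p : ℕ × ℕ => a k n ^ p.1 * x k n ^ p.2) ''
      (Finset.range (2 * n) ×ˢ Finset.range 2 : Finset (ℕ × ℕ))) := by
  set S := Submodule.span k ((fun p : ℕ × ℕ => a k n ^ p.1 * x k n ^ p.2) ''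
      (Finset.range (2 * n) ×ˢ Finset.range 2 : Finset (ℕ × ℕ))) with hS
  have base : ∀ i j : ℕ, a k n ^ i * x k n ^ j ∈ S := by
    intro i j
    rcases lt_or_ge j 2 with hj | hj
    · rw [← Nat.mod_add_div i (2 * n), pow_add, pow_mul, a_pow, one_pow, mul_one]
      refine Submodule.subset_span ⟨(i % (2 * n), j), ?_, rfl⟩
      simpa using ⟨Nat.mod_lt _ (by omega), by omega⟩
    · have : x k n ^ j = 0 := by
        rw [← Nat.sub_add_cancel hj, pow_add, x_sq, mul_zero]
      simp [this]
  have key : ∀ h : Radford k n, ∀ s ∈ S, h * s ∈ S := by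
    intro h
    induction h using induction with
    | hadd u v hu hv => intro s hs; rw [add_mul]; exact S.add_mem (hu s hs) (hv s hs)
    | halg r => intro s hs; rw [← Algebra.smul_def]; exact S.smul_mem r hs
    | hmul u v hu hv => intro s hs; rw [mul_assoc]; exact hu _ (hv s hs)
    | ha =>
      intro s hs
      induction hs using Submodule.span_induction with
      | mem y hy =>
        obtain ⟨p, -, rfl⟩ := hy
        simpa [← mul_assoc, ← pow_succ'] using base (p.1 + 1) p.2
      | zero => simp
      | add y z _ _ hy hz => rw [mul_add]; exact S.add_mem hy hz
      | smul r y _ hy => rw [mul_smul_comm]; exact S.smul_mem r hy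
    | hx =>
      intro s hs
      induction hs using Submodule.span_induction with
      | mem y hy =>
        obtain ⟨p, -, rfl⟩ := hy
        have h1 := base p.1 (p.2 + 1)
        simp only [← mul_assoc, x_mul_a_pow]
        rw [mul_assoc _ (x k n), ← pow_succ', mul_assoc]
        rcases neg_one_pow_eq_or (Radford k n) p.1 with h | h
        · rw [h, one_mul]; exact h1
        · rw [h, neg_one_mul]; exact S.neg_mem h1
      | zero => simp
      | add y z _ _ hy hz => rw [mul_add]; exact S.add_mem hy hz
      | smul r y _ hy => rw [mul_smul_comm]; exact S.smul_mem r hy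
  simpa using key h 1 (by simpa using base 0 0)

instance [hn : Fact (Odd n)] : FiniteDimensional k (Radford k n) := by
  classical
  refine ⟨⟨(Finset.range (2 * n) ×ˢ Finset.range 2).image
    (fun p : ℕ × ℕ => a k n ^ p.1 * x k n ^ p.2), ?_⟩⟩
  rw [eq_top_iff]
  intro h _
  simpa using mem_span hn.out.pos h

end Radford

namespace RibbonHopf

variable {k H : Type u} [Field k] [Ring H] [HopfAlgebra k H]

section Algebraic

variable (k) in
/-- `Λ` is a left integral for `H`. -/
def IsLeftIntegral (Λ : H) : Prop := ∀ x : H, x * Λ = Coalgebra.counit (R := k) x • Λ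

variable (k) in
/-- `Λ` is a right integral for `H`. -/
def IsRightIntegral (Λ : H) : Prop := ∀ x : H, Λ * x = Coalgebra.counit (R := k) x • Λ

variable (k H) in
/-- The integrals of `H` are two-sided. -/
def IsUnimodular : Prop := ∀ Λ : H, IsLeftIntegral k Λ ↔ IsRightIntegral k Λ

/-- `x ↦ f(x₍₁₎) x₍₂₎` -/
noncomputable def hit (f : Module.Dual k H) : H →ₗ[k] H :=
  (TensorProduct.lid k H).toLinearMap ∘ₗ f.rTensor H ∘ₗ Coalgebra.comul

/-- `λ` is a right integral for the dual of `H`: `λ(x₍₁₎) x₍₂₎ = λ(x) 1`. -/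
def IsDualRightIntegral (lam : Module.Dual k H) : Prop :=
  ∀ x : H, hit lam x = lam x • (1 : H)

/-- `ν` is the distinguished grouplike element of the dual of `H`: `Λ x = ν(x) Λ` for all left
integrals `Λ`. -/
def IsDistinguished (ν : H →ₐ[k] k) : Prop :=
  ∀ Λ : H, IsLeftIntegral k Λ → ∀ x : H, Λ * x = ν x • Λ

/-- `R` is an R-matrix: `R Δ(x) = Δ^op(x) R`, `(id ⊗ Δ)(R) = R₁₃ R₁₂`, `(Δ ⊗ id)(R) = R₁₃ R₂₃`. -/
structure IsRMatrix (R : H ⊗[k] H) : Prop where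
  isUnit : IsUnit R
  intertwines : ∀ x : H, R * Coalgebra.comul (R := k) x =
    TensorProduct.comm k H H (Coalgebra.comul (R := k) x) * R
  comul_right : (Coalgebra.comul (R := k) (A := H)).lTensor H R =
    Algebra.TensorProduct.map (AlgHom.id k H) Algebra.TensorProduct.includeRight R *
      Algebra.TensorProduct.map (AlgHom.id k H) Algebra.TensorProduct.includeLeft R
  comul_left : TensorProduct.assoc k H H H ((Coalgebra.comul (R := k) (A := H)).rTensor H R) =
    Algebra.TensorProduct.map (AlgHom.id k H) Algebra.TensorProduct.includeRight R *
      (Algebra.TensorProduct.includeRight : H ⊗[k] H →ₐ[k] H ⊗[k] (H ⊗[k] H)) R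

/-- The R-matrix `R` and the twist `θ` make `H` a ribbon Hopf algebra; the last condition is
`Δ(θ) = (θ ⊗ θ) R₂₁ R`. -/
structure IsRibbon (R : H ⊗[k] H) (θ : H) : Prop extends IsRMatrix R where
  isUnit_twist : IsUnit θ
  central : ∀ x : H, θ * x = x * θ
  antipode_twist : HopfAlgebra.antipode k θ = θ
  comul_twist : Coalgebra.comul (R := k) θ = (θ ⊗ₜ[k] θ) * (TensorProduct.comm k H H R * R)

/-- The Drinfeld element `u = ∑ S(b_i) a_i` of `R = ∑ a_i ⊗ b_i`. -/
noncomputable def drinfeld (R : H ⊗[k] H) : H :=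
  LinearMap.mul' k H ((HopfAlgebra.antipode k).rTensor H (TensorProduct.comm k H H R))

/-- The special grouplike element `G = θ u`. -/
noncomputable def special (R : H ⊗[k] H) (θ : H) : H := θ * drinfeld R

end Algebraic

section Representations

variable {V W : Type*} [AddCommGroup V] [Module k V] [AddCommGroup W] [Module k W]

/-- The map `f` is `H`-linear. Representations are algebra homomorphisms to endomorphism algebras. -/
def IsHom (ρ : H →ₐ[k] Module.End k V) (σ : H →ₐ[k] Module.End k W) (f : V →ₗ[k] W) : Prop :=
  ∀ h : H, f ∘ₗ ρ h = σ h ∘ₗ f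

variable (k H) in
/-- The unit object of the category of representations. -/
noncomputable def unitRep : H →ₐ[k] Module.End k k :=
  (Algebra.lmul k k).comp (Bialgebra.counitAlgHom k H)

variable (k H) in
/-- `H` acting on itself by left multiplication. -/
noncomputable def regularRep : H →ₐ[k] Module.End k H := Algebra.lmul k H

/-- `a ⊗ b` acts on `v ⊗ w` as `a v ⊗ b w`. -/
noncomputable def actTwo (ρ : H →ₐ[k] Module.End k V) (σ : H →ₐ[k] Module.End k W) :
    H ⊗[k] H →ₐ[k] Module.End k (V ⊗[k] W) :=
  (Module.endTensorEndAlgHom (R := k) (S := k) (A := k) (M := V) (N := W)).comp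
    (Algebra.TensorProduct.map ρ σ)

@[simp] theorem actTwo_tmul (ρ : H →ₐ[k] Module.End k V) (σ : H →ₐ[k] Module.End k W) (a b : H)
    (v : V) (w : W) : actTwo ρ σ (a ⊗ₜ b) (v ⊗ₜ w) = ρ a v ⊗ₜ σ b w := rfl

/-- The tensor product of representations. -/
noncomputable def tensorRep (ρ : H →ₐ[k] Module.End k V) (σ : H →ₐ[k] Module.End k W) :
    H →ₐ[k] Module.End k (V ⊗[k] W) :=
  (actTwo ρ σ).comp (Bialgebra.comulAlgHom k H)

/-- The dual representation `(h l)(m) = l(S(h) m)`. -/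
noncomputable def dualRep (ρ : H →ₐ[k] Module.End k V) :
    H →ₐ[k] Module.End k (Module.Dual k V) :=
  AlgHom.ofLinearMap (Module.Dual.transpose ∘ₗ ρ.toLinearMap ∘ₗ HopfAlgebra.antipode k)
    (by
      ext l m
      change l (ρ (HopfAlgebra.antipode k 1) m) = l m
      simp)
    (by
      intro a b; ext l m
      change l (ρ (HopfAlgebra.antipode k (a * b)) m) =
        l (ρ (HopfAlgebra.antipode k b) (ρ (HopfAlgebra.antipode k a) m))
      simp [HopfAlgebra.antipode_mul_antidistrib])

@[simp] theorem dualRep_apply (ρ : H →ₐ[k] Module.End k V) (h : H) (l : Module.Dual k V) :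
    dualRep ρ h l = l ∘ₗ ρ (HopfAlgebra.antipode k h) := rfl

/-- `a ⊗ b ↦ (x ↦ S(a) x b)` -/
noncomputable def sandwich : H ⊗[k] H →ₗ[k] Module.End k H :=
  TensorProduct.lift ((LinearMap.mul k (Module.End k H)).compl₁₂
    (LinearMap.mul k H ∘ₗ HopfAlgebra.antipode k) (LinearMap.mul k H).flip)

@[simp] theorem sandwich_tmul (a b x : H) :
    sandwich (k := k) (a ⊗ₜ b) x = HopfAlgebra.antipode k a * (x * b) := by
  simp [sandwich]

theorem sandwich_mul (p q : H ⊗[k] H) : sandwich (p * q) = sandwich q * sandwich p := by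
  induction p with
  | zero => simp
  | add p p' hp hp' => simp [add_mul, mul_add, hp, hp']
  | tmul a b =>
    induction q with
    | zero => simp
    | add q q' hq hq' => simp [add_mul, mul_add, hq, hq']
    | tmul c d =>
      ext x
      simp [HopfAlgebra.antipode_mul_antidistrib, mul_assoc]

variable (k H) in
/-- The coadjoint action `(h f)(x) = f(S(h₍₁₎) x h₍₂₎)` on the dual of `H`, which is the coend `A`. -/
noncomputable def coadjointRep : H →ₐ[k] Module.End k (Module.Dual k H) :=
  AlgHom.ofLinearMap (Module.Dual.transpose ∘ₗ sandwich ∘ₗ Coalgebra.comul)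
    (by
      ext f x
      change f (sandwich (Coalgebra.comul (R := k) (1 : H)) x) = f x
      simp [Algebra.TensorProduct.one_def])
    (by
      intro a b; ext f x
      change f (sandwich (Coalgebra.comul (R := k) (a * b)) x) =
        f (sandwich (Coalgebra.comul (R := k) b) (sandwich (Coalgebra.comul (R := k) a) x))
      simp [sandwich_mul])

end Representations

section Ribbon

variable {V W : Type*} [AddCommGroup V] [Module k V] [AddCommGroup W] [Module k W]
variable (R : H ⊗[k] H) (θ : H)
variable (ρ : H →ₐ[k] Module.End k V) (σ : H →ₐ[k] Module.End k W)

/-- The braiding: the action of `R`, then the flip. -/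
noncomputable def braiding : V ⊗[k] W →ₗ[k] W ⊗[k] V :=
  (TensorProduct.comm k V W).toLinearMap ∘ₗ actTwo ρ σ R

/-- The right evaluation `ev ∘ c ∘ (θ ⊗ id)`. -/
noncomputable def evTilde : V ⊗[k] Module.Dual k V →ₗ[k] k :=
  contractLeft k V ∘ₗ braiding R ρ (dualRep ρ) ∘ₗ (ρ θ).rTensor (Module.Dual k V)

/-- The quantum trace of an endomorphism. -/
noncomputable def quantumTrace [FiniteDimensional k V] (f : V →ₗ[k] V) : k :=
  evTilde R θ ρ (f.rTensor (Module.Dual k V) (coevaluation k V 1))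

/-- `f` is a negligible morphism: `tr_q(g f) = 0` for all morphisms `g` in the other direction. -/
def IsNegligible [FiniteDimensional k V] (f : V →ₗ[k] W) : Prop :=
  IsHom ρ σ f ∧ ∀ g : W →ₗ[k] V, IsHom σ ρ g → quantumTrace R θ ρ (g ∘ₗ f) = 0

/-- The universal dinatural map `i_V : V^* ⊗ V → A`, `i_V(l ⊗ m)(x) = l(x m)`. -/
noncomputable def coendMap : Module.Dual k V ⊗[k] V →ₗ[k] Module.Dual k H :=
  TensorProduct.lift (LinearMap.mk₂ k (fun l m => l ∘ₗ LinearMap.applyₗ m ∘ₗ ρ.toLinearMap)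
    (fun _ _ _ => rfl) (fun _ _ _ => rfl) (fun _ _ _ => by ext; simp) (fun _ _ _ => by ext; simp))

/-- The isomorphism `V → V^**` given by the right evaluation. -/
noncomputable def pivot : V →ₗ[k] Module.Dual k (Module.Dual k V) :=
  TensorProduct.curry (evTilde R θ ρ)

/-- The morphism `S_A ∘ i_V`: braid `V^*` past `V`, apply the twist to `V^*` and the isomorphism
`V → V^**`, and then `i` for the representation `V^*`. -/
noncomputable def antipodeOn : Module.Dual k V ⊗[k] V →ₗ[k] Module.Dual k H :=
  coendMap (dualRep ρ) ∘ₗ (pivot R θ ρ).rTensor (Module.Dual k V) ∘ₗ (dualRep ρ θ).lTensor V ∘ₗ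
    braiding R (dualRep ρ) ρ

/-- The morphism `Δ_A ∘ i_V = (i_V ⊗ i_V) ∘ (id ⊗ coev_V ⊗ id)`. -/
noncomputable def comulOn [FiniteDimensional k V] :
    Module.Dual k V ⊗[k] V →ₗ[k] Module.Dual k H ⊗[k] Module.Dual k H :=
  TensorProduct.map (coendMap ρ) (coendMap ρ) ∘ₗ
    (TensorProduct.assoc k (Module.Dual k V) V (Module.Dual k V ⊗[k] V)).symm.toLinearMap ∘ₗ
    ((TensorProduct.assoc k V (Module.Dual k V) V).toLinearMap ∘ₗ (coevaluation k V).rTensor V ∘ₗ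
      (TensorProduct.lid k V).symm.toLinearMap).lTensor (Module.Dual k V)

variable (k V W) in
/-- The identification `V^* ⊗ W^* = (W ⊗ V)^*`. -/
noncomputable def dualTensor :
    Module.Dual k V ⊗[k] Module.Dual k W →ₗ[k] Module.Dual k (W ⊗[k] V) :=
  TensorProduct.dualDistrib k W V ∘ₗ
    (TensorProduct.comm k (Module.Dual k V) (Module.Dual k W)).toLinearMap

/-- The morphism `μ_A ∘ (i_V ⊗ i_W)`: braid `V` past `W^* ⊗ W`, and then `i` for `W ⊗ V`. -/
noncomputable def mulOn :
    (Module.Dual k V ⊗[k] V) ⊗[k] (Module.Dual k W ⊗[k] W) →ₗ[k] Module.Dual k H :=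
  coendMap (tensorRep σ ρ) ∘ₗ (dualTensor k V W).rTensor (W ⊗[k] V) ∘ₗ
    (TensorProduct.assoc k (Module.Dual k V) (Module.Dual k W) (W ⊗[k] V)).symm.toLinearMap ∘ₗ
    ((TensorProduct.assoc k (Module.Dual k W) W V).toLinearMap ∘ₗ
      braiding R ρ (tensorRep (dualRep σ) σ)).lTensor (Module.Dual k V) ∘ₗ
    (TensorProduct.assoc k (Module.Dual k V) V (Module.Dual k W ⊗[k] W)).toLinearMap

variable (k H) in
/-- `f ↦ f ⊗ 1`. A dinatural family `ξ` factors through the coend as `f ↦ ξ_H(f ⊗ 1)`. -/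
noncomputable def atOne : Module.Dual k H →ₗ[k] Module.Dual k H ⊗[k] H :=
  (TensorProduct.mk k (Module.Dual k H) H).flip 1

/-- The antipode of the coend. -/
noncomputable def antipodeA : Module.Dual k H →ₗ[k] Module.Dual k H :=
  antipodeOn R θ (regularRep k H) ∘ₗ atOne k H

variable (k H) in
/-- The comultiplication of the coend. -/
noncomputable def comulA [FiniteDimensional k H] :
    Module.Dual k H →ₗ[k] Module.Dual k H ⊗[k] Module.Dual k H :=
  comulOn (regularRep k H) ∘ₗ atOne k H

/-- The multiplication of the coend. -/
noncomputable def mulA : Module.Dual k H ⊗[k] Module.Dual k H →ₗ[k] Module.Dual k H :=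
  mulOn R (regularRep k H) (regularRep k H) ∘ₗ TensorProduct.map (atOne k H) (atOne k H)

/-- The morphism from the coend to the unit object with `i_V ↦ ev_V ∘ (id ⊗ t)`, for central `t`; it
is `Θ₊` for `t = θ` and `Θ₋` for `t = θ⁻¹`. -/
noncomputable def thetaA (t : H) : Module.Dual k H →ₗ[k] k :=
  contractLeft k H ∘ₗ (regularRep k H t).lTensor (Module.Dual k H) ∘ₗ atOne k H

@[simp] theorem coendMap_tmul (l : Module.Dual k V) (m : V) (x : H) :
    coendMap ρ (l ⊗ₜ m) x = l (ρ x m) := rfl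

@[simp] theorem coendMap_atOne (f : Module.Dual k H) : coendMap (regularRep k H) (f ⊗ₜ 1) = f := by
  ext x
  simp [regularRep]

theorem evTilde_tmul (m : V) (l : Module.Dual k V) :
    evTilde R θ ρ (m ⊗ₜ l) = l (ρ (drinfeld R * θ) m) := by
  unfold drinfeld
  induction R with
  | zero => simp [evTilde, braiding]
  | add p q hp hq =>
    simp only [evTilde, braiding, map_add, LinearMap.comp_apply, LinearMap.add_apply, add_mul]
      at hp hq ⊢
    rw [hp, hq]
  | tmul a b => simp [evTilde, braiding]

theorem thetaA_comp (t : H) :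
    thetaA t ∘ₗ coendMap ρ = contractLeft k V ∘ₗ (ρ t).lTensor (Module.Dual k V) :=
  TensorProduct.ext' fun l m => by simp [thetaA, atOne, regularRep]

theorem antipodeOn_apply (l : Module.Dual k V) (m : V) (x : H) :
    antipodeOn R θ ρ (l ⊗ₜ m) x = l (ρ (sandwich R (HopfAlgebra.antipode k θ *
      (HopfAlgebra.antipode k x * (drinfeld R * θ)))) m) := by
  have key : ∀ p : H ⊗[k] H, (coendMap (dualRep ρ) ∘ₗ (pivot R θ ρ).rTensor (Module.Dual k V) ∘ₗ
      (dualRep ρ θ).lTensor V ∘ₗ braiding p (dualRep ρ) ρ) (l ⊗ₜ m) x =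
      l (ρ (sandwich p (HopfAlgebra.antipode k θ *
        (HopfAlgebra.antipode k x * (drinfeld R * θ)))) m) := by
    intro p
    induction p with
    | zero => simp [braiding]
    | add p q hp hq =>
      simp only [braiding, LinearMap.comp_apply, map_add, LinearMap.add_apply] at hp hq ⊢
      rw [hp, hq]
    | tmul a b => simp [braiding, pivot, evTilde_tmul]
  exact key R

/-- The relation that defines the antipode of the coend. -/
theorem antipodeA_comp : antipodeA R θ ∘ₗ coendMap ρ = antipodeOn R θ ρ :=
  TensorProduct.ext' fun l m => LinearMap.ext fun x => by
    simp [antipodeA, atOne, antipodeOn_apply, regularRep]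

theorem dualDistrib_comulOn [FiniteDimensional k V] (l : Module.Dual k V) (m : V) (x y : H) :
    TensorProduct.dualDistrib k H H (comulOn ρ (l ⊗ₜ m)) (x ⊗ₜ y) = l (ρ x (ρ y m)) := by
  conv_rhs => rw [← (Module.Basis.ofVectorSpace k V).sum_repr (ρ y m)]
  simp [comulOn, coevaluation_apply_one, TensorProduct.sum_tmul, TensorProduct.tmul_sum, mul_comm]

/-- The relation that defines the comultiplication of the coend. -/
theorem comulA_comp [FiniteDimensional k H] [FiniteDimensional k V] :
    comulA k H ∘ₗ coendMap ρ = comulOn ρ := by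
  refine TensorProduct.ext' fun l m => (TensorProduct.dualDistribEquiv k H H).injective ?_
  refine TensorProduct.ext' fun x y => ?_
  refine Eq.trans ?_ (dualDistrib_comulOn ρ l m x y).symm
  refine (dualDistrib_comulOn (regularRep k H) (coendMap ρ (l ⊗ₜ m)) (1 : H) x y).trans ?_
  simp [regularRep]

theorem mulOn_aux (s r : H ⊗[k] H) (a : H) : ∃ Z : H ⊗[k] H, ∀ {V W : Type u} [AddCommGroup V]
    [Module k V] [AddCommGroup W] [Module k W] (ρ : H →ₐ[k] Module.End k V)
    (σ : H →ₐ[k] Module.End k W) (l : Module.Dual k V) (m : V) (q : Module.Dual k W) (y : W),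
    contractLeft k (W ⊗[k] V) ((actTwo σ ρ s).lTensor _
      ((dualTensor k V W).rTensor (W ⊗[k] V)
        ((TensorProduct.assoc k (Module.Dual k V) (Module.Dual k W) (W ⊗[k] V)).symm
          (l ⊗ₜ (TensorProduct.assoc k (Module.Dual k W) W V
            (actTwo (dualRep σ) σ r (q ⊗ₜ y) ⊗ₜ ρ a m)))))) =
      TensorProduct.dualDistrib k H H (coendMap ρ (l ⊗ₜ m) ⊗ₜ coendMap σ (q ⊗ₜ y)) Z := by
  induction r with
  | zero => exact ⟨0, fun _ _ _ _ _ _ => by simp⟩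
  | add r r' hr hr' =>
    obtain ⟨Z, hZ⟩ := hr
    obtain ⟨Z', hZ'⟩ := hr'
    refine ⟨Z + Z', fun ρ σ l m q y => ?_⟩
    rw [map_add (TensorProduct.dualDistrib k H H _) Z Z', ← hZ ρ σ l m q y, ← hZ' ρ σ l m q y]
    simp only [map_add, LinearMap.add_apply, TensorProduct.add_tmul, TensorProduct.tmul_add]
  | tmul c d =>
    induction s with
    | zero => exact ⟨0, fun _ _ _ _ _ _ => by simp⟩
    | add s s' hs hs' =>
      obtain ⟨Z, hZ⟩ := hs
      obtain ⟨Z', hZ'⟩ := hs'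
      refine ⟨Z + Z', fun ρ σ l m q y => ?_⟩
      rw [map_add (TensorProduct.dualDistrib k H H _) Z Z', ← hZ ρ σ l m q y, ← hZ' ρ σ l m q y]
      simp only [map_add, LinearMap.add_apply, LinearMap.lTensor_add]
    | tmul e f =>
      refine ⟨(f * a) ⊗ₜ (HopfAlgebra.antipode k c * e * d), fun ρ σ l m q y => ?_⟩
      simp [dualTensor, mul_comm]

theorem mulOn_tmul : ∃ Z : H → H ⊗[k] H, ∀ {V W : Type u} [AddCommGroup V]
    [Module k V] [AddCommGroup W] [Module k W] (ρ : H →ₐ[k] Module.End k V)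
    (σ : H →ₐ[k] Module.End k W) (l : Module.Dual k V) (m : V) (q : Module.Dual k W) (y : W)
    (x : H), mulOn R ρ σ ((l ⊗ₜ m) ⊗ₜ (q ⊗ₜ y)) x =
      TensorProduct.dualDistrib k H H (coendMap ρ (l ⊗ₜ m) ⊗ₜ coendMap σ (q ⊗ₜ y)) (Z x) := by
  induction R with
  | zero => exact ⟨0, fun _ _ _ _ _ _ _ => by simp [mulOn, braiding]⟩
  | add p p' hp hp' =>
    obtain ⟨Z, hZ⟩ := hp
    obtain ⟨Z', hZ'⟩ := hp'
    refine ⟨fun x => Z x + Z' x, fun ρ σ l m q y x => ?_⟩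
    rw [map_add (TensorProduct.dualDistrib k H H _) (Z x) (Z' x), ← hZ ρ σ l m q y x, ← hZ' ρ σ l m q y x]
    simp only [mulOn, braiding, map_add, LinearMap.comp_add, LinearMap.lTensor_add,
      LinearMap.add_comp, LinearMap.add_apply]
  | tmul a b =>
    choose Z hZ using fun x : H => mulOn_aux (k := k) (Coalgebra.comul x) (Coalgebra.comul b) a
    refine ⟨Z, fun {V W} _ _ _ _ ρ σ l m q y x => ?_⟩
    rw [← hZ x ρ σ l m q y]
    have aux : ∀ t : Module.Dual k (W ⊗[k] V) ⊗[k] (W ⊗[k] V),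
        coendMap (tensorRep σ ρ) t x = contractLeft k (W ⊗[k] V)
          ((actTwo σ ρ (Coalgebra.comul x)).lTensor _ t) := by
      intro t
      induction t with
      | zero => simp
      | add t t' h h' => simp only [map_add, LinearMap.add_apply, h, h']
      | tmul f v => simp [tensorRep]
    simp only [mulOn, LinearMap.comp_apply, aux]
    simp [braiding, tensorRep]

/-- The relation that defines the multiplication of the coend. -/
theorem mulA_comp {V W : Type u} [AddCommGroup V] [Module k V] [AddCommGroup W] [Module k W]
    (ρ : H →ₐ[k] Module.End k V) (σ : H →ₐ[k] Module.End k W) :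
    mulA R ∘ₗ TensorProduct.map (coendMap ρ) (coendMap σ) = mulOn R ρ σ := by
  obtain ⟨Z, hZ⟩ := mulOn_tmul (k := k) R
  refine TensorProduct.ext_fourfold' fun l m q y => LinearMap.ext fun x => ?_
  rw [hZ ρ σ l m q y x]
  refine (hZ (regularRep k H) (regularRep k H) (coendMap ρ (l ⊗ₜ m)) (1 : H)
    (coendMap σ (q ⊗ₜ y)) (1 : H) x).trans ?_
  rw [coendMap_atOne, coendMap_atOne]

end Ribbon
end RibbonHopf

namespace RibbonHopf

section KirbyElements

/-- The difference of `f` and `g` is a negligible morphism. -/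
def EqModNegligible {k H V W : Type u} [Field k] [Ring H] [HopfAlgebra k H]
    [AddCommGroup V] [Module k V] [FiniteDimensional k V] [AddCommGroup W] [Module k W]
    (R : H ⊗[k] H) (θ : H) (ρ : H →ₐ[k] Module.End k V) (σ : H →ₐ[k] Module.End k W)
    (f g : V →ₗ[k] W) : Prop :=
  IsNegligible R θ ρ σ (f - g)

variable {k H : Type u} [Field k] [Ring H] [HopfAlgebra k H] [FiniteDimensional k H]

/-- The endomorphism `Γ_l = (id ⊗ μ) ∘ (Δ ⊗ id)` of `A ⊗ A`, for the comultiplication `Δ` and the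
multiplication `μ` of the coend `A`. -/
noncomputable def gammaA (R : H ⊗[k] H) :
    Module.Dual k H ⊗[k] Module.Dual k H →ₗ[k] Module.Dual k H ⊗[k] Module.Dual k H :=
  (mulA R).lTensor (Module.Dual k H) ∘ₗ
    (TensorProduct.assoc k (Module.Dual k H) (Module.Dual k H) (Module.Dual k H)).toLinearMap ∘ₗ
    (comulA k H).rTensor (Module.Dual k H)

/-- `α ⊗ α`, as a map from the unit object to `A ⊗ A`. -/
noncomputable def tensorSquare (α : k →ₗ[k] Module.Dual k H) :
    k →ₗ[k] Module.Dual k H ⊗[k] Module.Dual k H :=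
  TensorProduct.map α α ∘ₗ (TensorProduct.lid k k).symm.toLinearMap

/-- The set `I(rep H)`: the morphisms `α` from the unit object to the coend `A` such that
`S_A ∘ α - α` and `Γ_l ∘ (α ⊗ α) - α ⊗ α` are negligible. -/
def catKirby (R : H ⊗[k] H) (θ : H) : Set (k →ₗ[k] Module.Dual k H) :=
  {α | IsHom (unitRep k H) (coadjointRep k H) α ∧
    EqModNegligible R θ (unitRep k H) (coadjointRep k H) (antipodeA R θ ∘ₗ α) α ∧
    EqModNegligible R θ (unitRep k H) (tensorRep (coadjointRep k H) (coadjointRep k H))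
      (gammaA R ∘ₗ tensorSquare α) (tensorSquare α)}

/-- The set `I(rep H)^norm`: the elements `α` of `I(rep H)` such that `Θ₊ ∘ α ≠ 0` and
`Θ₋ ∘ α ≠ 0`. -/
def catKirbyNorm (R : H ⊗[k] H) (θ : H) : Set (k →ₗ[k] Module.Dual k H) :=
  {α | α ∈ catKirby R θ ∧ thetaA θ ∘ₗ α ≠ 0 ∧ thetaA (Ring.inverse θ) ∘ₗ α ≠ 0}

/-- `φ_z : t ↦ t (λ · z)`, where `(λ · z)(x) = λ(z x)`. -/
noncomputable def phi (lam : Module.Dual k H) (z : H) : k →ₗ[k] Module.Dual k H :=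
  LinearMap.toSpanSingleton k (Module.Dual k H) (lam ∘ₗ LinearMap.mulLeft k z)

/-- `I(H) = φ⁻¹(I(rep H))`. -/
def kirbySet (R : H ⊗[k] H) (θ : H) (lam : Module.Dual k H) : Set H :=
  {z | phi lam z ∈ catKirby R θ}

/-- `I(H)^norm = φ⁻¹(I(rep H)^norm)`. -/
def kirbySetNorm (R : H ⊗[k] H) (θ : H) (lam : Module.Dual k H) : Set H :=
  {z | phi lam z ∈ catKirbyNorm R θ}

end KirbyElements

section Subspaces

variable {k H : Type u} [Field k] [Ring H] [HopfAlgebra k H]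

/-- `L(H)`, where `ν` is the distinguished grouplike element of the dual of `H`. -/
def setL (ν : H →ₐ[k] k) : Set H := {z | ∀ x : H, hit ν.toLinearMap x * z = z * x}

/-- `N(H)`, the elements `z` of `L(H)` such that `λ(z c) = 0` for all central `c`. -/
def setN (lam : Module.Dual k H) (ν : H →ₐ[k] k) : Set H :=
  {z | z ∈ setL ν ∧ ∀ c ∈ Subring.center H, lam (z * c) = 0}

end Subspaces

end RibbonHopf

/-- The generators of framed braids on strands numbered from left to right by `0, 1, 2, …`. -/
inductive BraidLetter where
  /-- the crossing (positive if `pos` is true) of the strands at positions `i` and `i + 1` -/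
  | crossing (i : ℕ) (pos : Bool)
  /-- a full twist of the framing (positive if `pos` is true) of the strand at position `i` -/
  | twist (i : ℕ) (pos : Bool)

namespace BraidLetter

/-- The letter makes sense on `m` strands. -/
def Fits (m : ℕ) : BraidLetter → Prop
  | crossing i _ => i + 1 < m
  | twist i _ => i < m

/-- The inverse letter. -/
def inv : BraidLetter → BraidLetter
  | crossing i p => crossing i (!p)
  | twist i p => twist i (!p)

/-- The positions on which the letter acts. -/
def support : BraidLetter → Finset ℕ
  | crossing i _ => {i, i + 1}
  | twist i _ => {i}

/-- The effect on positions. -/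
def perm : BraidLetter → Equiv.Perm ℕ
  | crossing i _ => Equiv.swap i (i + 1)
  | twist _ _ => 1

end BraidLetter

/-- Words in the generators, read from the bottom of the braid to its top. -/
abbrev BraidWord := List BraidLetter

namespace BraidWord

/-- The permutation of a braid: the strand that starts at the bottom in position `p` ends at the
top in position `perm w p`. -/
def perm : BraidWord → Equiv.Perm ℕ
  | [] => 1
  | l :: w => perm w * l.perm

/-- The strands `p` and `q` (numbered by their bottom positions) lie on the same component of the
closure of the braid. -/
def SameComponent (w : BraidWord) (p q : ℕ) : Prop := (perm w).SameCycle p q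

/-- The strand `p` is the leftmost one on its component. -/
def IsBase (w : BraidWord) (p : ℕ) : Prop := ∀ q, SameComponent w p q → p ≤ q

/-- The crossings and framing twists of a braid with their signs; a crossing is recorded by the
bottom positions of its two strands, a twist by the pair `(p, p)` for the bottom position `p` of its
strand. The permutation `e` takes positions at the current height to bottom positions. -/
def crossings : BraidWord → Equiv.Perm ℕ → List (ℕ × ℕ × Bool)
  | [], _ => []
  | .crossing i s :: w, e => (e i, e (i + 1), s) :: crossings w (e * Equiv.swap i (i + 1))
  | .twist i s :: w, e => (e i, e i, s) :: crossings w e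

/-- The number of elements of `D` that are smaller than `i`, added to `i`. -/
def offset (D : Finset ℕ) (i : ℕ) : ℕ := i + (D.filter (· < i)).card

/-- The braid obtained by doubling, along the framing, the strands whose bottom positions are in
`D`; a doubled strand in position `i` takes the positions `offset D i` and `offset D i + 1`. -/
def cable : Finset ℕ → BraidWord → BraidWord
  | _, [] => []
  | D, .twist i s :: w =>
      (if i ∈ D then
        [.twist (offset D i) s, .twist (offset D i + 1) s,
          .crossing (offset D i) s, .crossing (offset D i) s]
      else [.twist (offset D i) s]) ++ cable D w
  | D, .crossing i s :: w =>
      (if i ∈ D then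
        if i + 1 ∈ D then
          [.crossing (offset D i + 1) s, .crossing (offset D i) s,
            .crossing (offset D i + 2) s, .crossing (offset D i + 1) s]
        else [.crossing (offset D i + 1) s, .crossing (offset D i) s]
      else
        if i + 1 ∈ D then [.crossing (offset D i) s, .crossing (offset D i + 1) s]
        else [.crossing (offset D i) s]) ++
      cable (D.map (Equiv.swap i (i + 1)).toEmbedding) w

/-- The local relations between framed braids. -/
inductive LocalRel : BraidWord → BraidWord → Prop
  | cancel (l : BraidLetter) : LocalRel [l, l.inv] []
  | commute (l l' : BraidLetter) (h : Disjoint l.support l'.support) : LocalRel [l, l'] [l', l]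
  | braid (i : ℕ) : LocalRel
      [.crossing i true, .crossing (i + 1) true, .crossing i true]
      [.crossing (i + 1) true, .crossing i true, .crossing (i + 1) true]
  | twist_left (i : ℕ) : LocalRel
      [.twist i true, .crossing i true] [.crossing i true, .twist (i + 1) true]
  | twist_right (i : ℕ) : LocalRel
      [.twist (i + 1) true, .crossing i true] [.crossing i true, .twist i true]

end BraidWord

/-- A framed braid; its closure is an oriented framed link in the 3-sphere. -/
structure FramedBraid where
  /-- the number of strands -/
  strands : ℕ
  /-- the word of the braid -/
  word : BraidWord
  fits : ∀ l ∈ word, BraidLetter.Fits strands l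

namespace FramedBraid

/-- The components of the closure, represented by their leftmost strands. -/
abbrev Component (L : FramedBraid) : Type := {p : Fin L.strands // L.word.IsBase p}

noncomputable instance (L : FramedBraid) : Fintype L.Component := Fintype.ofFinite _

open Classical in
/-- The linking matrix of the closure, with the framing numbers on its diagonal. -/
noncomputable def linkingMatrix (L : FramedBraid) : Matrix L.Component L.Component ℝ :=
  Matrix.of fun p q => ((BraidWord.crossings L.word 1).map fun c =>
    (if c.2.2 then (1 / 2 : ℝ) else -1 / 2) *
      ((if L.word.SameComponent c.1 p ∧ L.word.SameComponent c.2.1 q then 1 else 0) +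
        (if L.word.SameComponent c.2.1 p ∧ L.word.SameComponent c.1 q then 1 else 0))).sum

/-- The number `b₋` of negative eigenvalues, with multiplicity, of the linking matrix. -/
noncomputable def bMinus (L : FramedBraid) : ℕ :=
  sigNeg L.linkingMatrix.toQuadraticForm'

open Classical in
/-- The moves between framed braids: isotopies of braids, the two Markov moves (which give the
isotopies of framed links), adding an unlinked unknot with framing `1` or `-1`, and sliding the
component of strand `0` over the component of strand `1`. -/
inductive KirbyStep : FramedBraid → FramedBraid → Prop
  | local_rel (m : ℕ) (u v x y : BraidWord) (hx hy) (h : BraidWord.LocalRel x y) :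
      KirbyStep ⟨m, u ++ x ++ v, hx⟩ ⟨m, u ++ y ++ v, hy⟩
  | conj (m : ℕ) (u v : BraidWord) (h h') : KirbyStep ⟨m, u ++ v, h⟩ ⟨m, v ++ u, h'⟩
  | markov (m : ℕ) (w : BraidWord) (s : Bool) (h h') :
      KirbyStep ⟨m + 1, w, h⟩ ⟨m + 2, w ++ [.crossing m s, .twist (m + 1) !s], h'⟩
  | blow_up (m : ℕ) (w : BraidWord) (s : Bool) (h h') :
      KirbyStep ⟨m, w, h⟩ ⟨m + 1, w ++ [.twist m s], h'⟩
  | slide (m : ℕ) (w : BraidWord) (s : Bool) (D : Finset ℕ)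
      (hD : D = (Finset.range m).filter (w.SameComponent 1)) (hm : 2 ≤ m)
      (h01 : ¬ w.SameComponent 0 1) (h h') :
      KirbyStep ⟨m, w, h⟩
        ⟨m + D.card, [.crossing 0 s, .twist 0 !s] ++ BraidWord.cable D w, h'⟩

end FramedBraid

/-- Surgery presentations modulo the Kirby moves: the closed connected oriented 3-manifolds up to
orientation preserving homeomorphism. -/
def SurgeryManifold : Type := Quot FramedBraid.KirbyStep

/-- The manifold obtained by surgery along the closure of a framed braid. -/
def FramedBraid.surgery (L : FramedBraid) : SurgeryManifold := Quot.mk _ L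

namespace RibbonHopf

section Invariants

variable {k H : Type u} [Field k] [Ring H] [HopfAlgebra k H]

/-- `R` placed in the tensor factors `i` and `j`. -/
noncomputable def place {m : ℕ} (i j : Fin m) (R : H ⊗[k] H) : ⨂[k] _ : Fin m, H :=
  LinearMap.mul' k (⨂[k] _ : Fin m, H) (TensorProduct.map
    (PiTensorProduct.singleAlgHom (R := k) (A := fun _ : Fin m => H) i).toLinearMap
    (PiTensorProduct.singleAlgHom (R := k) (A := fun _ : Fin m => H) j).toLinearMap R)

/-- The permutation of tensor factors. -/
noncomputable def permuteFactors {m : ℕ} (e : Equiv.Perm (Fin m)) :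
    Module.End k (⨂[k] _ : Fin m, H) :=
  (PiTensorProduct.reindex k (fun _ : Fin m => H) e).toLinearMap

/-- The operator of a letter on the tensor power of the regular representation: the braiding or its
inverse in two adjacent factors, the action of the twist or of its inverse in one factor. -/
noncomputable def letterOp (R : H ⊗[k] H) (θ : H) (m : ℕ) :
    BraidLetter → Module.End k (⨂[k] _ : Fin m, H)
  | .crossing i true => if h : i + 1 < m then
      permuteFactors (Equiv.swap ⟨i, by omega⟩ ⟨i + 1, h⟩) *
        LinearMap.mulLeft k (place ⟨i, by omega⟩ ⟨i + 1, h⟩ R)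
      else 1
  | .crossing i false => if h : i + 1 < m then
      LinearMap.mulLeft k (place ⟨i, by omega⟩ ⟨i + 1, h⟩ (Ring.inverse R)) *
        permuteFactors (Equiv.swap ⟨i, by omega⟩ ⟨i + 1, h⟩)
      else 1
  | .twist i s => if h : i < m then
      LinearMap.mulLeft k (PiTensorProduct.singleAlgHom (R := k) (A := fun _ : Fin m => H) ⟨i, h⟩
        (if s then θ else Ring.inverse θ))
      else 1

/-- The operator of a framed braid whose strands are coloured by the regular representation. -/
noncomputable def braidOp (R : H ⊗[k] H) (θ : H) (m : ℕ) :
    BraidWord → Module.End k (⨂[k] _ : Fin m, H)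
  | [] => 1
  | l :: w => braidOp R θ m w * letterOp R θ m l

open Classical in
/-- `τ(L; φ_z)` for the closure `L` of a framed braid. The strands are closed on their left by
coevaluations `1 ↦ ∑ e_i^* ⊗ G⁻¹ e_i` and evaluations; on each component one closing arc is cut and
the coevaluation is replaced by the element `(λ · z) ⊗ 1`, which `i_H` sends to `φ_z(1)`. -/
noncomputable def tauLink (R : H ⊗[k] H) (θ : H) (lam : Module.Dual k H) (z : H)
    (L : FramedBraid) : k :=
  LinearMap.trace k (⨂[k] _ : Fin L.strands, H)
    (PiTensorProduct.map (fun p : Fin L.strands =>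
      if L.word.IsBase p then LinearMap.toSpanSingleton k H 1 ∘ₗ lam ∘ₗ LinearMap.mulLeft k z
      else LinearMap.mulLeft k (Ring.inverse (special R θ))) ∘ₗ
    braidOp R θ L.strands L.word)

/-- The normalized invariant `τ_{(H,z)}` of the manifold obtained by surgery along the closure `L`
of a framed braid: `λ(zθ)^(b₋(L) - n_L) λ(zθ⁻¹)^(-b₋(L)) τ(L; φ_z)`, where `n_L` is the number of
components of `L`. -/
noncomputable def tau (R : H ⊗[k] H) (θ : H) (lam : Module.Dual k H) (z : H)
    (L : FramedBraid) : k :=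
  lam (z * θ) ^ ((L.bMinus : ℤ) - (Fintype.card L.Component : ℤ)) *
    lam (z * Ring.inverse θ) ^ (-(L.bMinus : ℤ)) * tauLink R θ lam z L

/-- Invariants of 3-manifolds of the form `τ_{(H,z)}`, for a finite-dimensional ribbon Hopf algebra
`H` and an element `z` of `I(H)^norm`. -/
def IsHKRType (k : Type u) [Field k] (I : SurgeryManifold → k) : Prop :=
  ∃ (H : Type u) (_ : Ring H) (_ : HopfAlgebra k H) (_ : FiniteDimensional k H) (R : H ⊗[k] H)
    (θ : H) (lam : Module.Dual k H) (z : H),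
    IsRibbon R θ ∧ IsDualRightIntegral lam ∧ lam ≠ 0 ∧ z ∈ kirbySetNorm R θ lam ∧
      ∀ L : FramedBraid, I L.surgery = tau R θ lam z L

end Invariants

end RibbonHopf

namespace Radford

variable {k : Type u} [Field k] (n : ℕ)

/-- The idempotents `e_l = (2n)⁻¹ ∑ ω^(-il) a^i`. -/
noncomputable def idem (ω : k) (l : ℕ) : Radford k n :=
  ((2 * n : ℕ) : k)⁻¹ • ∑ i ∈ Finset.range (2 * n), (ω ^ (i * l))⁻¹ • a k n ^ i

/-- `χ(α) = ∑ α^(l²) e_l`. -/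
noncomputable def chi (ω α : k) : Radford k n :=
  ∑ l ∈ Finset.range (2 * n), α ^ (l ^ 2) • idem n ω l

/-- The twist `a^n χ(ω^s)`. -/
noncomputable def twist (ω : k) (s : ℕ) : Radford k n := a k n ^ n * chi n ω (ω ^ s)

/-- The R-matrix `R_{ω,s,β}`. -/
noncomputable def rMatrix (ω : k) (s : ℕ) (β : k) : Radford k n ⊗[k] Radford k n :=
  ((2 * n : ℕ) : k)⁻¹ • (∑ i ∈ Finset.range (2 * n), ∑ l ∈ Finset.range (2 * n),
      (ω ^ (i * l))⁻¹ • ((a k n ^ i) ⊗ₜ[k] (a k n ^ (s * l)))) +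
    (β / ((2 * n : ℕ) : k)) • (∑ i ∈ Finset.range (2 * n), ∑ l ∈ Finset.range (2 * n),
      (ω ^ (i * l))⁻¹ • ((a k n ^ i * x k n) ⊗ₜ[k] (a k n ^ (s * l + n) * x k n)))

variable (k) in
/-- `z_d = ∑_{0 ≤ j < n/d} a^(2dj+n) x`. -/
noncomputable def zElem (d : ℕ) : Radford k n :=
  ∑ j ∈ Finset.range (n / d), a k n ^ (2 * d * j + n) * x k n

end Radford

/-! ### Functional calculus of elements of finite order -/

/-! Since `ω` is a primitive `2n`-th root of unity, the group algebra of `a` is split semisimple,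
and whatever is built from powers of `a` is a function of eigenvalues. The R-matrix is `R₀ (1 + β •
x ⊗ a^n x)`, where `R₀` acts as `ω^(s p q)` on the joint eigenspace of `a ⊗ 1` and `1 ⊗ a` with
eigenvalues `ω^p` and `ω^q`; the twist is `a^n` times the element acting as `ω^(s p²)` on the
`ω^p`-eigenspace. The ribbon axioms thus become identities between exponents, together with the rule
that moving `x` past `a` replaces `a` by `-a`, that is, shifts an exponent by `n`. The nilpotent
factor drops out of `R₂₁ R`, of the Drinfeld element and of every evaluation by characters, so the
classification and the invariants do not depend on `β`.

A right integral for the dual is a multiple of the coefficient of `a^n x`. A functional is coadjoint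
invariant exactly when it vanishes on all `a^i x` (`mem_reduced_iff`); such functionals are spanned
by the characters `a ↦ ω^l`, `x ↦ 0`. On them `S_A` is composition with the antipode, and `Γ_l` is
the transpose of the shear `(i, j) ↦ (i + j, j)` on pairs of powers of `a`. A morphism out of the
unit object is negligible when every invariant functional kills it. Evaluation at a central element
`a^i`, `i` even, is such a functional; conversely, an invariant functional kills whatever is
supported on odd powers of `a`, because this lies in the image of `x` (`exists_coadjoint_x`). So
with `G j = λ(z a^(2j))`, a function on `ℤ/n`, membership in `I(H)` means that `z` lies in `L(H)`,
that `G` is even, and that `G (i + j) * G j = G i * G j` (`mem_catKirby_iff`). The last equation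
forces `G` to be a multiple of the indicator of a subgroup `dℤ/n` (`exists_dvd_eq_ite`), and then
`G` is even. The element `z_d` realises this indicator up to a scalar, and `N(H)` is the kernel of
`z ↦ G` on `L(H)`.

Because `n` and `s` are odd, `ω^(s p q) = (-1)^(p q) ψ(p q)` for the character `ψ` of `ℤ/n` with
`ψ(1) = -ω^s`. The Fourier transform of `G` is a multiple of the indicator of the annihilator of
`d`, so `λ(z θ)` and `λ(z θ⁻¹)` are multiples of quadratic Gauss sums over an ideal of a ring in
which `2` is invertible. Such sums do not vanish (`GaussSum.sum_sq_ne_zero`), which settles the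
normalized set.

For the link invariant, the functional at each cut is expanded into characters. Braid operators
commute with right multiplication, so the character at a cut evaluates its whole component
(`trace_map_charEnd_comp`). The signs `(-1)^(p q)` of the crossings multiply to the sign of the
permutation of the strands with odd colour, and this cancels against the pivotal factors `a^n` on
the uncut strands (`oddSign_eq`). What remains is a Gauss sum of the linking form over colourings of
the components by an ideal of `ℤ/n` (`tauLink_eq`). Isotopies and handle slides induce linear
isomorphisms of colourings that preserve the form, and a blow-up adds `± t²`. Over `ℤ/n` this
controls the sum, over `ℝ` it controls `b₋` and the number of components, and the normalization
cancels both the factor of a blow-up and any rescaling of `z`. -/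

namespace RootCalculus

variable {k : Type*} [Field k] {B : Type*} [Ring B] [Algebra k B]

/-- The projection onto the `ω ^ l`-eigenspace of an element `A` with `A ^ N = 1`. -/
noncomputable def eig (N : ℕ) (ω : k) (l : ℕ) (A : B) : B :=
  (N : k)⁻¹ • ∑ i ∈ Finset.range N, (ω ^ (i * l))⁻¹ • A ^ i

/-- The element that acts as `U ^ l` on the `ω ^ l`-eigenspace of `A`. -/
noncomputable def bich (N : ℕ) (ω : k) (A U : B) : B :=
  ∑ l ∈ Finset.range N, U ^ l * eig N ω l A

/-- The element that acts as `ω ^ (t l²)` on the `ω ^ l`-eigenspace of `A`. -/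
noncomputable def quad (N : ℕ) (ω : k) (t : ℕ) (A : B) : B :=
  ∑ l ∈ Finset.range N, ω ^ (t * l ^ 2) • eig N ω l A

variable {N : ℕ} {ω : k}

theorem pow_mul_eigenvector {A v : B} {c : k} (h : A * v = c • v) (i : ℕ) :
    A ^ i * v = c ^ i • v := by
  induction i with
  | zero => simp
  | succ i ih => rw [pow_succ, mul_assoc, h, mul_smul_comm, ih, smul_smul, pow_succ, mul_comm]

theorem pow_congr (hω : IsPrimitiveRoot ω N) {l p : ℕ} (h : l ≡ p [MOD N]) : ω ^ l = ω ^ p := by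
  rw [pow_eq_pow_mod l hω.pow_eq_one, pow_eq_pow_mod p hω.pow_eq_one, h]

theorem pow_congr' {U : B} (hU : U ^ N = 1) {l p : ℕ} (h : l ≡ p [MOD N]) : U ^ l = U ^ p := by
  rw [pow_eq_pow_mod l hU, pow_eq_pow_mod p hU, h]

/-- Orthogonality of the characters of `ℤ/N`: the sum is a geometric series with ratio `ω^p / ω^l`.
-/
theorem sum_inv_mul_pow (hN : (N : k) ≠ 0) (hω : IsPrimitiveRoot ω N) (l p : ℕ) :
    (N : k)⁻¹ * ∑ i ∈ Finset.range N, (ω ^ (i * l))⁻¹ * (ω ^ p) ^ i =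
      if l ≡ p [MOD N] then 1 else 0 := by
  have h0 : N ≠ 0 := by rintro rfl; simp at hN
  have hω0 : ω ≠ 0 := hω.ne_zero h0
  have e : ∀ i, (ω ^ (i * l))⁻¹ * (ω ^ p) ^ i = (ω ^ p / ω ^ l) ^ i := by
    intro i
    rw [div_pow, ← pow_mul, ← pow_mul, mul_comm i l]
    field_simp
  simp_rw [e]
  split_ifs with h
  · rw [pow_congr hω h, div_self (pow_ne_zero _ hω0)]
    simp [hN]
  · have hne : ω ^ p / ω ^ l ≠ 1 := by
      intro h1
      rw [div_eq_one_iff_eq (pow_ne_zero _ hω0)] at h1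
      apply h
      rw [pow_eq_pow_mod p hω.pow_eq_one, pow_eq_pow_mod l hω.pow_eq_one] at h1
      exact (hω.pow_inj (Nat.mod_lt _ (by omega)) (Nat.mod_lt _ (by omega)) h1).symm
    rw [geom_sum_eq hne, div_pow, ← pow_mul, ← pow_mul, mul_comm p, mul_comm l, pow_mul, pow_mul,
      hω.pow_eq_one]
    simp

theorem eig_mul_eigenvector (hN : (N : k) ≠ 0) (hω : IsPrimitiveRoot ω N) {A v : B} {p : ℕ}
    (h : A * v = ω ^ p • v) (l : ℕ) :
    eig N ω l A * v = if l ≡ p [MOD N] then v else 0 := by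
  simp only [eig, smul_mul_assoc, Finset.sum_mul, pow_mul_eigenvector h, smul_smul]
  rw [← Finset.sum_smul, smul_smul, sum_inv_mul_pow hN hω]
  split_ifs <;> simp

theorem sum_range_ite {M : Type*} [AddCommMonoid M] (hN : N ≠ 0) (p : ℕ) (f : ℕ → M) :
    (∑ l ∈ Finset.range N, if l ≡ p [MOD N] then f l else 0) = f (p % N) := by
  rw [Finset.sum_eq_single (p % N)]
  · rw [if_pos (Nat.mod_modEq _ _)]
  · intro l hl hne
    rw [if_neg]
    intro h
    exact hne (by rw [← h, Nat.mod_eq_of_lt (Finset.mem_range.mp hl)])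
  · intro h
    exact absurd (Finset.mem_range.mpr (Nat.mod_lt _ (by omega))) h

theorem mul_eig (hN : (N : k) ≠ 0) (hω : IsPrimitiveRoot ω N) {A : B} (hA : A ^ N = 1) (l : ℕ) :
    A * eig N ω l A = ω ^ l • eig N ω l A := by
  have h0 : N ≠ 0 := by rintro rfl; simp at hN
  have hω0 : ω ≠ 0 := hω.ne_zero h0
  -- Shifting the index by one changes nothing, because the summand has period `N`.
  have key : ∑ i ∈ Finset.range N, (ω ^ ((i + 1) * l))⁻¹ • A ^ (i + 1) =
      ∑ i ∈ Finset.range N, (ω ^ (i * l))⁻¹ • A ^ i := by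
    have h1 := Finset.sum_range_succ (fun i => (ω ^ (i * l))⁻¹ • A ^ i) N
    rw [Finset.sum_range_succ'] at h1
    have h2 : (ω ^ (N * l))⁻¹ • A ^ N = (ω ^ (0 * l))⁻¹ • A ^ 0 := by
      rw [hA, pow_mul, hω.pow_eq_one]; simp
    rw [h2] at h1
    exact add_right_cancel h1
  simp only [eig, mul_smul_comm, Finset.mul_sum, smul_comm (ω ^ l) (N : k)⁻¹]
  congr 1
  conv_rhs => rw [← key]
  rw [Finset.smul_sum]
  refine Finset.sum_congr rfl fun i _ => ?_
  rw [← pow_succ', smul_smul]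
  congr 1
  rw [add_mul, one_mul, pow_add, mul_inv]
  field_simp

theorem sum_eig (hN : (N : k) ≠ 0) (hω : IsPrimitiveRoot ω N) (A : B) :
    ∑ l ∈ Finset.range N, eig N ω l A = 1 := by
  have h0 : N ≠ 0 := by rintro rfl; simp at hN
  have hω0 : ω ≠ 0 := hω.ne_zero h0
  have hs : ∀ i ∈ Finset.range N, (N : k)⁻¹ * ∑ l ∈ Finset.range N, (ω ^ (i * l))⁻¹ =
      if i = 0 then 1 else 0 := by
    intro i hi
    have := sum_inv_mul_pow hN hω i 0
    simp only [pow_zero, one_pow, mul_one] at this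
    simp_rw [mul_comm i]
    rw [this]
    refine if_congr ?_ rfl rfl
    rw [Nat.ModEq, Nat.mod_eq_of_lt (Finset.mem_range.mp hi), Nat.zero_mod]
  simp only [eig]
  rw [← Finset.smul_sum, Finset.sum_comm]
  simp_rw [← Finset.sum_smul]
  rw [Finset.smul_sum]
  simp_rw [smul_smul]
  rw [Finset.sum_congr rfl fun i hi => by rw [hs i hi]]
  simp [ite_smul, Finset.sum_ite_eq', Nat.pos_of_ne_zero h0]

/-- The projections sum to `1`. Identities between `bich` and `quad` are thereby reduced to
comparing exponents on each eigenspace. -/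
theorem ext_eig (hN : (N : k) ≠ 0) (hω : IsPrimitiveRoot ω N) (A : B) {X Y : B}
    (h : ∀ p, X * eig N ω p A = Y * eig N ω p A) : X = Y := by
  rw [← mul_one X, ← mul_one Y, ← sum_eig hN hω A, Finset.mul_sum, Finset.mul_sum]
  exact Finset.sum_congr rfl fun p _ => h p

theorem bich_mul_eigenvector (hN : (N : k) ≠ 0) (hω : IsPrimitiveRoot ω N) {A U v : B} {p : ℕ}
    (hU : U ^ N = 1) (h : A * v = ω ^ p • v) : bich N ω A U * v = U ^ p * v := by
  have h0 : N ≠ 0 := by rintro rfl; simp at hN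
  simp only [bich, Finset.sum_mul, mul_assoc, eig_mul_eigenvector hN hω h, mul_ite, mul_zero]
  rw [sum_range_ite h0 p (fun l => U ^ l * v), pow_congr' hU (Nat.mod_modEq p N)]

theorem quad_mul_eigenvector (hN : (N : k) ≠ 0) (hω : IsPrimitiveRoot ω N) {A v : B} {p : ℕ}
    (t : ℕ) (h : A * v = ω ^ p • v) : quad N ω t A * v = ω ^ (t * p ^ 2) • v := by
  have h0 : N ≠ 0 := by rintro rfl; simp at hN
  simp only [quad, Finset.sum_mul, smul_mul_assoc, eig_mul_eigenvector hN hω h, smul_ite, smul_zero]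
  rw [sum_range_ite h0 p (fun l => ω ^ (t * l ^ 2) • v),
    pow_congr hω (((Nat.mod_modEq p N).pow 2).mul_left t)]

theorem mul_eigenvector_of_commute {A U v : B} {c : k} (hc : Commute A U) (h : A * v = c • v) :
    A * (U * v) = c • (U * v) := by
  rw [← mul_assoc, hc.eq, mul_assoc, h, mul_smul_comm]

theorem commute_eig {A U : B} (hc : Commute A U) (l : ℕ) : Commute (eig N ω l A) U := by
  refine Commute.smul_left (Commute.sum_left _ _ _ fun i _ => ?_) _
  exact (hc.pow_left i).smul_left _

/-- For commuting `A` and `A'` the products of their projections still sum to `1`, and each such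
product is a joint eigenvector. -/
theorem ext_eigenvector₂ (hN : (N : k) ≠ 0) (hω : IsPrimitiveRoot ω N) {A A' : B}
    (hA : A ^ N = 1) (hA' : A' ^ N = 1) (hc : Commute A A') {X Y : B}
    (h : ∀ p q v, A * v = ω ^ p • v → A' * v = ω ^ q • v → X * v = Y * v) : X = Y := by
  refine ext_eig hN hω A fun p => ext_eig hN hω A' fun q => ?_
  rw [mul_assoc, mul_assoc]
  refine h p q _ ?_ (mul_eigenvector_of_commute (commute_eig hc p).symm (mul_eig hN hω hA' q))
  rw [← mul_assoc, mul_eig hN hω hA p, smul_mul_assoc]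

theorem bich_mul_bich (hN : (N : k) ≠ 0) (hω : IsPrimitiveRoot ω N) {A U V : B}
    (hA : A ^ N = 1) (hU : U ^ N = 1) (hV : V ^ N = 1) (hAV : Commute A V) (hUV : Commute U V) :
    bich N ω A U * bich N ω A V = bich N ω A (U * V) := by
  refine ext_eig hN hω A fun p => ?_
  have h := mul_eig hN hω hA p
  have hUVN : (U * V) ^ N = 1 := by rw [hUV.mul_pow, hU, hV, one_mul]
  rw [mul_assoc, bich_mul_eigenvector hN hω hV h,
    bich_mul_eigenvector hN hω hU (mul_eigenvector_of_commute (hAV.pow_right p) h),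
    bich_mul_eigenvector hN hω hUVN h, hUV.mul_pow, mul_assoc]

/-- Both sides act as `ω^(p q)` on joint eigenvectors. The symmetry carries multiplicativity from
the second argument over to the first. -/
theorem bich_comm (hN : (N : k) ≠ 0) (hω : IsPrimitiveRoot ω N) {A U : B}
    (hA : A ^ N = 1) (hU : U ^ N = 1) (hAU : Commute A U) : bich N ω A U = bich N ω U A := by
  refine ext_eigenvector₂ hN hω hA hU hAU fun p q v h h' => ?_
  rw [bich_mul_eigenvector hN hω hU h, bich_mul_eigenvector hN hω hA h',
    pow_mul_eigenvector h, pow_mul_eigenvector h', ← pow_mul, ← pow_mul, mul_comm]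

theorem bich_mul_bich_left (hN : (N : k) ≠ 0) (hω : IsPrimitiveRoot ω N) {A A' U : B}
    (hA : A ^ N = 1) (hA' : A' ^ N = 1) (hU : U ^ N = 1) (hAU : Commute A U) (hAU' : Commute A' U)
    (hAA' : Commute A A') : bich N ω A U * bich N ω A' U = bich N ω (A * A') U := by
  rw [bich_comm hN hω hA hU hAU, bich_comm hN hω hA' hU hAU', bich_comm hN hω _ hU _,
    bich_mul_bich hN hω hU hA hA' hAU'.symm hAA']
  · rw [hAA'.mul_pow, hA, hA', one_mul]
  · exact hAU.mul_left hAU'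

theorem bich_one (hN : (N : k) ≠ 0) (hω : IsPrimitiveRoot ω N) (A : B) : bich N ω A 1 = 1 := by
  simp [bich, sum_eig hN hω]

theorem map_eig {C : Type*} [Ring C] [Algebra k C] (f : B →ₐ[k] C) (l : ℕ) (A : B) :
    f (eig N ω l A) = eig N ω l (f A) := by
  simp [eig]

theorem map_bich {C : Type*} [Ring C] [Algebra k C] (f : B →ₐ[k] C) (A U : B) :
    f (bich N ω A U) = bich N ω (f A) (f U) := by
  simp [bich, map_eig]

theorem map_quad {C : Type*} [Ring C] [Algebra k C] (f : B →ₐ[k] C) (t : ℕ) (A : B) :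
    f (quad N ω t A) = quad N ω t (f A) := by
  simp [quad, map_eig]

theorem semiconjBy_eig {x A A' : B} (h : SemiconjBy x A A') (l : ℕ) :
    SemiconjBy x (eig N ω l A) (eig N ω l A') := by
  have := fun i => h.pow_right i
  simp only [SemiconjBy] at this ⊢
  simp only [eig, mul_smul_comm, smul_mul_assoc, Finset.mul_sum, Finset.sum_mul, this]

/-- `bich` is a polynomial in its two arguments, so it is transported along semiconjugation; taking
`-A` for `A'` tells how `x` moves past the R-matrix. -/
theorem semiconjBy_bich {x A A' U U' : B} (hA : SemiconjBy x A A') (hU : SemiconjBy x U U') :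
    SemiconjBy x (bich N ω A U) (bich N ω A' U') := by
  have := fun l => (hU.pow_right l).mul_right (semiconjBy_eig (N := N) (ω := ω) hA l)
  simp only [SemiconjBy] at this ⊢
  simp only [bich, Finset.mul_sum, Finset.sum_mul, this]

theorem semiconjBy_quad {x A A' : B} (h : SemiconjBy x A A') (t : ℕ) :
    SemiconjBy x (quad N ω t A) (quad N ω t A') := by
  have := fun l => semiconjBy_eig (N := N) (ω := ω) h l
  simp only [SemiconjBy] at this ⊢
  simp only [quad, mul_smul_comm, smul_mul_assoc, Finset.mul_sum, Finset.sum_mul, this]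

theorem commute_bich {x A U : B} (hA : Commute x A) (hU : Commute x U) :
    Commute x (bich N ω A U) := semiconjBy_bich hA hU

end RootCalculus

/-! ### Even order: replacing an argument by its negative -/

namespace RootCalculus

variable {k : Type*} [Field k] {B : Type*} [Ring B] [Algebra k B] {n : ℕ} {ω : k}

theorem pow_half_eq_neg_one (hN : ((2 * n : ℕ) : k) ≠ 0) (hω : IsPrimitiveRoot ω (2 * n)) :
    ω ^ n = -1 := by
  have h0 : n ≠ 0 := by rintro rfl; simp at hN
  have h1 : ω ^ n ≠ 1 := hω.pow_ne_one_of_pos_of_lt h0 (by omega)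
  have h2 : (ω ^ n - 1) * (ω ^ n + 1) = 0 := by
    have := hω.pow_eq_one
    rw [mul_comm, pow_mul] at this
    linear_combination this
  rcases mul_eq_zero.mp h2 with h | h
  · exact absurd (sub_eq_zero.mp h) h1
  · exact eq_neg_of_add_eq_zero_left h

theorem neg_mul_eigenvector (hN : ((2 * n : ℕ) : k) ≠ 0) (hω : IsPrimitiveRoot ω (2 * n))
    {A v : B} {p : ℕ} (h : A * v = ω ^ p • v) : -A * v = ω ^ (n + p) • v := by
  rw [neg_mul, h, pow_add, pow_half_eq_neg_one hN hω, neg_one_mul, neg_smul]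

/-- Since `ω^n = -1`, an eigenvector of `A` with exponent `p` is one of `-A` with exponent `n + p`;
the shift produces the factor `U^n`. -/
theorem bich_neg_left (hN : ((2 * n : ℕ) : k) ≠ 0) (hω : IsPrimitiveRoot ω (2 * n)) {A U : B}
    (hA : A ^ (2 * n) = 1) (hU : U ^ (2 * n) = 1) :
    bich (2 * n) ω (-A) U = U ^ n * bich (2 * n) ω A U := by
  refine ext_eig hN hω A fun p => ?_
  have h := mul_eig hN hω hA p
  rw [bich_mul_eigenvector hN hω hU (neg_mul_eigenvector hN hω h), mul_assoc,
    bich_mul_eigenvector hN hω hU h, pow_add, mul_assoc]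

theorem bich_neg_right (hN : ((2 * n : ℕ) : k) ≠ 0) (hω : IsPrimitiveRoot ω (2 * n)) {A U : B}
    (hA : A ^ (2 * n) = 1) (hU : U ^ (2 * n) = 1) :
    bich (2 * n) ω A (-U) = bich (2 * n) ω A U * A ^ n := by
  refine ext_eig hN hω A fun p => ?_
  have h := mul_eig hN hω hA p
  have hU' : (-U) ^ (2 * n) = 1 := by rw [Even.neg_pow ⟨n, by ring⟩, hU]
  rw [bich_mul_eigenvector hN hω hU' h, mul_assoc, pow_mul_eigenvector h, mul_smul_comm,
    bich_mul_eigenvector hN hω hU h, ← pow_mul, mul_comm p n, pow_mul,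
    pow_half_eq_neg_one hN hω, neg_pow, mul_assoc]
  rcases Nat.even_or_odd p with h' | h' <;> simp [h'.neg_one_pow]

theorem mul_bich_of_neg_left (hN : ((2 * n : ℕ) : k) ≠ 0) (hω : IsPrimitiveRoot ω (2 * n))
    {A U ξ : B} (hA : A ^ (2 * n) = 1) (hU : U ^ (2 * n) = 1) (hAU : Commute A U)
    (h1 : ξ * A = -A * ξ) (h2 : Commute ξ U) :
    ξ * bich (2 * n) ω A U = bich (2 * n) ω A U * (U ^ n * ξ) := by
  have h := semiconjBy_bich (N := 2 * n) (ω := ω) (x := ξ) (A' := -A) h1 h2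
  rw [h.eq, bich_neg_left hN hω hA hU, ← mul_assoc,
    (commute_bich (hAU.symm.pow_left n) ((Commute.refl U).pow_left n)).eq]

theorem mul_bich_of_neg_right (hN : ((2 * n : ℕ) : k) ≠ 0) (hω : IsPrimitiveRoot ω (2 * n))
    {A U ξ : B} (hA : A ^ (2 * n) = 1) (hU : U ^ (2 * n) = 1)
    (h1 : Commute ξ A) (h2 : ξ * U = -U * ξ) :
    ξ * bich (2 * n) ω A U = bich (2 * n) ω A U * (A ^ n * ξ) := by
  have h := semiconjBy_bich (N := 2 * n) (ω := ω) (x := ξ) (U' := -U) h1 h2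
  rw [h.eq, bich_neg_right hN hω hA hU, mul_assoc]

end RootCalculus

/-! ### The R-matrix: factorization, invertibility, intertwining property -/

namespace Radford

open RootCalculus

variable {k : Type u} [Field k] {n : ℕ} {ω : k} {s : ℕ} {β : k}

/-- Each term of the `β`-sum factors as `(a^i ⊗ a^(sl)) (x ⊗ a^n x)`, so the same bicharacter comes
out of both sums. -/
theorem rMatrix_eq : rMatrix n ω s β =
    bich (2 * n) ω (a k n ⊗ₜ[k] (1 : Radford k n)) ((1 : Radford k n) ⊗ₜ[k] (a k n ^ s)) *
      (1 + β • (x k n ⊗ₜ[k] (a k n ^ n * x k n))) := by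
  have h0 : bich (2 * n) ω (a k n ⊗ₜ[k] (1 : Radford k n)) ((1 : Radford k n) ⊗ₜ[k] (a k n ^ s)) =
      ((2 * n : ℕ) : k)⁻¹ • (∑ i ∈ Finset.range (2 * n), ∑ l ∈ Finset.range (2 * n),
      (ω ^ (i * l))⁻¹ • ((a k n ^ i) ⊗ₜ[k] (a k n ^ (s * l)))) := by
    rw [Finset.sum_comm, Finset.smul_sum]
    refine Finset.sum_congr rfl fun l _ => ?_
    rw [eig, mul_smul_comm, Finset.mul_sum]
    congr 1
    refine Finset.sum_congr rfl fun i _ => ?_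
    simp [Algebra.TensorProduct.tmul_pow, ← pow_mul]
  rw [h0, mul_add, mul_one, rMatrix]
  congr 1
  rw [mul_smul_comm, smul_mul_assoc, smul_smul, div_eq_mul_inv, Finset.sum_mul]
  congr 1
  refine Finset.sum_congr rfl fun i _ => ?_
  rw [Finset.sum_mul]
  refine Finset.sum_congr rfl fun l _ => ?_
  rw [smul_mul_assoc, Algebra.TensorProduct.tmul_mul_tmul, ← mul_assoc, ← pow_add]

theorem x_mul_x : x k n * x k n = 0 := by rw [← sq, x_sq]

theorem x_mul_a : x k n * a k n = -(a k n * x k n) := by rw [a_mul_x, neg_neg]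

theorem a_pow_mul_odd (hs : Odd s) : a k n ^ (s * n) = a k n ^ n := by
  obtain ⟨m, rfl⟩ := hs
  rw [show (2 * m + 1) * n = 2 * n * m + n by ring, pow_add, pow_mul, a_pow, one_pow, one_mul]

theorem a_pow_n_mul_a_pow_n : a k n ^ n * a k n ^ n = 1 := by
  rw [← pow_add, ← two_mul, a_pow]

theorem a_pow_pow (i : ℕ) : (a k n ^ i) ^ (2 * n) = 1 := by
  rw [← pow_mul, mul_comm, pow_mul, a_pow, one_pow]

variable [hn : Fact (Odd n)]

theorem comul_a : Coalgebra.comul (R := k) (a k n) = a k n ⊗ₜ[k] a k n :=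
  lift_a _ _ _ _ _

theorem comul_x : Coalgebra.comul (R := k) (x k n) =
    x k n ⊗ₜ[k] (a k n ^ n) + (1 : Radford k n) ⊗ₜ[k] x k n :=
  lift_x _ _ _ _ _

theorem counit_a : Coalgebra.counit (R := k) (a k n) = 1 := lift_a _ _ _ _ _

theorem counit_x : Coalgebra.counit (R := k) (x k n) = 0 := lift_x _ _ _ _ _

theorem antipode_a : HopfAlgebra.antipode k (a k n) = a k n ^ (2 * n - 1) := antipodeLin_a

theorem antipode_x : HopfAlgebra.antipode k (x k n) = a k n ^ n * x k n := antipodeLin_x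

theorem comul_mul (u v : Radford k n) : Coalgebra.comul (R := k) (u * v) =
    Coalgebra.comul (R := k) u * Coalgebra.comul (R := k) v :=
  map_mul (comulHom k n) u v

theorem comul_a_pow (i : ℕ) : Coalgebra.comul (R := k) (a k n ^ i) =
    (a k n ^ i) ⊗ₜ[k] (a k n ^ i) := by
  rw [← Algebra.TensorProduct.tmul_pow, ← comul_a]
  exact map_pow (comulHom k n) _ _

end Radford

namespace Radford

open RootCalculus

variable {k : Type u} [Field k] {n : ℕ} {ω : k} {s : ℕ} {β : k}

theorem tmul_one_pow (i : ℕ) : (a k n ⊗ₜ[k] (1 : Radford k n)) ^ i = (a k n ^ i) ⊗ₜ 1 := by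
  simp [Algebra.TensorProduct.tmul_pow]

theorem one_tmul_pow (u : Radford k n) (i : ℕ) :
    ((1 : Radford k n) ⊗ₜ[k] u) ^ i = 1 ⊗ₜ (u ^ i) := by
  simp [Algebra.TensorProduct.tmul_pow]

theorem x_mul_odd (hs : Odd s) : x k n * a k n ^ s = -a k n ^ s * x k n := by
  rw [x_mul_a_pow, hs.neg_one_pow]; simp

theorem x_mul_even (hs : Even s) : x k n * a k n ^ s = a k n ^ s * x k n := by
  rw [x_mul_a_pow, hs.neg_one_pow]; simp

theorem one_add_mul_one_add {B : Type*} [Ring B] [Algebra k B] (b c : k) {u v : B}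
    (h : u * v = 0) : (1 + b • u) * (1 + c • v) = 1 + b • u + c • v := by
  simp [add_mul, mul_add, h, add_assoc]

theorem tmul_x_mul_self : (x k n ⊗ₜ[k] (a k n ^ n * x k n)) * (x k n ⊗ₜ[k] (a k n ^ n * x k n)) = 0 := by
  simp [x_mul_x]

/-- The semisimple part of the R-matrix. -/
noncomputable def rZero (k : Type u) [Field k] (n : ℕ) (ω : k) (s : ℕ) :
    Radford k n ⊗[k] Radford k n :=
  bich (2 * n) ω (a k n ⊗ₜ[k] (1 : Radford k n)) ((1 : Radford k n) ⊗ₜ[k] (a k n ^ s))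

section
variable (hN : ((2 * n : ℕ) : k) ≠ 0) (hω : IsPrimitiveRoot ω (2 * n))
include hN hω

/-- The bicharacter is inverted by replacing `U` with `U^(2n-1) = U⁻¹`; the other factor is `1` plus
an element of square zero. -/
theorem isUnit_rMatrix : IsUnit (rMatrix n ω s β) := by
  rw [rMatrix_eq]
  have hc : Commute (a k n ⊗ₜ[k] (1 : Radford k n)) ((1 : Radford k n) ⊗ₜ[k] (a k n ^ s)) := by
    simp [Commute, SemiconjBy]
  have hA : (a k n ⊗ₜ[k] (1 : Radford k n)) ^ (2 * n) = 1 := by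
    rw [tmul_one_pow, a_pow]; rfl
  have hU : ((1 : Radford k n) ⊗ₜ[k] (a k n ^ s)) ^ (2 * n) = 1 := by
    rw [one_tmul_pow, a_pow_pow]; rfl
  have h0 : 2 * n ≠ 0 := by rintro h; simp [h] at hN
  refine IsUnit.mul ?_ ?_
  · have hV : ∀ j, (((1 : Radford k n) ⊗ₜ[k] (a k n ^ s)) ^ j) ^ (2 * n) = 1 := fun j => by
      rw [← pow_mul, mul_comm, pow_mul, hU, one_pow]
    refine isUnit_iff_exists.mpr ⟨bich (2 * n) ω (a k n ⊗ₜ[k] (1 : Radford k n))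
      (((1 : Radford k n) ⊗ₜ[k] (a k n ^ s)) ^ (2 * n - 1)), ?_, ?_⟩
    · rw [bich_mul_bich hN hω hA hU (hV _) (hc.pow_right _) ((Commute.refl _).pow_right _),
        ← pow_succ', Nat.sub_add_cancel (by omega), hU, bich_one hN hω]
    · rw [bich_mul_bich hN hω hA (hV _) hU hc ((Commute.refl _).pow_left _),
        ← pow_succ, Nat.sub_add_cancel (by omega), hU, bich_one hN hω]
  · refine isUnit_iff_exists.mpr ⟨1 + (-β) • (x k n ⊗ₜ[k] (a k n ^ n * x k n)), ?_, ?_⟩ <;>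
      rw [one_add_mul_one_add _ _ tmul_x_mul_self] <;> simp

/-- Moving `x` past `a` in the first factor leaves `(a^s)^n` in the second, which is `a^n` because
`s` is odd. -/
theorem x_tmul_one_mul_rZero (hs : Odd s) : (x k n ⊗ₜ[k] (1 : Radford k n)) * rZero k n ω s =
    rZero k n ω s * (x k n ⊗ₜ[k] (a k n ^ n)) := by
  rw [rZero, mul_bich_of_neg_left hN hω]
  · rw [one_tmul_pow, ← pow_mul, a_pow_mul_odd hs]
    simp
  · rw [tmul_one_pow, a_pow]; rfl
  · rw [one_tmul_pow, a_pow_pow]; rfl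
  · simp [Commute, SemiconjBy]
  · simp [x_mul_a, TensorProduct.neg_tmul]
  · simp [Commute, SemiconjBy]

theorem one_tmul_x_mul_rZero (hs : Odd s) : ((1 : Radford k n) ⊗ₜ[k] x k n) * rZero k n ω s =
    rZero k n ω s * ((a k n ^ n) ⊗ₜ[k] x k n) := by
  rw [rZero, mul_bich_of_neg_right hN hω]
  · rw [tmul_one_pow]
    simp
  · rw [tmul_one_pow, a_pow]; rfl
  · rw [one_tmul_pow, a_pow_pow]; rfl
  · simp [Commute, SemiconjBy]
  · simp [x_mul_odd hs, TensorProduct.tmul_neg]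

omit hN hω in
theorem tmul_a_pow_mul_rZero (i j : ℕ) : ((a k n ^ i) ⊗ₜ[k] (a k n ^ j)) * rZero k n ω s =
    rZero k n ω s * ((a k n ^ i) ⊗ₜ[k] (a k n ^ j)) := by
  refine (commute_bich ?_ ?_).eq <;> simp [Commute, SemiconjBy, ← pow_succ, ← pow_succ', ← pow_add, add_comm]

/-- Both sides are multiplicative in `h`, so generators suffice. For `x`, the two commutation rules
turn `Δ^op(x) R₀` into `R₀ Δ(x)`, and the products of `Δ(x)` with `x ⊗ a^n x` vanish because `x² =
0`. -/
theorem rMatrix_mul_comul [hn : Fact (Odd n)] (hs : Odd s) (h : Radford k n) :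
    rMatrix n ω s β * Coalgebra.comul (R := k) h =
      TensorProduct.comm k _ _ (Coalgebra.comul (R := k) h) * rMatrix n ω s β := by
  have hmul : ∀ u v : Radford k n, TensorProduct.comm k _ _ (Coalgebra.comul (R := k) (u * v)) =
      TensorProduct.comm k _ _ (Coalgebra.comul (R := k) u) *
      TensorProduct.comm k _ _ (Coalgebra.comul (R := k) v) := fun u v => by
    rw [comul_mul]
    exact map_mul (Algebra.TensorProduct.comm k (Radford k n) (Radford k n)) _ _
  induction h using induction with
  | hadd u v hu hv => simp only [map_add, mul_add, add_mul, hu, hv]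
  | halg r =>
    rw [Algebra.algebraMap_eq_smul_one, map_smul, map_smul, Bialgebra.comul_one,
      Algebra.TensorProduct.one_def, TensorProduct.comm_tmul, ← Algebra.TensorProduct.one_def]
    simp
  | hmul u v hu hv => rw [hmul, comul_mul, ← mul_assoc, hu, mul_assoc, hv, mul_assoc]
  | ha =>
    rw [comul_a, TensorProduct.comm_tmul, rMatrix_eq]
    change rZero k n ω s * _ * _ = _ * (rZero k n ω s * _)
    have := tmul_a_pow_mul_rZero (k := k) (n := n) (ω := ω) (s := s) 1 1
    rw [pow_one] at this
    rw [← mul_assoc, this, mul_assoc, mul_assoc]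
    congr 1
    simp only [add_mul, mul_add, one_mul, mul_one, smul_mul_assoc, mul_smul_comm,
      Algebra.TensorProduct.tmul_mul_tmul, x_mul_a, ← mul_assoc, ← pow_succ']
    simp only [mul_assoc, x_mul_a, TensorProduct.neg_tmul, TensorProduct.tmul_neg, mul_neg,
      neg_neg]
    simp only [← mul_assoc, ← pow_succ]
  | hx =>
    rw [comul_x, map_add, TensorProduct.comm_tmul, TensorProduct.comm_tmul, rMatrix_eq]
    change rZero k n ω s * _ * _ = _ * (rZero k n ω s * _)
    -- `a^n ⊗ 1` commutes with `R₀` and cancels against the `a^n` produced by moving `1 ⊗ x`.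
    have e1 : ((a k n ^ n) ⊗ₜ[k] x k n) * rZero k n ω s =
        rZero k n ω s * ((1 : Radford k n) ⊗ₜ[k] x k n) := by
      have := tmul_a_pow_mul_rZero (k := k) (n := n) (ω := ω) (s := s) n 0
      rw [show ((a k n ^ n) ⊗ₜ[k] x k n) = ((a k n ^ n) ⊗ₜ[k] (a k n ^ 0)) * (1 ⊗ₜ x k n) by simp,
        mul_assoc, one_tmul_x_mul_rZero hN hω hs, ← mul_assoc, this]
      simp [mul_assoc, a_pow_n_mul_a_pow_n]
    rw [← mul_assoc, add_mul ((a k n ^ n) ⊗ₜ[k] x k n), e1, x_tmul_one_mul_rZero hN hω hs, ← mul_add,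
      mul_assoc, mul_assoc]
    congr 1
    simp only [add_mul, mul_add, one_mul, mul_one, smul_mul_assoc, mul_smul_comm,
      Algebra.TensorProduct.tmul_mul_tmul, x_mul_x, TensorProduct.zero_tmul, smul_zero, add_zero, ← mul_assoc,
      x_mul_a_pow_n]
    simp only [mul_assoc, x_mul_x, neg_mul, mul_zero, neg_zero, TensorProduct.tmul_zero, smul_zero,
      add_zero]
    abel

end

end Radford

/-! ### The hexagon identities -/

namespace Radford

open RootCalculus

variable {k : Type u} [Field k] {n : ℕ} {ω : k} {s : ℕ} {β : k}

theorem map_rMatrix {B : Type*} [Ring B] [Algebra k B] (f : Radford k n ⊗[k] Radford k n →ₐ[k] B) :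
    f (rMatrix n ω s β) = bich (2 * n) ω (f (a k n ⊗ₜ 1)) (f (1 ⊗ₜ (a k n ^ s))) *
      (1 + β • f (x k n ⊗ₜ (a k n ^ n * x k n))) := by
  rw [rMatrix_eq, map_mul, map_bich, map_add, map_smul, map_one]

theorem tmul_three_pow {B C D : Type*} [Ring B] [Algebra k B] [Ring C] [Algebra k C] [Ring D]
    [Algebra k D] (b : B) (c : C) (d : D) (i : ℕ) :
    (b ⊗ₜ[k] (c ⊗ₜ[k] d)) ^ i = (b ^ i) ⊗ₜ[k] ((c ^ i) ⊗ₜ[k] (d ^ i)) := by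
  simp [Algebra.TensorProduct.tmul_pow]

theorem comul_a_pow_mul_x [Fact (Odd n)] (i : ℕ) : Coalgebra.comul (R := k) (a k n ^ i * x k n) =
    (a k n ^ i * x k n) ⊗ₜ[k] (a k n ^ (i + n)) + (a k n ^ i) ⊗ₜ[k] (a k n ^ i * x k n) := by
  rw [comul_mul, comul_a_pow, comul_x]
  simp [mul_add, pow_add]

section
variable (hN : ((2 * n : ℕ) : k) ≠ 0) (hω : IsPrimitiveRoot ω (2 * n)) [hn : Fact (Odd n)]
include hN hω

/-- As `a^s` is grouplike, the semisimple parts agree by multiplicativity of `bich` in its second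
argument. The unipotent parts multiply additively, since the product of their nilpotent terms
contains `x²`. -/
theorem comul_right_rMatrix (hs : Odd s) :
    (Coalgebra.comul (R := k) (A := Radford k n)).lTensor (Radford k n) (rMatrix n ω s β) =
    Algebra.TensorProduct.map (AlgHom.id k (Radford k n)) Algebra.TensorProduct.includeRight
        (rMatrix n ω s β) *
      Algebra.TensorProduct.map (AlgHom.id k (Radford k n)) Algebra.TensorProduct.includeLeft
        (rMatrix n ω s β) := by
  have h1 : (Coalgebra.comul (R := k) (A := Radford k n)).lTensor (Radford k n) (rMatrix n ω s β) =
      Algebra.TensorProduct.map (AlgHom.id k (Radford k n)) (comulHom k n) (rMatrix n ω s β) := rfl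
  have h2 : comulHom k n (a k n ^ s) = (a k n ^ s) ⊗ₜ (a k n ^ s) := comul_a_pow s
  have h3 : comulHom k n (a k n ^ n * x k n) = _ := comul_a_pow_mul_x n
  rw [h1, map_rMatrix, map_rMatrix, map_rMatrix]
  simp only [Algebra.TensorProduct.map_tmul, h2, h3, map_one, AlgHom.id_apply,
    Algebra.TensorProduct.includeRight_apply, Algebra.TensorProduct.includeLeft_apply,
    Algebra.TensorProduct.one_def]
  have hc : ∀ u v : Radford k n, Commute u v → ∀ u' v' : Radford k n, Commute u' v' →
    ∀ u'' v'' : Radford k n, Commute u'' v'' →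
    Commute (u ⊗ₜ[k] (u' ⊗ₜ[k] u'')) (v ⊗ₜ[k] (v' ⊗ₜ[k] v'')) := by
    intro u v h u' v' h' u'' v'' h''
    simp [Commute, SemiconjBy, h.eq, h'.eq, h''.eq]
  have hA : (a k n ⊗ₜ[k] ((1 : Radford k n) ⊗ₜ[k] (1 : Radford k n))) ^ (2 * n) = 1 := by
    rw [tmul_three_pow, a_pow, one_pow]; rfl
  have hU : ((1 : Radford k n) ⊗ₜ[k] ((a k n ^ s) ⊗ₜ[k] (1 : Radford k n))) ^ (2 * n) = 1 := by
    rw [tmul_three_pow, a_pow_pow, one_pow]; rfl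
  have hV : ((1 : Radford k n) ⊗ₜ[k] ((1 : Radford k n) ⊗ₜ[k] (a k n ^ s))) ^ (2 * n) = 1 := by
    rw [tmul_three_pow, a_pow_pow, one_pow]; rfl
  -- The `x` in the first slot passes the bicharacter of slots one and two and leaves `(a^s)^n =
  -- a^n` in the middle: this is the `a^n` in the term `a^n ⊗ a^n x` of `Δ(a^n x)`.
  have key : (1 + β • (x k n ⊗ₜ[k] ((1 : Radford k n) ⊗ₜ[k] (a k n ^ n * x k n)))) *
      bich (2 * n) ω (a k n ⊗ₜ[k] ((1 : Radford k n) ⊗ₜ[k] (1 : Radford k n)))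
        ((1 : Radford k n) ⊗ₜ[k] ((a k n ^ s) ⊗ₜ[k] (1 : Radford k n))) =
      bich (2 * n) ω (a k n ⊗ₜ[k] ((1 : Radford k n) ⊗ₜ[k] (1 : Radford k n)))
        ((1 : Radford k n) ⊗ₜ[k] ((a k n ^ s) ⊗ₜ[k] (1 : Radford k n))) *
      (1 + β • (x k n ⊗ₜ[k] ((a k n ^ n) ⊗ₜ[k] (a k n ^ n * x k n)))) := by
    rw [add_mul, mul_add, one_mul, mul_one, smul_mul_assoc, mul_smul_comm,
      mul_bich_of_neg_left hN hω hA hU]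
    · rw [tmul_three_pow, ← pow_mul, a_pow_mul_odd hs]
      simp
    · apply hc <;> simp
    · rw [← TensorProduct.neg_tmul]
      simp [x_mul_a]
    · apply hc <;> simp
  have hone : (1 : Radford k n) ⊗ₜ[k] ((1 : Radford k n) ⊗ₜ[k] (1 : Radford k n)) = 1 := rfl
  simp only [hone]
  rw [mul_assoc, ← mul_assoc (_ + _) (bich _ _ _ _), key, ← mul_assoc, ← mul_assoc,
    bich_mul_bich hN hω hA hV hU, mul_assoc, one_add_mul_one_add, TensorProduct.tmul_add]
  · simp only [Algebra.TensorProduct.tmul_mul_tmul, one_mul, mul_one, ← two_mul, a_pow]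
    rw [add_assoc, ← smul_add, add_comm (x k n ⊗ₜ[k] _)]
  · simp [x_mul_x]
  · apply hc <;> simp
  · apply hc <;> simp

/-- The mirror image of the other hexagon, with multiplicativity of `bich` in its first argument. -/
theorem comul_left_rMatrix (hs : Odd s) :
    TensorProduct.assoc k (Radford k n) (Radford k n) (Radford k n)
      ((Coalgebra.comul (R := k) (A := Radford k n)).rTensor (Radford k n) (rMatrix n ω s β)) =
    Algebra.TensorProduct.map (AlgHom.id k (Radford k n)) Algebra.TensorProduct.includeRight
        (rMatrix n ω s β) *
      (Algebra.TensorProduct.includeRight : Radford k n ⊗[k] Radford k n →ₐ[k]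
        Radford k n ⊗[k] (Radford k n ⊗[k] Radford k n)) (rMatrix n ω s β) := by
  have h1 : TensorProduct.assoc k (Radford k n) (Radford k n) (Radford k n)
      ((Coalgebra.comul (R := k) (A := Radford k n)).rTensor (Radford k n) (rMatrix n ω s β)) =
      ((Algebra.TensorProduct.assoc k k k (Radford k n) (Radford k n) (Radford k n)).toAlgHom.comp
      (Algebra.TensorProduct.map (comulHom k n) (AlgHom.id k (Radford k n)))) (rMatrix n ω s β) :=
    rfl
  have h2 : comulHom k n (a k n) = (a k n) ⊗ₜ (a k n) := comul_a
  have h3 : comulHom k n (x k n) = _ := comul_x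
  rw [h1, map_rMatrix, map_rMatrix, map_rMatrix]
  simp only [Algebra.TensorProduct.map_tmul, h2, h3, map_one, AlgHom.id_apply,
    Algebra.TensorProduct.includeRight_apply, AlgHom.comp_apply,
    TensorProduct.add_tmul, map_add]
  have hass : ∀ u v w : Radford k n, (Algebra.TensorProduct.assoc k k k (Radford k n)
      (Radford k n) (Radford k n)).toAlgHom ((u ⊗ₜ v) ⊗ₜ w) = u ⊗ₜ (v ⊗ₜ w) := fun _ _ _ => rfl
  simp only [Algebra.TensorProduct.one_def, hass]
  have hc : ∀ u v : Radford k n, Commute u v → ∀ u' v' : Radford k n, Commute u' v' →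
    ∀ u'' v'' : Radford k n, Commute u'' v'' →
    Commute (u ⊗ₜ[k] (u' ⊗ₜ[k] u'')) (v ⊗ₜ[k] (v' ⊗ₜ[k] v'')) := by
    intro u v h u' v' h' u'' v'' h''
    simp [Commute, SemiconjBy, h.eq, h'.eq, h''.eq]
  have hA : (a k n ⊗ₜ[k] ((1 : Radford k n) ⊗ₜ[k] (1 : Radford k n))) ^ (2 * n) = 1 := by
    rw [tmul_three_pow, a_pow, one_pow]; rfl
  have hU : ((1 : Radford k n) ⊗ₜ[k] ((a k n) ⊗ₜ[k] (1 : Radford k n))) ^ (2 * n) = 1 := by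
    rw [tmul_three_pow, a_pow, one_pow]; rfl
  have hV : ((1 : Radford k n) ⊗ₜ[k] ((1 : Radford k n) ⊗ₜ[k] (a k n ^ s))) ^ (2 * n) = 1 := by
    rw [tmul_three_pow, a_pow_pow, one_pow]; rfl
  -- Here the `x` in the third slot passes the bicharacter of slots two and three; the `a^n` left in
  -- the middle is the one in the term `x ⊗ a^n` of `Δ(x)`.
  have key : (1 + β • (x k n ⊗ₜ[k] ((1 : Radford k n) ⊗ₜ[k] (a k n ^ n * x k n)))) *
      bich (2 * n) ω ((1 : Radford k n) ⊗ₜ[k] (a k n ⊗ₜ[k] (1 : Radford k n)))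
        ((1 : Radford k n) ⊗ₜ[k] ((1 : Radford k n) ⊗ₜ[k] (a k n ^ s))) =
      bich (2 * n) ω ((1 : Radford k n) ⊗ₜ[k] (a k n ⊗ₜ[k] (1 : Radford k n)))
        ((1 : Radford k n) ⊗ₜ[k] ((1 : Radford k n) ⊗ₜ[k] (a k n ^ s))) *
      (1 + β • (x k n ⊗ₜ[k] ((a k n ^ n) ⊗ₜ[k] (a k n ^ n * x k n)))) := by
    rw [add_mul, mul_add, one_mul, mul_one, smul_mul_assoc, mul_smul_comm,
      mul_bich_of_neg_right hN hω hU hV]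
    · rw [tmul_three_pow]
      simp
    · apply hc <;> simp
    · simp only [Algebra.TensorProduct.tmul_mul_tmul, neg_mul, ← TensorProduct.tmul_neg, mul_assoc,
        x_mul_odd hs, one_mul, mul_one]
      simp only [← mul_assoc, mul_neg, ← pow_add, add_comm n s]
  have hone : (1 : Radford k n) ⊗ₜ[k] ((1 : Radford k n) ⊗ₜ[k] (1 : Radford k n)) = 1 := rfl
  simp only [hone]
  rw [mul_assoc, ← mul_assoc (_ + _) (bich _ _ _ _), key, ← mul_assoc, ← mul_assoc,
    bich_mul_bich_left hN hω hA hU hV, mul_assoc, one_add_mul_one_add]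
  · simp only [Algebra.TensorProduct.tmul_mul_tmul, one_mul, mul_one, smul_add, add_assoc]
  · simp only [Algebra.TensorProduct.tmul_mul_tmul, mul_assoc]
    simp only [← mul_assoc (x k n), x_mul_a_pow_n]
    simp [mul_assoc, x_mul_x]
  all_goals apply hc <;> simp

end

end Radford

/-! ### The twist and the ribbon structure -/

namespace Radford

open RootCalculus

variable {k : Type u} [Field k] {n : ℕ} {ω : k} {s : ℕ} {β : k}

theorem idem_eq (l : ℕ) : idem n ω l = eig (2 * n) ω l (a k n) := rfl

theorem twist_eq : twist n ω s = a k n ^ n * quad (2 * n) ω s (a k n) := by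
  simp only [twist, chi, quad, idem_eq, ← pow_mul]

theorem commute_a_quad (i t : ℕ) : Commute (a k n ^ i) (quad (2 * n) ω t (a k n)) :=
  semiconjBy_quad ((Commute.refl _).pow_left i) t

section
variable [hn : Fact (Odd n)]

theorem antipode_mul (u v : Radford k n) : HopfAlgebra.antipode k (u * v) =
    HopfAlgebra.antipode k v * HopfAlgebra.antipode k u := antipodeLin_mul u v

theorem antipode_a_pow (i : ℕ) : HopfAlgebra.antipode k (a k n ^ i) = (a k n ^ (2 * n - 1)) ^ i := by
  induction i with
  | zero => simp
  | succ i ih => rw [pow_succ, antipode_mul, ih, antipode_a, ← pow_succ']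

theorem antipode_a_pow_n : HopfAlgebra.antipode k (a k n ^ n) = a k n ^ n := by
  have hpos := hn.out.pos
  rw [antipode_a_pow, ← pow_mul, a_pow_mul_odd ⟨n - 1, by omega⟩]

theorem antipode_eig (l : ℕ) : HopfAlgebra.antipode k (eig (2 * n) ω l (a k n)) =
    eig (2 * n) ω l (a k n ^ (2 * n - 1)) := by
  simp [eig, antipode_a_pow]

theorem antipode_quad (t : ℕ) : HopfAlgebra.antipode k (quad (2 * n) ω t (a k n)) =
    quad (2 * n) ω t (a k n ^ (2 * n - 1)) := by
  simp [quad, antipode_eig]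

end

section
variable (hN : ((2 * n : ℕ) : k) ≠ 0) (hω : IsPrimitiveRoot ω (2 * n))
include hN hω

theorem quad_mul_quad (t t' : ℕ) : quad (2 * n) ω t (a k n) * quad (2 * n) ω t' (a k n) =
    quad (2 * n) ω (t + t') (a k n) := by
  refine ext_eig hN hω (a k n) fun p => ?_
  have h := mul_eig hN hω (a_pow k n) p
  rw [mul_assoc, quad_mul_eigenvector hN hω t' h, mul_smul_comm, quad_mul_eigenvector hN hω t h,
    quad_mul_eigenvector hN hω _ h, smul_smul, add_mul, pow_add, mul_comm]

theorem quad_two_n_mul (t : ℕ) : quad (2 * n) ω (2 * n * t) (a k n) = 1 := by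
  refine ext_eig hN hω (a k n) fun p => ?_
  rw [quad_mul_eigenvector hN hω _ (mul_eig hN hω (a_pow k n) p), mul_assoc, pow_mul,
    hω.pow_eq_one]
  simp

/-- The exponent `(2n - 1) t` stands for `-t` modulo `2n`. -/
theorem quad_mul_quad_inv (t : ℕ) : quad (2 * n) ω t (a k n) *
    quad (2 * n) ω ((2 * n - 1) * t) (a k n) = 1 := by
  have h0 : n ≠ 0 := by rintro rfl; simp at hN
  rw [quad_mul_quad hN hω, ← quad_two_n_mul hN hω t]
  congr 1
  obtain ⟨m, hm⟩ : ∃ m, 2 * n = m + 1 := ⟨2 * n - 1, by omega⟩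
  rw [hm, Nat.add_sub_cancel]
  ring

theorem twist_mul_inv (s : ℕ) : twist n ω s * (a k n ^ n * quad (2 * n) ω ((2 * n - 1) * s) (a k n)) = 1 := by
  rw [twist_eq, (commute_a_quad n s).eq, mul_assoc, ← mul_assoc (a k n ^ n), a_pow_n_mul_a_pow_n,
    one_mul, quad_mul_quad_inv hN hω]

theorem inv_mul_twist (s : ℕ) : (a k n ^ n * quad (2 * n) ω ((2 * n - 1) * s) (a k n)) * twist n ω s = 1 := by
  rw [twist_eq, (commute_a_quad n _).eq, mul_assoc, ← mul_assoc (a k n ^ n), a_pow_n_mul_a_pow_n,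
    one_mul, quad_mul_quad hN hω, add_comm, ← quad_mul_quad hN hω, quad_mul_quad_inv hN hω]

theorem isUnit_twist (s : ℕ) : IsUnit (twist n ω s : Radford k n) :=
  isUnit_iff_exists.mpr ⟨_, twist_mul_inv hN hω s, inv_mul_twist hN hω s⟩

variable [hn : Fact (Odd n)]

/-- In `s (n + p)² = s n² + 2n s p + s p²` the middle term is a multiple of `2n`, and `ω^(s n²) =
(-1)^(s n) = -1` because `s` and `n` are odd. -/
theorem quad_neg (hs : Odd s) : quad (2 * n) ω s (-a k n) = -quad (2 * n) ω s (a k n) := by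
  refine ext_eig hN hω (a k n) fun p => ?_
  have h := mul_eig hN hω (a_pow k n) p
  rw [quad_mul_eigenvector hN hω s (neg_mul_eigenvector hN hω h), neg_mul,
    quad_mul_eigenvector hN hω s h, ← neg_smul]
  congr 1
  rw [show s * (n + p) ^ 2 = n * (s * n) + (2 * n) * (s * p) + s * p ^ 2 by ring, pow_add, pow_add,
    pow_mul, pow_half_eq_neg_one hN hω, (hs.mul hn.out).neg_one_pow, pow_mul ω (2 * n),
    hω.pow_eq_one]
  simp

/-- Moving `x` past the quadratic part costs a sign, and moving it past `a^n` costs another, since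
`n` is odd; the two cancel. -/
theorem twist_central (hs : Odd s) (h : Radford k n) : twist n ω s * h = h * twist n ω s := by
  induction h using induction with
  | hadd u v hu hv => rw [mul_add, add_mul, hu, hv]
  | halg r => rw [Algebra.commutes]
  | hmul u v hu hv => rw [← mul_assoc, hu, mul_assoc, hv, mul_assoc]
  | ha =>
    have := commute_a_quad (k := k) (n := n) (ω := ω) 1 s
    rw [pow_one] at this
    rw [twist_eq, ← mul_assoc, ← pow_succ', mul_assoc, ← this.eq, ← mul_assoc, ← pow_succ]
  | hx =>
    have h1 : SemiconjBy (x k n) (a k n) (-a k n) := by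
      rw [SemiconjBy, neg_mul, x_mul_a]
    have h2 := (semiconjBy_quad (N := 2 * n) (ω := ω) h1 s).eq
    rw [quad_neg hN hω hs] at h2
    rw [twist_eq, ← mul_assoc, x_mul_a_pow_n, neg_mul, mul_assoc, mul_assoc, h2]
    simp

/-- The antipode inverts `a`, hence replaces `p` by `-p`, which `p²` does not see. -/
theorem antipode_twist (s : ℕ) :
    HopfAlgebra.antipode k (twist n ω s) = (twist n ω s : Radford k n) := by
  have hpos := hn.out.pos
  rw [twist_eq, antipode_mul, antipode_quad, antipode_a_pow_n, (commute_a_quad n s).eq]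
  congr 1
  refine ext_eig hN hω (a k n) fun p => ?_
  have h := mul_eig hN hω (a_pow k n) p
  have h' := pow_mul_eigenvector h (2 * n - 1)
  rw [← pow_mul] at h'
  rw [quad_mul_eigenvector hN hω s h', quad_mul_eigenvector hN hω s h]
  congr 1
  refine pow_congr hω (Nat.ModEq.mul_left s ?_)
  -- `m = 2n - 1` is `-1` modulo `2n`, so its square is `1`.
  obtain ⟨m, hm⟩ : ∃ m, 2 * n = m + 1 := ⟨2 * n - 1, by omega⟩
  rw [hm, Nat.add_sub_cancel, mul_pow]
  have : m ^ 2 ≡ 1 [MOD (m + 1)] := by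
    refine (Nat.ModEq.symm ?_)
    rw [Nat.modEq_iff_dvd]
    exact ⟨m - 1, by push_cast; ring⟩
  simpa using this.mul_left (p ^ 2)

omit hn in
-- The exponent `s p q` is symmetric in `p` and `q`.
theorem comm_rZero : TensorProduct.comm k _ _ (rZero k n ω s) = rZero k n ω s := by
  have h1 : TensorProduct.comm k _ _ (rZero k n ω s) =
      (Algebra.TensorProduct.comm k (Radford k n) (Radford k n)).toAlgHom (rZero k n ω s) := rfl
  have h2 : ∀ u v : Radford k n, (Algebra.TensorProduct.comm k (Radford k n)
      (Radford k n)).toAlgHom (u ⊗ₜ v) = v ⊗ₜ u := fun _ _ => rfl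
  rw [h1, rZero, map_bich, h2, h2]
  have hA : (a k n ⊗ₜ[k] (1 : Radford k n)) ^ (2 * n) = 1 := by
    rw [tmul_one_pow, a_pow]; rfl
  have hB : ((1 : Radford k n) ⊗ₜ[k] (a k n)) ^ (2 * n) = 1 := by
    rw [one_tmul_pow, a_pow]; rfl
  have hc : Commute (a k n ⊗ₜ[k] (1 : Radford k n)) ((1 : Radford k n) ⊗ₜ[k] (a k n)) := by
    simp [Commute, SemiconjBy]
  have hs1 : ((a k n ^ s) ⊗ₜ[k] (1 : Radford k n)) = (a k n ⊗ₜ[k] (1 : Radford k n)) ^ s := by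
    rw [tmul_one_pow]
  have hs2 : ((1 : Radford k n) ⊗ₜ[k] (a k n ^ s)) = ((1 : Radford k n) ⊗ₜ[k] (a k n)) ^ s := by
    rw [one_tmul_pow]
  have hcp : ∀ {y : Radford k n ⊗[k] Radford k n}, y ^ (2 * n) = 1 → (y ^ s) ^ (2 * n) = 1 := by
    intro y hy
    rw [← pow_mul, mul_comm, pow_mul, hy, one_pow]
  refine ext_eigenvector₂ hN hω hA hB hc fun p q v h h' => ?_
  rw [hs1, hs2, bich_mul_eigenvector hN hω (hcp hA) h',
    bich_mul_eigenvector hN hω (hcp hB) h, ← pow_mul, ← pow_mul, pow_mul_eigenvector h,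
    pow_mul_eigenvector h', ← pow_mul, ← pow_mul]
  congr 2
  ring

omit hn in
-- Polarization: `(p + q)² = p² + q² + 2 p q`, each copy of `rZero` supplying one `p q`.
theorem quad_tmul (t : ℕ) : quad (2 * n) ω t (a k n ⊗ₜ[k] a k n) =
    (quad (2 * n) ω t (a k n) ⊗ₜ[k] quad (2 * n) ω t (a k n)) *
      (rZero k n ω t * rZero k n ω t) := by
  have hA : (a k n ⊗ₜ[k] (1 : Radford k n)) ^ (2 * n) = 1 := by
    rw [tmul_one_pow, a_pow]; rfl
  have hB : ((1 : Radford k n) ⊗ₜ[k] (a k n)) ^ (2 * n) = 1 := by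
    rw [one_tmul_pow, a_pow]; rfl
  have hc : Commute (a k n ⊗ₜ[k] (1 : Radford k n)) ((1 : Radford k n) ⊗ₜ[k] (a k n)) := by
    simp [Commute, SemiconjBy]
  have e1 : (quad (2 * n) ω t (a k n) ⊗ₜ[k] quad (2 * n) ω t (a k n)) =
      quad (2 * n) ω t (a k n ⊗ₜ[k] (1 : Radford k n)) *
        quad (2 * n) ω t ((1 : Radford k n) ⊗ₜ[k] (a k n)) := by
    have h1 := map_quad (N := 2 * n) (ω := ω) (Algebra.TensorProduct.includeLeft (R := k) (S := k)
      (A := Radford k n) (B := Radford k n)) t (a k n)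
    have h2 := map_quad (N := 2 * n) (ω := ω) (Algebra.TensorProduct.includeRight (R := k)
      (A := Radford k n) (B := Radford k n)) t (a k n)
    simp only [Algebra.TensorProduct.includeLeft_apply,
      Algebra.TensorProduct.includeRight_apply] at h1 h2
    rw [← h1, ← h2]
    simp
  refine ext_eigenvector₂ hN hω hA hB hc fun p q v h h' => ?_
  have hab : (a k n ⊗ₜ[k] a k n) * v = ω ^ (p + q) • v := by
    rw [show a k n ⊗ₜ[k] a k n = (a k n ⊗ₜ[k] (1 : Radford k n)) * (1 ⊗ₜ[k] (a k n)) by simp,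
      mul_assoc, h', mul_smul_comm, h, smul_smul, ← pow_add, add_comm]
  have hs2 : ((1 : Radford k n) ⊗ₜ[k] (a k n ^ t)) = ((1 : Radford k n) ⊗ₜ[k] (a k n)) ^ t := by
    rw [one_tmul_pow]
  have hBt : (((1 : Radford k n) ⊗ₜ[k] (a k n)) ^ t) ^ (2 * n) = 1 := by
    rw [← pow_mul, mul_comm, pow_mul, hB, one_pow]
  have hR : rZero k n ω t * v = ω ^ (q * (t * p)) • v := by
    rw [rZero, hs2, bich_mul_eigenvector hN hω hBt h, ← pow_mul, pow_mul_eigenvector h', ← pow_mul]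
  rw [e1, mul_assoc, mul_assoc, mul_assoc, hR, mul_smul_comm, hR, quad_mul_eigenvector hN hω t hab]
  simp only [mul_smul_comm]
  rw [quad_mul_eigenvector hN hω t h', mul_smul_comm, quad_mul_eigenvector hN hω t h]
  simp only [smul_smul, ← pow_add]
  congr 2
  ring

/-- Moving the flipped nilpotent `a^n x ⊗ x` past `R₀` gives minus the original one, so the
unipotent factors become `1 - β u` and `1 + β u`, with `u = x ⊗ a^n x`, and cancel. The double
braiding does not see `β`. -/
theorem comm_rMatrix_mul_rMatrix (hs : Odd s) :
    TensorProduct.comm k _ _ (rMatrix n ω s β) * rMatrix n ω s β =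
      rZero k n ω s * rZero k n ω s := by
  have h1 : ∀ u v, TensorProduct.comm k (Radford k n) (Radford k n) (u * v) =
      TensorProduct.comm k _ _ u * TensorProduct.comm k _ _ v :=
    map_mul (Algebra.TensorProduct.comm k (Radford k n) (Radford k n))
  have h2 : TensorProduct.comm k (Radford k n) (Radford k n) 1 = 1 :=
    map_one (Algebra.TensorProduct.comm k (Radford k n) (Radford k n))
  have key : ((a k n ^ n * x k n) ⊗ₜ[k] x k n) * rZero k n ω s =
      rZero k n ω s * ((-1 : k) • (x k n ⊗ₜ[k] (a k n ^ n * x k n))) := by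
    rw [show ((a k n ^ n * x k n) ⊗ₜ[k] x k n) = ((a k n ^ n) ⊗ₜ[k] (a k n ^ 0)) * ((x k n ⊗ₜ[k] 1) *
      (1 ⊗ₜ x k n)) by simp, mul_assoc, mul_assoc, one_tmul_x_mul_rZero hN hω hs, ← mul_assoc (x k n ⊗ₜ 1),
      x_tmul_one_mul_rZero hN hω hs, ← mul_assoc, ← mul_assoc, tmul_a_pow_mul_rZero]
    simp only [mul_assoc]
    congr 1
    simp only [Algebra.TensorProduct.tmul_mul_tmul, x_mul_a_pow_n, ← mul_assoc, mul_neg,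
      pow_zero, one_mul, TensorProduct.neg_tmul, neg_smul, one_smul, a_pow_n_mul_a_pow_n]
  rw [rMatrix_eq]
  change TensorProduct.comm k _ _ (rZero k n ω s * _) * (rZero k n ω s * _) = _
  rw [h1, comm_rZero hN hω, map_add, map_smul, h2, TensorProduct.comm_tmul, mul_assoc,
    ← mul_assoc (1 + _)]
  have e : (1 + β • (a k n ^ n * x k n) ⊗ₜ[k] x k n) * rZero k n ω s = rZero k n ω s *
      (1 + (-β) • (x k n ⊗ₜ[k] (a k n ^ n * x k n))) := by
    rw [add_mul, mul_add, one_mul, mul_one, smul_mul_assoc, key, mul_smul_comm, mul_smul_comm,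
      smul_smul, mul_neg_one]
  rw [e, mul_assoc, one_add_mul_one_add _ _ tmul_x_mul_self]
  simp

theorem comul_twist (hs : Odd s) : Coalgebra.comul (R := k) (twist n ω s) =
    (twist n ω s ⊗ₜ[k] twist n ω s) *
      (TensorProduct.comm k _ _ (rMatrix n ω s β) * rMatrix n ω s β) := by
  have h1 : Coalgebra.comul (R := k) (quad (2 * n) ω s (a k n)) =
      quad (2 * n) ω s (a k n ⊗ₜ[k] a k n) := by
    rw [← comul_a]
    exact map_quad (comulHom k n) s (a k n)
  rw [comm_rMatrix_mul_rMatrix hN hω hs, twist_eq, comul_mul, comul_a_pow, h1, quad_tmul hN hω,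
    ← mul_assoc]
  simp

/-- `(H_n, R, θ)` is a ribbon Hopf algebra. -/
theorem isRibbon (hs : Odd s) : RibbonHopf.IsRibbon (rMatrix n ω s β) (twist n ω s) where
  isUnit := isUnit_rMatrix hN hω
  intertwines := rMatrix_mul_comul hN hω hs
  comul_right := comul_right_rMatrix hN hω hs
  comul_left := comul_left_rMatrix hN hω hs
  isUnit_twist := isUnit_twist hN hω s
  central := twist_central hN hω hs
  antipode_twist := antipode_twist hN hω s
  comul_twist := comul_twist hN hω hs

omit hN hω in
-- In the `β`-sum each product `S(b_i) a_i` contains `x` twice and vanishes.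
theorem drinfeld_rMatrix : RibbonHopf.drinfeld (rMatrix n ω s β) =
    bich (2 * n) ω (a k n) ((a k n ^ (2 * n - 1)) ^ s) := by
  have h0 : ∀ i j, a k n ^ n * x k n * (a k n ^ (2 * n - 1)) ^ j * (a k n ^ i * x k n) = 0 := by
    intro i j
    rw [mul_assoc, ← mul_assoc _ (a k n ^ i), ← pow_mul, ← pow_add, mul_assoc,
      ← mul_assoc (x k n), x_mul_a_pow, mul_assoc, mul_assoc, x_mul_x]
    simp
  simp only [RibbonHopf.drinfeld, rMatrix, map_add, map_smul, map_sum, TensorProduct.comm_tmul,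
    LinearMap.rTensor_tmul, LinearMap.mul'_apply, antipode_mul, antipode_x, antipode_a_pow, h0,
    smul_zero, Finset.sum_const_zero, add_zero]
  rw [Finset.sum_comm, Finset.smul_sum, bich]
  refine Finset.sum_congr rfl fun l _ => ?_
  rw [eig, mul_smul_comm, Finset.mul_sum]
  simp only [mul_smul_comm, ← pow_mul, mul_assoc]

/-- The Drinfeld element acts as `ω^(-s p²)` on the `ω^p`-eigenspace, which is inverse to the
quadratic part of the twist. -/
theorem special_rMatrix : RibbonHopf.special (rMatrix n ω s β) (twist n ω s) = a k n ^ n := by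
  have hpos := hn.out.pos
  rw [RibbonHopf.special, drinfeld_rMatrix, twist_eq, mul_assoc]
  conv_rhs => rw [← mul_one (a k n ^ n)]
  congr 1
  refine ext_eig hN hω (a k n) fun p => ?_
  have h := mul_eig hN hω (a_pow k n) p
  rw [mul_assoc, bich_mul_eigenvector hN hω (by rw [← pow_mul (a k n), a_pow_pow]) h, ← pow_mul, ← pow_mul,
    pow_mul_eigenvector h, mul_smul_comm, quad_mul_eigenvector hN hω s h, smul_smul, ← pow_mul,
    ← pow_add, pow_congr hω (p := 0), pow_zero, one_smul, one_mul]
  obtain ⟨m, hm⟩ : ∃ m, 2 * n = m + 1 := ⟨2 * n - 1, by omega⟩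
  rw [hm, Nat.add_sub_cancel, Nat.modEq_zero_iff_dvd]
  exact ⟨s * p ^ 2, by ring⟩

end

end Radford

/-! ### Characters, and coordinates in the monomials `a^i` and `a^i x` -/

namespace Radford

open RootCalculus

variable {k : Type u} [Field k] {n : ℕ} {ω : k} {s : ℕ} {β : k}

/-- The character `a ↦ c`, `x ↦ 0`. -/
def character (c : k) (hc : c ^ (2 * n) = 1) : Radford k n →ₐ[k] k :=
  lift c 0 hc (by simp) (by simp)

@[simp] theorem character_a (c : k) (hc : c ^ (2 * n) = 1) : character c hc (a k n) = c :=
  lift_a _ _ _ _ _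

@[simp] theorem character_x (c : k) (hc : c ^ (2 * n) = 1) : character c hc (x k n) = 0 :=
  lift_x _ _ _ _ _

/-- The two-dimensional representation with `a ↦ diag(c, -c)` and `x ↦ E₁₂`. -/
def matRep (c : k) (hc : c ^ (2 * n) = 1) : Radford k n →ₐ[k] Matrix (Fin 2) (Fin 2) k :=
  lift (Matrix.diagonal ![c, -c]) !![0, 1; 0, 0]
    (by
      rw [Matrix.diagonal_pow, ← Matrix.diagonal_one]
      congr 1
      ext i
      fin_cases i
      · simp [hc]
      · simp [Even.neg_pow ⟨n, two_mul n⟩, hc])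
    (by ext i j; fin_cases i <;> fin_cases j <;> simp [sq])
    (by ext i j; fin_cases i <;> fin_cases j <;> simp [Matrix.vecMul_diagonal])

/-- The upper right entry of `matRep`. -/
def skew (c : k) (hc : c ^ (2 * n) = 1) : Module.Dual k (Radford k n) :=
  Matrix.entryLinearMap k k 0 1 ∘ₗ (matRep c hc).toLinearMap

theorem skew_a_pow (c : k) (hc : c ^ (2 * n) = 1) (i : ℕ) : skew c hc (a k n ^ i) = 0 := by
  simp [skew, matRep, Matrix.diagonal_pow]

theorem skew_a_pow_mul_x (c : k) (hc : c ^ (2 * n) = 1) (i : ℕ) :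
    skew c hc (a k n ^ i * x k n) = c ^ i := by
  simp [skew, matRep, Matrix.diagonal_pow]

theorem linear_ext {M : Type*} [AddCommMonoid M] [Module k M] (hn : 0 < n)
    {f g : Radford k n →ₗ[k] M} (h0 : ∀ i, f (a k n ^ i) = g (a k n ^ i))
    (h1 : ∀ i, f (a k n ^ i * x k n) = g (a k n ^ i * x k n)) : f = g := by
  refine LinearMap.ext fun h => ?_
  induction mem_span hn h using Submodule.span_induction with
  | mem y hy =>
    obtain ⟨⟨p, q⟩, hp, rfl⟩ := hy
    obtain rfl | rfl : q = 0 ∨ q = 1 := by simp at hp; omega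
    · simpa using h0 p
    · simpa using h1 p
  | zero => simp
  | add y z _ _ hy hz => rw [map_add, map_add, hy, hz]
  | smul r y _ hy => rw [map_smul, map_smul, hy]

theorem linear_ext_apply {M : Type*} [AddCommMonoid M] [Module k M] (hn : 0 < n)
    (f g : Radford k n →ₗ[k] M) (h0 : ∀ i, f (a k n ^ i) = g (a k n ^ i))
    (h1 : ∀ i, f (a k n ^ i * x k n) = g (a k n ^ i * x k n)) (h : Radford k n) : f h = g h := by
  rw [linear_ext hn h0 h1]

theorem pow_pow_eq_one (hω : IsPrimitiveRoot ω (2 * n)) (l : ℕ) : (ω ^ l) ^ (2 * n) = 1 := by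
  rw [← pow_mul, mul_comm, pow_mul, hω.pow_eq_one, one_pow]

/-- The coefficient of `a ^ p`. -/
noncomputable def coordA (hω : IsPrimitiveRoot ω (2 * n)) (p : ℕ) : Module.Dual k (Radford k n) :=
  ((2 * n : ℕ) : k)⁻¹ • ∑ l ∈ Finset.range (2 * n), (ω ^ (l * p))⁻¹ •
    (character (ω ^ l) (pow_pow_eq_one hω l)).toLinearMap

/-- The coefficient of `a ^ p x`. -/
noncomputable def coordX (hω : IsPrimitiveRoot ω (2 * n)) (p : ℕ) : Module.Dual k (Radford k n) :=
  ((2 * n : ℕ) : k)⁻¹ • ∑ l ∈ Finset.range (2 * n), (ω ^ (l * p))⁻¹ •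
    skew (ω ^ l) (pow_pow_eq_one hω l)

theorem mul_x_mul_pow_mul_x (u : Radford k n) (i : ℕ) : u * x k n * (a k n ^ i * x k n) = 0 := by
  rw [mul_assoc, ← mul_assoc (x k n), x_mul_a_pow, mul_assoc, mul_assoc, x_mul_x]
  simp

theorem x_mul_a_pow_smul (i : ℕ) : x k n * a k n ^ i = (-1 : k) ^ i • (a k n ^ i * x k n) := by
  rw [x_mul_a_pow, Algebra.smul_def]
  simp

section
variable (hN : ((2 * n : ℕ) : k) ≠ 0) (hω : IsPrimitiveRoot ω (2 * n))

section
include hN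

/-- Fourier inversion over the characters `a ↦ ω^l`. Together with its analogue for `coordX` it
gives the linear independence of the monomials, which the presentation leaves open. -/
theorem coordA_a_pow (p i : ℕ) : coordA hω p (a k n ^ i) = if p ≡ i [MOD 2 * n] then 1 else 0 := by
  rw [← sum_inv_mul_pow hN hω p i]
  simp only [coordA, LinearMap.smul_apply, LinearMap.sum_apply, AlgHom.toLinearMap_apply, map_pow,
    character_a, smul_eq_mul]
  refine congrArg _ (Finset.sum_congr rfl fun l _ => ?_)
  rw [← pow_mul, ← pow_mul, mul_comm l i]

omit hN in
theorem coordA_a_pow_mul_x (p i : ℕ) : coordA hω p (a k n ^ i * x k n) = 0 := by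
  simp [coordA]

omit hN in
theorem coordX_a_pow (p i : ℕ) : coordX hω p (a k n ^ i) = 0 := by
  simp [coordX, skew_a_pow]

theorem coordX_a_pow_mul_x (p i : ℕ) :
    coordX hω p (a k n ^ i * x k n) = if p ≡ i [MOD 2 * n] then 1 else 0 := by
  rw [← sum_inv_mul_pow hN hω p i]
  simp only [coordX, LinearMap.smul_apply, LinearMap.sum_apply, skew_a_pow_mul_x, smul_eq_mul]
  refine congrArg _ (Finset.sum_congr rfl fun l _ => ?_)
  rw [← pow_mul, ← pow_mul, mul_comm l i]

end

include hN in
theorem two_ne_zero' : (2 : k) ≠ 0 := by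
  intro h
  apply hN
  push_cast
  rw [h, zero_mul]

variable [hn : Fact (Odd n)]

theorem eq_sum_coord (hN : ((2 * n : ℕ) : k) ≠ 0) (h : Radford k n) :
    h = ∑ p ∈ Finset.range (2 * n), (coordA hω p h • a k n ^ p +
      coordX hω p h • (a k n ^ p * x k n)) := by
  have hpos := hn.out.pos
  have := linear_ext_apply hpos LinearMap.id (∑ p ∈ Finset.range (2 * n),
    ((coordA hω p).smulRight (a k n ^ p) + (coordX hω p).smulRight (a k n ^ p * x k n))) ?_ ?_ h
  · simpa using this
  · intro i
    have e := sum_range_ite (N := 2 * n) (by omega) i (fun p => a k n ^ p)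
    simp only [LinearMap.id_apply, LinearMap.sum_apply, LinearMap.add_apply,
      LinearMap.smulRight_apply, coordA_a_pow hN, coordX_a_pow, ite_smul, one_smul, zero_smul,
      add_zero]
    rw [e, pow_congr' (a_pow k n) (Nat.mod_modEq i (2 * n))]
  · intro i
    have e := sum_range_ite (N := 2 * n) (by omega) i (fun p => a k n ^ p * x k n)
    simp only [LinearMap.id_apply, LinearMap.sum_apply, LinearMap.add_apply,
      LinearMap.smulRight_apply, coordA_a_pow_mul_x, coordX_a_pow_mul_x hN, ite_smul, one_smul,
      zero_smul, zero_add]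
    rw [e, pow_congr' (a_pow k n) (Nat.mod_modEq i (2 * n))]

/-! ### Integrals -/

/-- The element `(2n)⁻¹ ∑ a ^ i x`, which spans the left integrals. -/
noncomputable def leftIntegral (k : Type u) [Field k] (n : ℕ) (ω : k) : Radford k n :=
  eig (2 * n) ω 0 (a k n) * x k n

include hN hω

omit hn in
theorem a_pow_mul_eig_zero (i : ℕ) :
    a k n ^ i * eig (2 * n) ω 0 (a k n) = eig (2 * n) ω 0 (a k n) := by
  have h := mul_eig hN hω (a_pow k n) 0
  rw [pow_mul_eigenvector h]
  simp

/-- `e₀` absorbs powers of `a`, so the right ideal `e₀ H` is spanned by `e₀` and `e₀ x`. -/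
theorem eig_zero_mul (h : Radford k n) : eig (2 * n) ω 0 (a k n) * h =
    character (n := n) 1 (by simp) h • eig (2 * n) ω 0 (a k n) +
      skew (n := n) 1 (by simp) h • leftIntegral k n ω := by
  have hc : ∀ i, eig (2 * n) ω 0 (a k n) * a k n ^ i = eig (2 * n) ω 0 (a k n) := fun i => by
    rw [(commute_eig ((Commute.refl (a k n)).pow_right i) 0).eq, a_pow_mul_eig_zero hN hω]
  have := linear_ext_apply hn.out.pos (LinearMap.mulLeft k (eig (2 * n) ω 0 (a k n)))
    ((character (n := n) 1 (by simp)).toLinearMap.smulRight (eig (2 * n) ω 0 (a k n)) +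
      (skew (n := n) 1 (by simp)).smulRight (leftIntegral k n ω)) ?_ ?_ h
  · simpa using this
  · intro i
    simp [hc, skew_a_pow]
  · intro i
    simp [← mul_assoc, hc, skew_a_pow_mul_x, leftIntegral]

omit hn in
theorem coordX_leftIntegral (p : ℕ) :
    coordX hω p (leftIntegral k n ω) = ((2 * n : ℕ) : k)⁻¹ := by
  have h0 : 2 * n ≠ 0 := by rintro h; simp [h] at hN
  have := sum_range_ite (N := 2 * n) h0 p (fun _ => (1 : k))
  simp only [Nat.ModEq.comm (a := p), leftIntegral, eig, mul_zero, pow_zero, inv_one, one_smul, smul_mul_assoc, Finset.sum_mul,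
    map_smul, map_sum, coordX_a_pow_mul_x hN, this, smul_eq_mul, mul_one] at this ⊢

omit hn in
theorem leftIntegral_ne_zero : leftIntegral k n ω ≠ 0 := by
  intro h
  have := coordX_leftIntegral hN hω 0
  rw [h, map_zero] at this
  exact inv_ne_zero hN this.symm

theorem isLeftIntegral_leftIntegral : RibbonHopf.IsLeftIntegral k (leftIntegral k n ω) := by
  intro h
  refine linear_ext_apply hn.out.pos (LinearMap.mulRight k (leftIntegral k n ω))
    ((Coalgebra.counit (R := k)).smulRight (leftIntegral k n ω)) ?_ ?_ h
  · intro i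
    have : Coalgebra.counit (R := k) (a k n ^ i) = 1 := by simp [counit_a]
    simp only [LinearMap.mulRight_apply, LinearMap.smulRight_apply, this, leftIntegral, one_smul,
      ← mul_assoc, a_pow_mul_eig_zero hN hω]
  · intro i
    have : Coalgebra.counit (R := k) (a k n ^ i * x k n) = 0 := by simp [counit_x]
    simp only [LinearMap.mulRight_apply, LinearMap.smulRight_apply, this, zero_smul, leftIntegral,
      eig, smul_mul_assoc, mul_smul_comm, Finset.sum_mul, Finset.mul_sum, mul_x_mul_pow_mul_x,
      smul_zero, Finset.sum_const_zero]

/-- Invariance under `a` puts `Λ` into `e₀ H`, and `x Λ = 0` removes its `e₀`-component because `x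
e₀ ≠ 0`. -/
theorem eq_smul_leftIntegral {Λ : Radford k n} (h : RibbonHopf.IsLeftIntegral k Λ) :
    Λ = skew (n := n) 1 (by simp) Λ • leftIntegral k n ω := by
  have h1 : eig (2 * n) ω 0 (a k n) * Λ = Λ := by
    have hi : ∀ i, a k n ^ i * Λ = Λ := fun i => by
      have := h (a k n ^ i)
      rwa [show Coalgebra.counit (R := k) (a k n ^ i) = 1 by simp [counit_a], one_smul] at this
    have h2 := eig_mul_eigenvector hN hω (p := 0) (v := Λ) (A := a k n) (by simpa using hi 1) 0
    simpa [Nat.ModEq.refl] using h2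
  have h2 := eig_zero_mul hN hω Λ
  rw [h1] at h2
  have h3 : x k n * Λ = 0 := by rw [h, counit_x, zero_smul]
  have h4 : character (n := n) 1 (by simp) Λ = 0 := by
    have h5 := congrArg (coordX hω 0) h3
    rw [h2, mul_add, mul_smul_comm, mul_smul_comm, isLeftIntegral_leftIntegral hN hω, counit_x,
      zero_smul, smul_zero, add_zero, map_smul, map_zero] at h5
    -- The coefficient of `x` in `x e₀` is `(2n)⁻¹`, which witnesses `x e₀ ≠ 0`.
    have h6 : coordX hω 0 (x k n * eig (2 * n) ω 0 (a k n)) = ((2 * n : ℕ) : k)⁻¹ := by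
      have h0 : 2 * n ≠ 0 := by rintro h; simp [h] at hN
      have := sum_range_ite (N := 2 * n) h0 0 (fun i => ((2 * n : ℕ) : k)⁻¹ * (-1 : k) ^ i)
      simp only [Nat.ModEq.comm (a := 0), eig, mul_zero, pow_zero, inv_one, one_smul, mul_smul_comm,
        Finset.mul_sum, x_mul_a_pow_smul, map_smul, map_sum, coordX_a_pow_mul_x hN, smul_eq_mul,
        mul_ite, mul_one, Nat.zero_mod] at this ⊢
      rw [this]
    rw [h6, smul_eq_mul] at h5
    exact (mul_eq_zero.mp h5).resolve_right (inv_ne_zero hN)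
  rwa [h4, zero_smul, zero_add] at h2

omit hn in
-- The sign comes from `x a = -a x`. It is the reason why `H_n` is not unimodular and why the
-- distinguished grouplike sends `a` to `-1`.
theorem leftIntegral_mul_a : leftIntegral k n ω * a k n = -leftIntegral k n ω := by
  rw [leftIntegral, mul_assoc, x_mul_a, mul_neg, ← mul_assoc,
    (commute_eig (Commute.refl (a k n)) 0).eq]
  have := a_pow_mul_eig_zero hN hω 1
  rw [pow_one] at this
  rw [this]

omit hN hω hn in
theorem leftIntegral_mul_x : leftIntegral k n ω * x k n = 0 := by
  rw [leftIntegral, mul_assoc, x_mul_x, mul_zero]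

theorem not_isUnimodular : ¬ RibbonHopf.IsUnimodular k (Radford k n) := by
  intro h
  have h1 := (h _).mp (isLeftIntegral_leftIntegral hN hω) (a k n)
  rw [leftIntegral_mul_a hN hω, counit_a, one_smul] at h1
  have h2 : (2 : k) • leftIntegral k n ω = 0 := by
    rw [two_smul]
    nth_rewrite 1 [← h1]
    simp
  exact (smul_eq_zero.mp h2).elim (two_ne_zero' hN) (leftIntegral_ne_zero hN hω)

theorem isDistinguished_iff (ν : Radford k n →ₐ[k] k) :
    RibbonHopf.IsDistinguished ν ↔ ν (a k n) = -1 ∧ ν (x k n) = 0 := by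
  constructor
  · intro h
    have h1 := h _ (isLeftIntegral_leftIntegral hN hω)
    have ha := h1 (a k n)
    have hx := h1 (x k n)
    rw [leftIntegral_mul_a hN hω, ← neg_one_smul k] at ha
    rw [leftIntegral_mul_x] at hx
    refine ⟨(smul_left_injective k (leftIntegral_ne_zero hN hω) ha).symm, ?_⟩
    exact (smul_eq_zero.mp hx.symm).resolve_right (leftIntegral_ne_zero hN hω)
  · rintro ⟨ha, hx⟩ Λ hΛ h
    rw [eq_smul_leftIntegral hN hω hΛ, smul_mul_assoc, smul_comm]
    congr 1
    induction h using induction with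
    | hadd u v hu hv => rw [mul_add, hu, hv, map_add, add_smul]
    | halg r => rw [← Algebra.commutes, AlgHom.commutes, Algebra.smul_def]; rfl
    | hmul u v hu hv => rw [← mul_assoc, hu, smul_mul_assoc, hv, smul_smul, map_mul]
    | ha => rw [leftIntegral_mul_a hN hω, ha, neg_one_smul]
    | hx => rw [leftIntegral_mul_x, hx, zero_smul]

theorem existsUnique_distinguished :
    ∃! ν : Radford k n →ₐ[k] k, RibbonHopf.IsDistinguished ν := by
  refine ⟨character (-1) (Even.neg_one_pow ⟨n, two_mul n⟩), ?_, fun ν hν => ?_⟩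
  · exact (isDistinguished_iff hN hω _).mpr (by simp)
  · obtain ⟨ha, hx⟩ := (isDistinguished_iff hN hω ν).mp hν
    exact hom_ext (by simp [ha]) (by simp [hx])

omit hN hω in
theorem hit_a_pow (f : Module.Dual k (Radford k n)) (i : ℕ) :
    RibbonHopf.hit f (a k n ^ i) = f (a k n ^ i) • a k n ^ i := by
  rw [RibbonHopf.hit, LinearMap.comp_apply, LinearMap.comp_apply, comul_a_pow]
  simp

omit hN hω in
theorem hit_a_pow_mul_x (f : Module.Dual k (Radford k n)) (i : ℕ) :
    RibbonHopf.hit f (a k n ^ i * x k n) =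
      f (a k n ^ i * x k n) • a k n ^ (i + n) + f (a k n ^ i) • (a k n ^ i * x k n) := by
  simp only [RibbonHopf.hit, LinearMap.comp_apply, comul_a_pow_mul_x]
  simp

/-- In `Δ(a^i x)` the factor to the right of `a^i x` is `a^(i + n)`, which is `1` precisely for `i ≡
n`; this singles out the coefficient of `a^n x`. -/
theorem isDualRightIntegral_coordX : RibbonHopf.IsDualRightIntegral (coordX hω n) := by
  intro h
  refine linear_ext_apply hn.out.pos (RibbonHopf.hit (coordX hω n))
    ((coordX hω n).smulRight 1) ?_ ?_ h
  · intro i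
    simp [hit_a_pow, coordX_a_pow]
  · intro i
    simp only [hit_a_pow_mul_x, coordX_a_pow_mul_x hN, coordX_a_pow, LinearMap.smulRight_apply]
    split_ifs with hi
    · have h1 : a k n ^ (i + n) = a k n ^ (n + n) := pow_congr' (a_pow k n) (hi.symm.add_right n)
      rw [h1, ← two_mul, a_pow]
      simp
    · simp

theorem exists_dualRightIntegral :
    ∃ lam : Module.Dual k (Radford k n), RibbonHopf.IsDualRightIntegral lam ∧ lam ≠ 0 := by
  refine ⟨_, isDualRightIntegral_coordX hN hω, fun h => ?_⟩
  have := coordX_a_pow_mul_x hN hω n n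
  rw [h, if_pos (Nat.ModEq.refl _)] at this
  simp at this

/-- Read off the coefficient of `a^i x` in the integral equation at `a^i x`. The coefficient of `1`
in the same equation then gives uniqueness up to a scalar. -/
theorem dualRightIntegral_a_pow {lam : Module.Dual k (Radford k n)}
    (h : RibbonHopf.IsDualRightIntegral lam) (i : ℕ) : lam (a k n ^ i) = 0 := by
  have h1 := congrArg (coordX hω i) (h (a k n ^ i * x k n))
  have h2 := coordX_a_pow (k := k) hω i 0
  rw [pow_zero] at h2
  simpa [hit_a_pow_mul_x, coordX_a_pow_mul_x hN, coordX_a_pow, h2, Nat.ModEq.refl] using h1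

theorem dualRightIntegral_a_pow_mul_x {lam : Module.Dual k (Radford k n)}
    (h : RibbonHopf.IsDualRightIntegral lam) (i : ℕ) :
    lam (a k n ^ i * x k n) = if n ≡ i [MOD 2 * n] then lam (a k n ^ n * x k n) else 0 := by
  split_ifs with hi
  · rw [pow_congr' (a_pow k n) hi]
  · have h1 := congrArg (coordA hω 0) (h (a k n ^ i * x k n))
    have h2 := coordA_a_pow hN hω 0 0
    rw [pow_zero] at h2
    have h3 : ¬ 0 ≡ i + n [MOD 2 * n] := by
      intro h4
      apply hi
      have h5 := h4.add_right n
      rw [zero_add, add_assoc, ← two_mul] at h5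
      simpa [Nat.ModEq] using h5
    simpa [hit_a_pow_mul_x, coordA_a_pow_mul_x, coordA_a_pow hN, h2, h3, Nat.ModEq.refl] using h1.symm

theorem dualRightIntegral_eq {lam : Module.Dual k (Radford k n)}
    (h : RibbonHopf.IsDualRightIntegral lam) :
    lam = lam (a k n ^ n * x k n) • coordX hω n := by
  refine linear_ext hn.out.pos (fun i => ?_) fun i => ?_
  · simp [dualRightIntegral_a_pow hN hω h, coordX_a_pow]
  · simp [dualRightIntegral_a_pow_mul_x hN hω h i, coordX_a_pow_mul_x hN]

theorem dualRightIntegral_apply_ne_zero {lam : Module.Dual k (Radford k n)}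
    (h : RibbonHopf.IsDualRightIntegral lam) (h0 : lam ≠ 0) : lam (a k n ^ n * x k n) ≠ 0 := by
  intro h1
  apply h0
  rw [dualRightIntegral_eq hN hω h, h1, zero_smul]

end

end Radford

/-! ### Negligible morphisms out of the unit object, and characters in the coend -/

namespace RibbonHopf

variable {k H : Type u} [Field k] [Ring H] [HopfAlgebra k H]

section Negligible

variable {W : Type*} [AddCommGroup W] [Module k W]

theorem quantumTrace_unitRep (R : H ⊗[k] H) (θ : H) (f : k →ₗ[k] k) :
    quantumTrace R θ (unitRep k H) f = Coalgebra.counit (R := k) (drinfeld R * θ) * f 1 := by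
  have hf : ∀ c, f c = c * f 1 := fun c => by
    rw [← smul_eq_mul c (f 1), ← map_smul, smul_eq_mul, mul_one]
  have hu : ∀ (h : H) (c : k), unitRep k H h c = Coalgebra.counit (R := k) h * c := fun h c => rfl
  rw [quantumTrace, coevaluation_apply_one, map_sum, map_sum]
  simp only [LinearMap.rTensor_tmul, evTilde_tmul, hu]
  have h1 : ∀ i, ((Module.Basis.ofVectorSpace k k).coord i)
      (Coalgebra.counit (R := k) (drinfeld R * θ) * f (Module.Basis.ofVectorSpace k k i)) =
      Coalgebra.counit (R := k) (drinfeld R * θ) * f 1 := fun i => by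
    rw [hf, mul_comm _ (f 1), ← mul_assoc, ← smul_eq_mul (_ * _) (Module.Basis.ofVectorSpace k k i),
      map_smul, Module.Basis.coord_apply, Module.Basis.repr_self, Finsupp.single_eq_same,
      smul_eq_mul, mul_one, mul_comm]
  simp only [h1, Finset.sum_const, Finset.card_univ,
    ← Module.finrank_eq_card_basis (Module.Basis.ofVectorSpace k k), Module.finrank_self, one_smul]

/-- On the one-dimensional unit object the quantum trace is multiplication by `ε(u θ)`, where `u` is
the Drinfeld element. -/
theorem isNegligible_unitRep_iff {R : H ⊗[k] H} {θ : H}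
    (h1 : Coalgebra.counit (R := k) (drinfeld R * θ) = 1) (σ : H →ₐ[k] Module.End k W)
    (f : k →ₗ[k] W) : IsNegligible R θ (unitRep k H) σ f ↔
      (∀ h, σ h (f 1) = Coalgebra.counit (R := k) h • f 1) ∧
      ∀ g : W →ₗ[k] k, IsHom σ (unitRep k H) g → g (f 1) = 0 := by
  have hu : ∀ (h : H) (c : k), unitRep k H h c = Coalgebra.counit (R := k) h * c := fun h c => rfl
  refine and_congr ?_ ?_
  · refine forall_congr' fun h => ?_
    rw [LinearMap.ext_ring_iff, LinearMap.comp_apply, LinearMap.comp_apply, hu, mul_one,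
      ← mul_one (Coalgebra.counit (R := k) h), ← smul_eq_mul, map_smul, eq_comm, smul_eq_mul, mul_one]
  · refine forall_congr' fun g => ?_
    rw [quantumTrace_unitRep, h1, one_mul, LinearMap.comp_apply]

theorem isHom_unitRep_iff (σ : H →ₐ[k] Module.End k W) (f : k →ₗ[k] W) :
    IsHom (unitRep k H) σ f ↔ ∀ h, σ h (f 1) = Coalgebra.counit (R := k) h • f 1 := by
  have hu : ∀ (h : H) (c : k), unitRep k H h c = Coalgebra.counit (R := k) h * c := fun h c => rfl
  refine forall_congr' fun h => ?_
  rw [LinearMap.ext_ring_iff, LinearMap.comp_apply, LinearMap.comp_apply, hu, mul_one,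
    ← mul_one (Coalgebra.counit (R := k) h), ← smul_eq_mul, map_smul, eq_comm, smul_eq_mul, mul_one]

end Negligible

section Characters

theorem coadjointRep_apply (h : H) (f : Module.Dual k H) (y : H) :
    coadjointRep k H h f y = f (sandwich (Coalgebra.comul (R := k) h) y) := rfl

theorem map_sandwich (χ : H →ₐ[k] k) (p : H ⊗[k] H) (y : H) :
    χ (sandwich p y) =
      χ y * χ (LinearMap.mul' k H ((HopfAlgebra.antipode k).rTensor H p)) := by
  induction p with
  | zero => simp
  | add p q hp hq => simp only [map_add, LinearMap.add_apply, hp, hq, mul_add]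
  | tmul a b =>
    simp only [sandwich_tmul, map_mul, LinearMap.rTensor_tmul, LinearMap.mul'_apply]
    ring

theorem sandwich_central {c : H} (hc : ∀ h, c * h = h * c) (p : H ⊗[k] H) :
    sandwich p c = c * LinearMap.mul' k H ((HopfAlgebra.antipode k).rTensor H p) := by
  induction p with
  | zero => simp
  | add p q hp hq => simp only [map_add, LinearMap.add_apply, hp, hq, mul_add]
  | tmul a b =>
    simp only [sandwich_tmul, LinearMap.rTensor_tmul, LinearMap.mul'_apply]
    rw [← mul_assoc, ← hc, mul_assoc]

theorem sandwich_comul_central {c : H} (hc : ∀ h, c * h = h * c) (h : H) :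
    sandwich (Coalgebra.comul (R := k) h) c = Coalgebra.counit (R := k) h • c := by
  rw [sandwich_central hc, HopfAlgebra.mul_antipode_rTensor_comul_apply, ← Algebra.commutes,
    Algebra.smul_def]

/-- A character does not see the order of the factors in `S(h₍₁₎) y h₍₂₎`, so the antipode axiom
applies. -/
theorem coadjointRep_character (χ : H →ₐ[k] k) (h : H) :
    coadjointRep k H h χ.toLinearMap = Coalgebra.counit (R := k) h • χ.toLinearMap := by
  ext y
  rw [coadjointRep_apply, AlgHom.toLinearMap_apply, map_sandwich,
    HopfAlgebra.mul_antipode_rTensor_comul_apply, AlgHom.commutes, LinearMap.smul_apply, mul_comm]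
  rfl

/-- A central `c` comes out of `S(h₍₁₎) c h₍₂₎`, and the antipode axiom does the rest. These
evaluations are the test functionals for negligibility. -/
theorem isHom_eval {c : H} (hc : ∀ h, c * h = h * c) :
    IsHom (coadjointRep k H) (unitRep k H) (Module.Dual.eval k H c) := by
  intro h
  ext f
  simp only [LinearMap.comp_apply, Module.Dual.eval_apply, coadjointRep_apply,
    sandwich_comul_central hc, map_smul]
  rfl

theorem counit_tmul_counit_comul (h : H) :
    TensorProduct.lid k k (TensorProduct.map (Coalgebra.counit (R := k)) (Coalgebra.counit (R := k))
      (Coalgebra.comul (R := k) h)) = Coalgebra.counit (R := k) h := by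
  rw [← LinearMap.lTensor_comp_rTensor, LinearMap.comp_apply, Coalgebra.rTensor_counit_comul]
  simp

theorem actTwo_of_invariant {V W : Type*} [AddCommGroup V] [Module k V] [AddCommGroup W]
    [Module k W] {ρ : H →ₐ[k] Module.End k V} {σ : H →ₐ[k] Module.End k W} {v : V} {w : W}
    (hv : ∀ h, ρ h v = Coalgebra.counit (R := k) h • v)
    (hw : ∀ h, σ h w = Coalgebra.counit (R := k) h • w) (h : H) :
    tensorRep ρ σ h (v ⊗ₜ w) = Coalgebra.counit (R := k) h • (v ⊗ₜ w) := by
  have key : ∀ p : H ⊗[k] H, actTwo ρ σ p (v ⊗ₜ w) = TensorProduct.lid k k (TensorProduct.map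
      (Coalgebra.counit (R := k)) (Coalgebra.counit (R := k)) p) • (v ⊗ₜ w) := by
    intro p
    induction p with
    | zero => simp
    | add p q hp hq => simp only [map_add, LinearMap.add_apply, hp, hq, add_smul]
    | tmul a b => simp [hv, hw, TensorProduct.smul_tmul', TensorProduct.tmul_smul, smul_smul, mul_comm]
  exact (key (Coalgebra.comul (R := k) h)).trans (by rw [counit_tmul_counit_comul])

theorem isHom_eval_tmul {c d : H} (hc : ∀ h, c * h = h * c) (hd : ∀ h, d * h = h * d) :
    IsHom (tensorRep (coadjointRep k H) (coadjointRep k H)) (unitRep k H)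
      ((TensorProduct.dualDistrib k H H).flip (c ⊗ₜ d)) := by
  intro h
  have key : ∀ (p : H ⊗[k] H) (f g : Module.Dual k H),
      TensorProduct.dualDistrib k H H (actTwo (coadjointRep k H) (coadjointRep k H) p (f ⊗ₜ g))
        (c ⊗ₜ d) = TensorProduct.lid k k (TensorProduct.map (Coalgebra.counit (R := k))
          (Coalgebra.counit (R := k)) p) * (f c * g d) := by
    intro p f g
    induction p with
    | zero => simp
    | add p q hp hq => simp only [map_add, LinearMap.add_apply, hp, hq, add_mul]
    | tmul a b =>
      simp only [actTwo_tmul, TensorProduct.dualDistrib_apply, coadjointRep_apply,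
        sandwich_comul_central hc, sandwich_comul_central hd, map_smul, smul_eq_mul,
        TensorProduct.map_tmul, TensorProduct.lid_tmul]
      ring
  refine TensorProduct.ext' fun f g => ?_
  refine (key (Coalgebra.comul (R := k) h) f g).trans ?_
  rw [counit_tmul_counit_comul]
  simp [unitRep]

theorem antipodeA_apply (R : H ⊗[k] H) (θ : H) (f : Module.Dual k H) (y : H) :
    antipodeA R θ f y = f (sandwich R (HopfAlgebra.antipode k θ *
      (HopfAlgebra.antipode k y * (drinfeld R * θ)))) := by
  simp [antipodeA, atOne, antipodeOn_apply, regularRep]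

theorem comulA_character [FiniteDimensional k H] (χ : H →ₐ[k] k) :
    comulA k H χ.toLinearMap = χ.toLinearMap ⊗ₜ χ.toLinearMap := by
  refine (TensorProduct.dualDistribEquiv k H H).injective (TensorProduct.ext' fun y z => ?_)
  refine (dualDistrib_comulOn (regularRep k H) χ.toLinearMap (1 : H) y z).trans ?_
  simp only [regularRep, Algebra.coe_lmul_eq_mul, LinearMap.mul_apply', mul_one]
  simp [TensorProduct.dualDistribEquiv, TensorProduct.dualDistribEquivOfBasis]

/-- In the product of the coend, the first leg of `R` acts on one factor and the second leg acts on
`W^* ⊗ W`. On characters the latter action collapses to the counit by the antipode axiom, so the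
braiding contributes only the scalar `(χ ⊗ ε)(R)`, and convolution in the opposite order remains. -/
theorem mulA_character (R : H ⊗[k] H) (χ χ' : H →ₐ[k] k)
    (hR : TensorProduct.lid k k (TensorProduct.map χ.toLinearMap (Coalgebra.counit (R := k)) R) = 1)
    (y : H) : mulA R (χ.toLinearMap ⊗ₜ χ'.toLinearMap) y =
      TensorProduct.lid k k (TensorProduct.map χ'.toLinearMap χ.toLinearMap
        (Coalgebra.comul (R := k) y)) := by
  -- Evaluation at pure tensors: `r` is to be the coproduct of the second leg of `R`, and `p` the
  -- coproduct of the argument.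
  have hpure : ∀ p r : H ⊗[k] H, ∀ c : H, contractLeft k (H ⊗[k] H)
      ((actTwo (regularRep k H) (regularRep k H) p).lTensor _
      ((dualTensor k H H).rTensor (H ⊗[k] H)
        ((TensorProduct.assoc k (Module.Dual k H) (Module.Dual k H) (H ⊗[k] H)).symm
          (χ.toLinearMap ⊗ₜ (TensorProduct.assoc k (Module.Dual k H) H H
            (actTwo (dualRep (regularRep k H)) (regularRep k H) r (χ'.toLinearMap ⊗ₜ 1) ⊗ₜ c)))))) =
      χ c * χ' (LinearMap.mul' k H ((HopfAlgebra.antipode k).rTensor H r)) *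
        TensorProduct.lid k k (TensorProduct.map χ'.toLinearMap χ.toLinearMap p) := by
    intro p r c
    induction r with
    | zero => simp
    | add r r' hr hr' =>
      simp only [map_add, LinearMap.add_apply, TensorProduct.add_tmul, TensorProduct.tmul_add,
        hr, hr', mul_add, add_mul]
    | tmul d e =>
      induction p with
      | zero => simp
      | add p p' hp hp' =>
        simp only [map_add, LinearMap.add_apply, LinearMap.lTensor_add, hp, hp', mul_add]
      | tmul f g =>
        simp [dualTensor, regularRep]
        ring
  have aux : ∀ t : Module.Dual k (H ⊗[k] H) ⊗[k] (H ⊗[k] H),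
      coendMap (tensorRep (regularRep k H) (regularRep k H)) t y = contractLeft k (H ⊗[k] H)
        ((actTwo (regularRep k H) (regularRep k H) (Coalgebra.comul y)).lTensor _ t) := by
    intro t
    induction t with
    | zero => simp
    | add t t' h h' => simp only [map_add, LinearMap.add_apply, h, h']
    | tmul f v => simp [tensorRep]
  have key : ∀ R : H ⊗[k] H, mulOn R (regularRep k H) (regularRep k H)
      ((χ.toLinearMap ⊗ₜ 1) ⊗ₜ (χ'.toLinearMap ⊗ₜ 1)) y =
      TensorProduct.lid k k (TensorProduct.map χ.toLinearMap (Coalgebra.counit (R := k)) R) *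
      TensorProduct.lid k k (TensorProduct.map χ'.toLinearMap χ.toLinearMap
        (Coalgebra.comul (R := k) y)) := by
    intro R
    induction R with
    | zero => simp [mulOn, braiding]
    | add p q hp hq =>
      simp only [map_add, add_mul, ← hp, ← hq]
      simp only [mulOn, braiding, map_add, LinearMap.comp_add, LinearMap.lTensor_add,
        LinearMap.add_comp, LinearMap.add_apply]
    | tmul c d =>
      simp only [mulOn, LinearMap.comp_apply, aux]
      have h2 := hpure (Coalgebra.comul (R := k) y) (Coalgebra.comul (R := k) d) c
      rw [HopfAlgebra.mul_antipode_rTensor_comul_apply, AlgHom.commutes] at h2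
      simp only [TensorProduct.map_tmul, TensorProduct.lid_tmul, smul_eq_mul]
      refine Eq.trans ?_ h2
      simp [braiding, tensorRep, regularRep]
  refine (key R).trans ?_
  rw [hR, one_mul]

end Characters

end RibbonHopf

/-! ### Coadjoint invariant functionals on `H_n` -/

namespace Radford

open RootCalculus RibbonHopf

variable {k : Type u} [Field k] {n : ℕ} {ω : k} {s : ℕ} {β : k}

/-- The functionals that vanish on the ideal generated by `x`. -/
def reduced (k : Type u) [Field k] (n : ℕ) : Submodule k (Module.Dual k (Radford k n)) where
  carrier := {f | ∀ i, f (a k n ^ i * x k n) = 0}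
  add_mem' hf hg i := by simp [hf i, hg i]
  zero_mem' i := by simp
  smul_mem' c f hf i := by simp [hf i]

theorem character_mem_reduced (c : k) (hc : c ^ (2 * n) = 1) :
    (character c hc).toLinearMap ∈ reduced k n := fun i => by simp

/-- The first character kills `x`, so only the bicharacter survives, evaluated on the scalars `ω^p`
and `χ(a)^s`. -/
theorem lid_map_rMatrix (hN : ((2 * n : ℕ) : k) ≠ 0) (hω : IsPrimitiveRoot ω (2 * n)) (p : ℕ)
    (χ : Radford k n →ₐ[k] k) :
    TensorProduct.lid k k (TensorProduct.map
      (character (ω ^ p) (pow_pow_eq_one hω p)).toLinearMap χ.toLinearMap (rMatrix n ω s β)) =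
      χ (a k n) ^ (s * p) := by
  set Φ := (Algebra.TensorProduct.lmul' k).comp
    (Algebra.TensorProduct.map (character (n := n) (ω ^ p) (pow_pow_eq_one hω p)) χ)
  have h1 : ∀ t, TensorProduct.lid k k (TensorProduct.map
      (character (ω ^ p) (pow_pow_eq_one hω p)).toLinearMap χ.toLinearMap t) = Φ t := by
    intro t
    induction t with
    | zero => simp
    | add t t' h h' => rw [map_add, map_add, map_add, h, h']
    | tmul u v => simp [Φ]
  have hχ : (χ (a k n) ^ s) ^ (2 * n) = 1 := by
    rw [← map_pow, ← map_pow, a_pow_pow, map_one]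
  rw [h1, rMatrix_eq, map_mul, map_bich]
  have h2 : Φ (a k n ⊗ₜ 1) = ω ^ p := by simp [Φ]
  have h3 : Φ (1 ⊗ₜ (a k n ^ s)) = χ (a k n) ^ s := by simp [Φ]
  have h4 := bich_mul_eigenvector hN hω (A := ω ^ p) (U := χ (a k n) ^ s) (v := (1 : k)) (p := p)
    hχ (by simp)
  rw [h2, h3, ← mul_one (bich _ _ _ _), h4]
  simp [Φ, pow_mul]

section
variable (hN : ((2 * n : ℕ) : k) ≠ 0) (hω : IsPrimitiveRoot ω (2 * n)) [hn : Fact (Odd n)]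
include hN hω

theorem reduced_eq_sum {f : Module.Dual k (Radford k n)} (hf : f ∈ reduced k n) :
    f = ∑ l ∈ Finset.range (2 * n), f (eig (2 * n) ω l (a k n)) •
      (character (ω ^ l) (pow_pow_eq_one hω l)).toLinearMap := by
  refine linear_ext hn.out.pos (fun i => ?_) (fun i => ?_)
  · conv_lhs => rw [← mul_one (a k n ^ i), ← sum_eig hN hω (a k n), Finset.mul_sum, map_sum]
    simp only [LinearMap.sum_apply, LinearMap.smul_apply, AlgHom.toLinearMap_apply, map_pow,
      character_a, smul_eq_mul]
    refine Finset.sum_congr rfl fun l _ => ?_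
    rw [pow_mul_eigenvector (mul_eig hN hω (a_pow k n) l), map_smul, smul_eq_mul, mul_comm]
  · rw [hf i]
    simp

theorem reduced_eq_sum_coord {f : Module.Dual k (Radford k n)} (hf : f ∈ reduced k n) :
    f = ∑ i ∈ Finset.range (2 * n), f (a k n ^ i) • coordA hω i := by
  ext h
  conv_lhs => rw [eq_sum_coord hω hN h]
  simp [hf _, mul_comm]

omit hN hn in
theorem coordA_mem_reduced (p : ℕ) : coordA hω p ∈ reduced k n := fun i =>
  coordA_a_pow_mul_x hω p i

theorem reduced_induction {P : Module.Dual k (Radford k n) → Prop}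
    (hadd : ∀ f g, P f → P g → P (f + g)) (hsmul : ∀ (c : k) f, P f → P (c • f))
    (hchar : ∀ l, P (character (ω ^ l) (pow_pow_eq_one hω l)).toLinearMap)
    {f : Module.Dual k (Radford k n)} (hf : f ∈ reduced k n) : P f := by
  have h0 : P 0 := by simpa using hsmul 0 _ (hchar 0)
  rw [reduced_eq_sum hN hω hf]
  exact Finset.sum_induction _ P hadd h0 fun l _ => hsmul _ _ (hchar l)

/-- Characters are invariant and span the reduced functionals. Conversely, conjugation by `a`
negates `a^i x`, so invariance under `a` alone forces `f(a^i x) = -f(a^i x)`, and `2 ≠ 0`. -/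
theorem mem_reduced_iff (f : Module.Dual k (Radford k n)) : f ∈ reduced k n ↔
    ∀ h, coadjointRep k (Radford k n) h f = Coalgebra.counit (R := k) h • f := by
  constructor
  · intro hf h
    refine reduced_induction hN hω (P := fun f => coadjointRep k (Radford k n) h f =
      Coalgebra.counit (R := k) h • f) ?_ ?_ ?_ hf
    · intro f g hf hg
      rw [map_add, hf, hg, smul_add]
    · intro c f hf
      rw [map_smul, hf, smul_comm]
    · exact fun l => coadjointRep_character _ h
  · intro h i
    have h1 := LinearMap.congr_fun (h (a k n)) (a k n ^ i * x k n)
    rw [coadjointRep_apply, comul_a, sandwich_tmul, counit_a, one_smul, antipode_a, mul_assoc,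
      x_mul_a, mul_neg, mul_neg, ← mul_assoc, ← mul_assoc, ← pow_add, ← pow_succ,
      show 2 * n - 1 + i + 1 = 2 * n + i by have := hn.out.pos; omega, pow_add, a_pow, one_mul,
      map_neg] at h1
    have h2 : (2 : k) * f (a k n ^ i * x k n) = 0 := by linear_combination -h1
    exact (mul_eq_zero.mp h2).resolve_left (two_ne_zero' hN)

theorem counit_drinfeld_mul_twist (hs : Odd s) :
    Coalgebra.counit (R := k) (drinfeld (rMatrix n ω s β) * twist n ω s) = 1 := by
  rw [← twist_central hN hω hs]
  have := special_rMatrix (β := β) hN hω (s := s)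
  rw [special] at this
  rw [this, Bialgebra.counit_pow, counit_a, one_pow]

omit hN in
theorem character_comp_antipode (l : ℕ) :
    (character (n := n) (ω ^ l) (pow_pow_eq_one hω l)).toLinearMap ∘ₗ HopfAlgebra.antipode k =
      (character (ω ^ (l * (2 * n - 1))) (pow_pow_eq_one hω _)).toLinearMap := by
  refine linear_ext hn.out.pos (fun i => ?_) (fun i => ?_)
  · simp [antipode_a_pow, pow_mul]
  · simp [antipode_mul, antipode_x]

omit hn in
theorem character_twist (l : ℕ) : character (n := n) (ω ^ l) (pow_pow_eq_one hω l) (twist n ω s) =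
    ω ^ (l * n) * ω ^ (s * l ^ 2) := by
  rw [twist_eq, map_mul, map_quad, map_pow, character_a, ← pow_mul]
  have := quad_mul_eigenvector hN hω (A := ω ^ l) (v := (1 : k)) (p := l) s (by simp)
  rw [← mul_one (quad _ _ _ _), this]
  simp

/-- On the character with exponent `l` the twist, the special grouplike and the R-matrix contribute
`ω^(l n + s l²)`, `ω^(l n)` and `ω^(-s l²)`, whose product is `1`. -/
theorem antipodeA_reduced (hs : Odd s) {f : Module.Dual k (Radford k n)} (hf : f ∈ reduced k n) :
    antipodeA (rMatrix n ω s β) (twist n ω s) f = f ∘ₗ HopfAlgebra.antipode k := by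
  refine reduced_induction hN hω (P := fun f => antipodeA (rMatrix n ω s β) (twist n ω s) f =
      f ∘ₗ HopfAlgebra.antipode k) ?_ ?_ ?_ hf
  · intro f g hf hg
    rw [map_add, hf, hg, LinearMap.add_comp]
  · intro c f hf
    rw [map_smul, hf, LinearMap.smul_comp]
  · intro l
    ext y
    set χ := character (n := n) (ω ^ l) (pow_pow_eq_one hω l) with hχ
    rw [antipodeA_apply, AlgHom.toLinearMap_apply, map_sandwich, antipode_twist hN hω,
      ← twist_central hN hω hs, LinearMap.comp_apply, AlgHom.toLinearMap_apply]
    have h1 := special_rMatrix (β := β) hN hω (s := s)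
    rw [special] at h1
    have h2 : ∀ t : Radford k n ⊗[k] Radford k n, χ (LinearMap.mul' k _
        ((HopfAlgebra.antipode k).rTensor _ t)) = TensorProduct.lid k k (TensorProduct.map
        (χ.toLinearMap ∘ₗ HopfAlgebra.antipode k) χ.toLinearMap t) := by
      intro t
      induction t with
      | zero => simp
      | add t t' h h' => simp only [map_add, h, h']
      | tmul u v => simp
    rw [h1, h2, hχ, character_comp_antipode hω, lid_map_rMatrix hN hω, ← hχ, map_mul, map_mul, hχ,
      character_twist hN hω, map_pow, character_a, ← hχ]
    have h3 : ω ^ (l * n) * ω ^ (s * l ^ 2) * (ω ^ l) ^ n * (ω ^ l) ^ (s * (l * (2 * n - 1))) = 1 := by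
      rw [← pow_mul, ← pow_mul, ← pow_add, ← pow_add, ← pow_add, hω.pow_eq_one_iff_dvd]
      obtain ⟨m, hm⟩ : ∃ m, 2 * n = m + 1 := ⟨2 * n - 1, by have := hn.out.pos; omega⟩
      refine ⟨l + s * l ^ 2, ?_⟩
      rw [hm, Nat.add_sub_cancel, ← hm]
      have : l * n + s * l ^ 2 + l * n + l * (s * (l * m)) = l * (2 * n) + s * l ^ 2 * (m + 1) := by
        ring
      rw [this, ← hm]
      ring
    linear_combination (χ ((HopfAlgebra.antipode k) y)) * h3

/-- A character is grouplike for `Δ_A`, and characters multiply by convolution, so exponents add.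
The condition on `R` holds because `ε(a) = 1`. -/
theorem gammaA_character (l m : ℕ) : gammaA (rMatrix n ω s β)
    ((character (n := n) (ω ^ l) (pow_pow_eq_one hω l)).toLinearMap ⊗ₜ
      (character (n := n) (ω ^ m) (pow_pow_eq_one hω m)).toLinearMap) =
    (character (n := n) (ω ^ l) (pow_pow_eq_one hω l)).toLinearMap ⊗ₜ
      (character (n := n) (ω ^ (m + l)) (pow_pow_eq_one hω _)).toLinearMap := by
  simp only [gammaA, LinearMap.comp_apply, LinearMap.rTensor_tmul, comulA_character,
    LinearEquiv.coe_coe, TensorProduct.assoc_tmul, LinearMap.lTensor_tmul]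
  congr 1
  ext y
  rw [mulA_character]
  · refine linear_ext_apply hn.out.pos ((TensorProduct.lid k k).toLinearMap ∘ₗ (TensorProduct.map
      (character (n := n) (ω ^ m) (pow_pow_eq_one hω m)).toLinearMap
      (character (n := n) (ω ^ l) (pow_pow_eq_one hω l)).toLinearMap) ∘ₗ
      (Coalgebra.comul (R := k))) _ (fun i => ?_) (fun i => ?_) y
    · rw [LinearMap.comp_apply, LinearMap.comp_apply, comul_a_pow]
      simp [mul_pow, pow_add]
    · rw [LinearMap.comp_apply, LinearMap.comp_apply, comul_a_pow_mul_x]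
      simp
  · have := lid_map_rMatrix (s := s) (β := β) hN hω l (Bialgebra.counitAlgHom k (Radford k n))
    refine this.trans ?_
    rw [Bialgebra.counitAlgHom_apply, counit_a, one_pow]

end

end Radford

namespace RibbonHopf

variable {k H : Type u} [Field k] [Ring H] [HopfAlgebra k H] [FiniteDimensional k H]

omit [FiniteDimensional k H] in
theorem eqModNegligible_unitRep_iff {W : Type u} [AddCommGroup W] [Module k W] {R : H ⊗[k] H} {θ : H}
    (h1 : Coalgebra.counit (R := k) (drinfeld R * θ) = 1) (σ : H →ₐ[k] Module.End k W)
    (f g : k →ₗ[k] W) : EqModNegligible R θ (unitRep k H) σ f g ↔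
      (∀ h, σ h (f 1) + Coalgebra.counit (R := k) h • g 1 =
        σ h (g 1) + Coalgebra.counit (R := k) h • f 1) ∧
      ∀ φ : W →ₗ[k] k, IsHom σ (unitRep k H) φ → φ (f 1) = φ (g 1) := by
  simp only [EqModNegligible, isNegligible_unitRep_iff h1, LinearMap.sub_apply, map_sub,
    sub_eq_zero, smul_sub]
  refine and_congr (forall_congr' fun h => ?_) Iff.rfl
  rw [sub_eq_sub_iff_add_eq_add, add_comm (_ • _) (σ h _)]

theorem eqModNegligible_gammaA_iff {R : H ⊗[k] H} {θ : H}
    (h1 : Coalgebra.counit (R := k) (drinfeld R * θ) = 1) (α : k →ₗ[k] Module.Dual k H) :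
    EqModNegligible R θ (unitRep k H) (tensorRep (coadjointRep k H) (coadjointRep k H))
      (gammaA R ∘ₗ tensorSquare α) (tensorSquare α) ↔
    (∀ h, tensorRep (coadjointRep k H) (coadjointRep k H) h (gammaA R (α 1 ⊗ₜ α 1)) +
      Coalgebra.counit (R := k) h • (α 1 ⊗ₜ α 1) =
      tensorRep (coadjointRep k H) (coadjointRep k H) h (α 1 ⊗ₜ α 1) +
        Coalgebra.counit (R := k) h • gammaA R (α 1 ⊗ₜ α 1)) ∧
    ∀ g : Module.Dual k H ⊗[k] Module.Dual k H →ₗ[k] k,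
      IsHom (tensorRep (coadjointRep k H) (coadjointRep k H)) (unitRep k H) g →
        g (gammaA R (α 1 ⊗ₜ α 1)) = g (α 1 ⊗ₜ α 1) := by
  have hsq : tensorSquare α 1 = α 1 ⊗ₜ α 1 := by simp [tensorSquare]
  rw [eqModNegligible_unitRep_iff h1, LinearMap.comp_apply, hsq]

end RibbonHopf

/-! ### The conditions defining `I(H)`, tested on even powers of `a` -/

namespace Radford

open RootCalculus RibbonHopf

variable {k : Type u} [Field k] {n : ℕ} {ω : k} {s : ℕ} {β : k}

/-- The span of the tensor products of two functionals that vanish on the ideal generated by `x`. -/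
def reducedSq (k : Type u) [Field k] (n : ℕ) :
    Submodule k (Module.Dual k (Radford k n) ⊗[k] Module.Dual k (Radford k n)) :=
  Submodule.span k {t | ∃ f ∈ reduced k n, ∃ g ∈ reduced k n, t = f ⊗ₜ g}

theorem tmul_mem_reducedSq {f g : Module.Dual k (Radford k n)} (hf : f ∈ reduced k n)
    (hg : g ∈ reduced k n) : f ⊗ₜ g ∈ reducedSq k n :=
  Submodule.subset_span ⟨f, hf, g, hg, rfl⟩

section
variable (hN : ((2 * n : ℕ) : k) ≠ 0) (hω : IsPrimitiveRoot ω (2 * n)) [hn : Fact (Odd n)]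
include hN hω

/-- By bilinearity the case of two characters suffices. The values show that `Γ_l` is the transpose
of the shear `(i, j) ↦ (i + j, j)`. -/
theorem gammaA_reduced {f g : Module.Dual k (Radford k n)} (hf : f ∈ reduced k n)
    (hg : g ∈ reduced k n) : gammaA (rMatrix n ω s β) (f ⊗ₜ g) ∈ reducedSq k n ∧
    ∀ i j, TensorProduct.dualDistrib k _ _ (gammaA (rMatrix n ω s β) (f ⊗ₜ g))
      ((a k n ^ i) ⊗ₜ (a k n ^ j)) = f (a k n ^ (i + j)) * g (a k n ^ j) := by
  refine reduced_induction hN hω (P := fun f => gammaA (rMatrix n ω s β) (f ⊗ₜ g) ∈ reducedSq k n ∧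
    ∀ i j, TensorProduct.dualDistrib k _ _ (gammaA (rMatrix n ω s β) (f ⊗ₜ g))
      ((a k n ^ i) ⊗ₜ (a k n ^ j)) = f (a k n ^ (i + j)) * g (a k n ^ j)) ?_ ?_ ?_ hf
  · rintro f f' ⟨h1, h2⟩ ⟨h1', h2'⟩
    rw [TensorProduct.add_tmul, map_add]
    refine ⟨add_mem h1 h1', fun i j => ?_⟩
    rw [map_add, LinearMap.add_apply, h2, h2', LinearMap.add_apply, add_mul]
  · rintro c f ⟨h1, h2⟩
    rw [← TensorProduct.smul_tmul', map_smul]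
    refine ⟨Submodule.smul_mem _ _ h1, fun i j => ?_⟩
    rw [map_smul, LinearMap.smul_apply, h2, LinearMap.smul_apply, smul_eq_mul, smul_eq_mul, mul_assoc]
  intro l
  refine reduced_induction hN hω (P := fun g => gammaA (rMatrix n ω s β)
      ((character (ω ^ l) (pow_pow_eq_one hω l)).toLinearMap ⊗ₜ g) ∈ reducedSq k n ∧
    ∀ i j, TensorProduct.dualDistrib k _ _ (gammaA (rMatrix n ω s β)
      ((character (ω ^ l) (pow_pow_eq_one hω l)).toLinearMap ⊗ₜ g))
      ((a k n ^ i) ⊗ₜ (a k n ^ j)) =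
      character (ω ^ l) (pow_pow_eq_one hω l) (a k n ^ (i + j)) * g (a k n ^ j)) ?_ ?_ ?_ hg
  · rintro f f' ⟨h1, h2⟩ ⟨h1', h2'⟩
    rw [TensorProduct.tmul_add, map_add]
    refine ⟨add_mem h1 h1', fun i j => ?_⟩
    rw [map_add, LinearMap.add_apply, h2, h2', LinearMap.add_apply, mul_add]
  · rintro c f ⟨h1, h2⟩
    rw [TensorProduct.tmul_smul, map_smul]
    refine ⟨Submodule.smul_mem _ _ h1, fun i j => ?_⟩
    rw [map_smul, LinearMap.smul_apply, h2, LinearMap.smul_apply, smul_eq_mul, smul_eq_mul,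
      mul_left_comm]
  · intro m
    rw [gammaA_character hN hω]
    refine ⟨tmul_mem_reducedSq (character_mem_reduced _ _) (character_mem_reduced _ _), fun i j => ?_⟩
    simp only [TensorProduct.dualDistrib_apply, AlgHom.toLinearMap_apply, map_pow, character_a]
    ring

theorem tensorRep_reducedSq {t} (ht : t ∈ reducedSq k n) (h : Radford k n) :
    tensorRep (coadjointRep k (Radford k n)) (coadjointRep k (Radford k n)) h t =
      Coalgebra.counit (R := k) h • t := by
  induction ht using Submodule.span_induction with
  | mem t ht =>
    obtain ⟨f, hf, g, hg, rfl⟩ := ht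
    exact actTwo_of_invariant ((mem_reduced_iff hN hω f).mp hf) ((mem_reduced_iff hN hω g).mp hg) h
  | zero => simp
  | add t t' _ _ ht ht' => rw [map_add, ht, ht', smul_add]
  | smul c t _ ht => rw [map_smul, ht, smul_comm]

/-- For every `w'` one has `(x w')(a^i) = (1 - (-1)^i) w'(a^i x)`, because `n` is odd. Thus the
image of `x` contains every reduced functional supported on odd powers of `a`, and invariant
functionals kill this image since `ε(x) = 0`. -/
theorem exists_coadjoint_x {w : Module.Dual k (Radford k n)} (hw : w ∈ reduced k n)
    (h0 : ∀ i, Even i → w (a k n ^ i) = 0) :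
    ∃ w' : Module.Dual k (Radford k n), coadjointRep k (Radford k n) (x k n) w' = w := by
  -- The values `w(a^p) / 2` are placed on `a^p x`; the `2⁻¹` cancels `1 - (-1)^p = 2` for odd `p`.
  refine ⟨(2 : k)⁻¹ • ∑ p ∈ Finset.range (2 * n), w (a k n ^ p) • coordX hω p, ?_⟩
  set w' : Module.Dual k (Radford k n) :=
    (2 : k)⁻¹ • ∑ p ∈ Finset.range (2 * n), w (a k n ^ p) • coordX hω p with hw'
  have h1 : ∀ i, w' (a k n ^ i * x k n) = (2 : k)⁻¹ * w (a k n ^ i) := by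
    intro i
    have e := sum_range_ite (N := 2 * n) (by have := hn.out.pos; omega) i (fun p => w (a k n ^ p))
    rw [pow_congr' (a_pow k n) (Nat.mod_modEq i (2 * n))] at e
    simp only [hw', LinearMap.smul_apply, LinearMap.sum_apply, coordX_a_pow_mul_x hN, smul_eq_mul,
      mul_ite, mul_one, mul_zero, e]
  have h2 : ∀ y, coadjointRep k (Radford k n) (x k n) w' y =
      w' (a k n ^ n * x k n * (y * a k n ^ n)) + w' (y * x k n) := by
    intro y
    rw [coadjointRep_apply, comul_x]
    simp [antipode_x]
  refine linear_ext hn.out.pos (fun i => ?_) (fun i => ?_)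
  · have e : a k n ^ n * x k n * (a k n ^ i * a k n ^ n) = (-1 : k) ^ (i + n) • (a k n ^ i * x k n) := by
      rw [← pow_add, mul_assoc, x_mul_a_pow_smul, mul_smul_comm, ← mul_assoc, ← pow_add,
        show n + (i + n) = 2 * n + i by ring, pow_add (a k n), a_pow, one_mul]
    rw [h2, e, map_smul, h1, smul_eq_mul, pow_add, hn.out.neg_one_pow]
    rcases Nat.even_or_odd i with hi | hi
    · rw [h0 i hi]; simp
    · rw [hi.neg_one_pow]
      have := two_ne_zero' hN
      field_simp
      ring
  · have e1 : a k n ^ i * x k n * x k n = 0 := by rw [mul_assoc, x_mul_x, mul_zero]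
    have e2 : a k n ^ n * x k n * (a k n ^ i * x k n * a k n ^ n) = 0 := by
      rw [← mul_assoc (a k n ^ n * x k n), mul_x_mul_pow_mul_x, zero_mul]
    rw [h2, hw i, e1, e2, map_zero, add_zero]

omit hN hω in
theorem tensorRep_x_apply (f g : Module.Dual k (Radford k n)) :
    tensorRep (coadjointRep k (Radford k n)) (coadjointRep k (Radford k n)) (x k n) (f ⊗ₜ g) =
      coadjointRep k (Radford k n) (x k n) f ⊗ₜ coadjointRep k (Radford k n) (a k n ^ n) g +
        f ⊗ₜ coadjointRep k (Radford k n) (x k n) g := by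
  have : tensorRep (coadjointRep k (Radford k n)) (coadjointRep k (Radford k n)) (x k n) (f ⊗ₜ g) =
    actTwo (coadjointRep k (Radford k n)) (coadjointRep k (Radford k n))
      (Coalgebra.comul (R := k) (x k n)) (f ⊗ₜ g) := rfl
  rw [this, comul_x, map_add, LinearMap.add_apply, actTwo_tmul, actTwo_tmul, map_one]
  rfl

omit hN hω in
theorem hom_apply_x {W : Type*} [AddCommGroup W] [Module k W]
    {σ : Radford k n →ₐ[k] Module.End k W} {g : W →ₗ[k] k}
    (hg : IsHom σ (unitRep k (Radford k n)) g) (w : W) : g (σ (x k n) w) = 0 := by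
  have h := LinearMap.congr_fun (hg (x k n)) w
  have hu : ∀ c : k, unitRep k (Radford k n) (x k n) c = Coalgebra.counit (R := k) (x k n) * c :=
    fun c => rfl
  rwa [LinearMap.comp_apply, LinearMap.comp_apply, hu, counit_x, zero_mul] at h

theorem hom_reduced_eq_zero {g : Module.Dual k (Radford k n) →ₗ[k] k}
    (hg : IsHom (coadjointRep k (Radford k n)) (unitRep k (Radford k n)) g)
    {w : Module.Dual k (Radford k n)} (hw : w ∈ reduced k n)
    (h0 : ∀ i, Even i → w (a k n ^ i) = 0) : g w = 0 := by
  obtain ⟨w', rfl⟩ := exists_coadjoint_x hN hω hw h0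
  exact hom_apply_x hg w'

/-- As `x` annihilates the invariant `f`, `x (f ⊗ w') = f ⊗ x w'`. In the mirrored case the term `x
w' ⊗ a^n f` survives, and `a^n` fixes `f`. -/
theorem hom_tmul_eq_zero_right
    {g : Module.Dual k (Radford k n) ⊗[k] Module.Dual k (Radford k n) →ₗ[k] k}
    (hg : IsHom (tensorRep (coadjointRep k (Radford k n)) (coadjointRep k (Radford k n)))
      (unitRep k (Radford k n)) g)
    {f w : Module.Dual k (Radford k n)} (hf : f ∈ reduced k n) (hw : w ∈ reduced k n)
    (h0 : ∀ i, Even i → w (a k n ^ i) = 0) : g (f ⊗ₜ w) = 0 := by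
  obtain ⟨w', rfl⟩ := exists_coadjoint_x hN hω hw h0
  have := hom_apply_x hg (f ⊗ₜ w')
  rwa [tensorRep_x_apply, (mem_reduced_iff hN hω f).mp hf, counit_x, zero_smul,
    TensorProduct.zero_tmul, zero_add] at this

theorem hom_tmul_eq_zero_left
    {g : Module.Dual k (Radford k n) ⊗[k] Module.Dual k (Radford k n) →ₗ[k] k}
    (hg : IsHom (tensorRep (coadjointRep k (Radford k n)) (coadjointRep k (Radford k n)))
      (unitRep k (Radford k n)) g)
    {f w : Module.Dual k (Radford k n)} (hf : f ∈ reduced k n) (hw : w ∈ reduced k n)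
    (h0 : ∀ i, Even i → w (a k n ^ i) = 0) : g (w ⊗ₜ f) = 0 := by
  obtain ⟨w', rfl⟩ := exists_coadjoint_x hN hω hw h0
  have := hom_apply_x hg (w' ⊗ₜ f)
  have hf' := (mem_reduced_iff hN hω f).mp hf
  rwa [tensorRep_x_apply, hf', hf', counit_x, zero_smul, Bialgebra.counit_pow, counit_a,
    one_pow, one_smul, TensorProduct.tmul_zero, add_zero] at this

/-- After expansion in the coordinates `coordA`, each term with an odd index is killed, so an
invariant functional sees only the values at pairs of even powers. -/
theorem hom_reducedSq
    {g : Module.Dual k (Radford k n) ⊗[k] Module.Dual k (Radford k n) →ₗ[k] k}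
    (hg : IsHom (tensorRep (coadjointRep k (Radford k n)) (coadjointRep k (Radford k n)))
      (unitRep k (Radford k n)) g) {t} (ht : t ∈ reducedSq k n) :
    g t = ∑ i ∈ Finset.range (2 * n), ∑ j ∈ Finset.range (2 * n), if Even i ∧ Even j then
      TensorProduct.dualDistrib k _ _ t ((a k n ^ i) ⊗ₜ (a k n ^ j)) *
        g (coordA hω i ⊗ₜ coordA hω j) else 0 := by
  -- Congruence modulo `2n` preserves parity, so a coordinate of odd index vanishes on even powers.
  have hz : ∀ i, Odd i → ∀ j, Even j → coordA hω i (a k n ^ j) = 0 := by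
    intro i hi j hj
    rw [coordA_a_pow hN, if_neg]
    intro h
    have h2 : i % 2 = j % 2 := (h.of_mul_right n : i ≡ j [MOD 2])
    rw [Nat.odd_iff.mp hi, Nat.even_iff.mp hj] at h2
    exact one_ne_zero h2
  induction ht using Submodule.span_induction with
  | mem t ht =>
    obtain ⟨f, hf, f', hf', rfl⟩ := ht
    conv_lhs => rw [reduced_eq_sum_coord hN hω hf, reduced_eq_sum_coord hN hω hf',
      TensorProduct.sum_tmul, map_sum]
    refine Finset.sum_congr rfl fun i _ => ?_
    rw [TensorProduct.tmul_sum, map_sum]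
    refine Finset.sum_congr rfl fun j _ => ?_
    rw [TensorProduct.smul_tmul_smul, map_smul, TensorProduct.dualDistrib_apply, smul_eq_mul]
    split_ifs with hij
    · rfl
    · rw [not_and_or, Nat.not_even_iff_odd, Nat.not_even_iff_odd] at hij
      rcases hij with h | h
      · rw [hom_tmul_eq_zero_left hN hω hg (coordA_mem_reduced hω j) (coordA_mem_reduced hω i)
          (hz i h), mul_zero]
      · rw [hom_tmul_eq_zero_right hN hω hg (coordA_mem_reduced hω i) (coordA_mem_reduced hω j)
          (hz j h), mul_zero]
  | zero => simp
  | add t t' _ _ ht ht' =>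
    rw [map_add, ht, ht', ← Finset.sum_add_distrib]
    refine Finset.sum_congr rfl fun i _ => ?_
    rw [← Finset.sum_add_distrib]
    refine Finset.sum_congr rfl fun j _ => ?_
    split_ifs
    · rw [map_add, LinearMap.add_apply, add_mul]
    · simp
  | smul c t _ ht =>
    rw [map_smul, ht, Finset.smul_sum]
    refine Finset.sum_congr rfl fun i _ => ?_
    rw [Finset.smul_sum]
    refine Finset.sum_congr rfl fun j _ => ?_
    split_ifs
    · rw [map_smul, LinearMap.smul_apply, smul_eq_mul, smul_eq_mul, mul_assoc]
    · simp

omit hN hω hn in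
theorem a_pow_even_central {i : ℕ} (hi : Even i) (h : Radford k n) :
    a k n ^ i * h = h * a k n ^ i := by
  induction h using induction with
  | hadd u v hu hv => rw [mul_add, add_mul, hu, hv]
  | halg r => rw [Algebra.commutes]
  | hmul u v hu hv => rw [← mul_assoc, hu, mul_assoc, hv, mul_assoc]
  | ha => rw [← pow_succ, ← pow_succ']
  | hx => rw [x_mul_even hi]

/-- Even powers of `a` are central, so evaluating at them gives necessity. Sufficiency holds because
invariant functionals see nothing else of a reduced functional, or of a tensor of two of them. -/
theorem mem_catKirby_iff (hs : Odd s) (α : k →ₗ[k] Module.Dual k (Radford k n)) :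
    α ∈ catKirby (rMatrix n ω s β) (twist n ω s) ↔ α 1 ∈ reduced k n ∧
      (∀ i, Even i → α 1 (a k n ^ (i * (2 * n - 1))) = α 1 (a k n ^ i)) ∧
      ∀ i j, Even i → Even j → α 1 (a k n ^ (i + j)) * α 1 (a k n ^ j) =
        α 1 (a k n ^ i) * α 1 (a k n ^ j) := by
  have hε := counit_drinfeld_mul_twist (β := β) hN hω hs
  have hS : ∀ i, HopfAlgebra.antipode k (a k n ^ i) = a k n ^ (i * (2 * n - 1)) := fun i => by
    rw [antipode_a_pow, ← pow_mul, mul_comm]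
  rw [catKirby, Set.mem_ofPred_eq, eqModNegligible_gammaA_iff hε]
  simp only [EqModNegligible, isNegligible_unitRep_iff hε,
    isHom_unitRep_iff, LinearMap.sub_apply, LinearMap.comp_apply, ← mem_reduced_iff hN hω]
  refine and_congr_right fun hf => ?_
  have hanti : antipodeA (rMatrix n ω s β) (twist n ω s) (α 1) ∈ reduced k n := by
    rw [antipodeA_reduced hN hω hs hf]
    intro i
    rw [LinearMap.comp_apply, antipode_mul, antipode_x, hS, mul_assoc, x_mul_a_pow_smul,
      mul_smul_comm, map_smul, ← mul_assoc, ← pow_add, hf, smul_zero]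
  obtain ⟨hg1, hg2⟩ := gammaA_reduced (s := s) (β := β) hN hω hf hf
  have hY := tmul_mem_reducedSq hf hf
  refine and_congr ?_ ?_
  · constructor
    · rintro ⟨-, h⟩ i hi
      have := h _ (isHom_eval (fun y => a_pow_even_central hi y))
      rw [antipodeA_reduced hN hω hs hf, Module.Dual.eval_apply, LinearMap.sub_apply,
        LinearMap.comp_apply, hS] at this
      exact sub_eq_zero.mp this
    · intro h
      refine ⟨sub_mem hanti hf, fun g hg => ?_⟩
      refine hom_reduced_eq_zero hN hω hg (sub_mem hanti hf) fun i hi => ?_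
      rw [antipodeA_reduced hN hω hs hf, LinearMap.sub_apply, LinearMap.comp_apply, hS, h i hi,
        sub_self]
  · constructor
    · rintro ⟨-, h⟩ i j hi hj
      have := h _ (isHom_eval_tmul (fun y => a_pow_even_central hi y)
        (fun y => a_pow_even_central hj y))
      rwa [LinearMap.flip_apply, LinearMap.flip_apply, hg2, TensorProduct.dualDistrib_apply] at this
    · intro h
      refine ⟨fun y => ?_, fun g hg => ?_⟩
      · rw [tensorRep_reducedSq hN hω hg1, tensorRep_reducedSq hN hω hY, add_comm]
      rw [hom_reducedSq hN hω hg hg1, hom_reducedSq hN hω hg hY]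
      refine Finset.sum_congr rfl fun i _ => Finset.sum_congr rfl fun j _ => ?_
      split_ifs with hij
      · rw [hg2, h i j hij.1 hij.2, TensorProduct.dualDistrib_apply]
      · rfl

end

end Radford

/-! ### From functionals back to elements: the classification -/

namespace Radford

open RootCalculus RibbonHopf

variable {k : Type u} [Field k] {n : ℕ} {ω : k} {s : ℕ} {β : k}

theorem phi_one_apply {H : Type u} [Ring H] [HopfAlgebra k H] [FiniteDimensional k H]
    (lam : Module.Dual k H) (z y : H) : phi lam z 1 y = lam (z * y) := by
  simp [phi]

section
variable (hN : ((2 * n : ℕ) : k) ≠ 0) (hω : IsPrimitiveRoot ω (2 * n)) [hn : Fact (Odd n)]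
include hN hω

section
variable {lam : Module.Dual k (Radford k n)} (hlam : IsDualRightIntegral lam)
include hlam

/-- The integral reads the coefficient of `a^n x`, so pairing with `a^j x` isolates the coefficient
of `a^(n - j)` in `z`; the `x`-part of `z` dies by `x² = 0`. -/
theorem dualRightIntegral_mul_a_pow_mul_x {p j : ℕ} (hpj : p + j ≡ n [MOD 2 * n])
    (z : Radford k n) : lam (z * (a k n ^ j * x k n)) = lam (a k n ^ n * x k n) * coordA hω p z := by
  refine linear_ext_apply hn.out.pos (lam ∘ₗ LinearMap.mulRight k (a k n ^ j * x k n))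
    (lam (a k n ^ n * x k n) • coordA hω p) (fun i => ?_) (fun i => ?_) z
  · have h : (n ≡ i + j [MOD 2 * n]) ↔ (p ≡ i [MOD 2 * n]) :=
      ⟨fun h => Nat.ModEq.add_right_cancel' j (hpj.trans h), fun h => hpj.symm.trans (h.add_right j)⟩
    rw [LinearMap.comp_apply, LinearMap.mulRight_apply, ← mul_assoc, ← pow_add,
      dualRightIntegral_a_pow_mul_x hN hω hlam, LinearMap.smul_apply, coordA_a_pow hN, if_congr h rfl rfl,
      smul_eq_mul, mul_ite, mul_one, mul_zero]
  · rw [LinearMap.comp_apply, LinearMap.mulRight_apply, mul_x_mul_pow_mul_x, map_zero,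
      LinearMap.smul_apply, coordA_a_pow_mul_x, smul_zero]

theorem phi_mem_reduced_iff (h0 : lam ≠ 0) (z : Radford k n) :
    phi lam z 1 ∈ reduced k n ↔ ∀ p, coordA hω p z = 0 := by
  have hc := dualRightIntegral_apply_ne_zero hN hω hlam h0
  -- The exponent `n + p (2n - 1)` stands for `n - p` modulo `2n`.
  have hm : ∀ p, p + (n + p * (2 * n - 1)) ≡ n [MOD 2 * n] := fun p => by
    rw [show p + (n + p * (2 * n - 1)) = n + 2 * n * p by
      have := hn.out.pos
      obtain ⟨m, hm⟩ : ∃ m, 2 * n = m + 1 := ⟨2 * n - 1, by omega⟩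
      rw [hm, Nat.add_sub_cancel]
      ring]
    simp [Nat.ModEq]
  constructor
  · intro h p
    have h1 := h (n + p * (2 * n - 1))
    rw [phi_one_apply, dualRightIntegral_mul_a_pow_mul_x hN hω hlam (hm p)] at h1
    exact (mul_eq_zero.mp h1).resolve_left hc
  · intro h j
    have h1 := hm j
    rw [add_left_comm, add_comm j, ← add_assoc] at h1
    rw [phi_one_apply, dualRightIntegral_mul_a_pow_mul_x hN hω hlam h1, h, mul_zero]

/-- Both conditions say that `z` is a combination of the `a^p x`. For `L(H)`, the element `a`
already gives `-a z = z a`, while `a` commutes with the powers of `a` occurring in `z`. -/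
theorem mem_setL_iff (h0 : lam ≠ 0) {ν : Radford k n →ₐ[k] k} (hν : IsDistinguished ν)
    (z : Radford k n) : z ∈ setL ν ↔ phi lam z 1 ∈ reduced k n := by
  obtain ⟨ha, hx⟩ := (isDistinguished_iff hN hω ν).mp hν
  rw [phi_mem_reduced_iff hN hω hlam h0]
  constructor
  · intro h p
    have h1 := h (a k n ^ 1)
    rw [hit_a_pow, pow_one, AlgHom.toLinearMap_apply, ha, neg_one_smul] at h1
    -- In `z a + a z` the `x`-part of `z` cancels and its powers of `a` are doubled and shifted by
    -- one.
    have h2 : coordA hω (p + 1) (z * a k n + a k n * z) = 2 * coordA hω p z := by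
      refine linear_ext_apply hn.out.pos
        (coordA hω (p + 1) ∘ₗ (LinearMap.mulRight k (a k n) + LinearMap.mulLeft k (a k n)))
        ((2 : k) • coordA hω p) (fun i => ?_) (fun i => ?_) z
      · rw [LinearMap.comp_apply, LinearMap.add_apply, LinearMap.mulRight_apply,
          LinearMap.mulLeft_apply, ← pow_succ, ← pow_succ', map_add, coordA_a_pow hN,
          LinearMap.smul_apply, coordA_a_pow hN, ← two_mul, smul_eq_mul]
        congr 1
        refine if_congr ⟨fun h => Nat.ModEq.add_right_cancel' 1 h, fun h => h.add_right 1⟩ rfl rfl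
      · rw [LinearMap.comp_apply, LinearMap.add_apply, LinearMap.mulRight_apply,
          LinearMap.mulLeft_apply, mul_assoc, x_mul_a, mul_neg, ← mul_assoc, ← mul_assoc,
          ← pow_succ, ← pow_succ', neg_add_cancel, map_zero, LinearMap.smul_apply,
          coordA_a_pow_mul_x, smul_zero]
    rw [← h1, neg_mul, neg_add_cancel, map_zero] at h2
    exact (mul_eq_zero.mp h2.symm).resolve_left (two_ne_zero' hN)
  · intro h y
    rw [eq_sum_coord hω hN z, Finset.mul_sum, Finset.sum_mul]
    refine Finset.sum_congr rfl fun p _ => ?_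
    rw [h p, zero_smul, zero_add, mul_smul_comm, smul_mul_assoc]
    congr 1
    refine linear_ext_apply hn.out.pos
      (LinearMap.mulRight k (a k n ^ p * x k n) ∘ₗ hit ν.toLinearMap)
      (LinearMap.mulLeft k (a k n ^ p * x k n)) (fun i => ?_) (fun i => ?_) y
    · rw [LinearMap.comp_apply, LinearMap.mulRight_apply, LinearMap.mulLeft_apply, hit_a_pow,
        AlgHom.toLinearMap_apply, map_pow, ha, mul_assoc, x_mul_a_pow_smul, mul_smul_comm,
        smul_mul_assoc, ← mul_assoc, ← mul_assoc, ← pow_add, ← pow_add, add_comm]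
    · rw [LinearMap.comp_apply, LinearMap.mulRight_apply, LinearMap.mulLeft_apply, hit_a_pow_mul_x,
        AlgHom.toLinearMap_apply, map_mul, hx, mul_zero, zero_smul, zero_add, smul_mul_assoc,
        mul_x_mul_pow_mul_x, mul_x_mul_pow_mul_x, smul_zero]

omit hlam in
-- The coefficient of `a^p x` in `c x` is that of `a^p` in `c`, whereas in `x c` it acquires the
-- sign `(-1)^p`.
theorem coordA_center {c : Radford k n} (hc : c ∈ Subring.center (Radford k n)) {p : ℕ}
    (hp : Odd p) : coordA hω p c = 0 := by
  have h1 : coordX hω p (c * x k n) = coordA hω p c := by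
    refine linear_ext_apply hn.out.pos (coordX hω p ∘ₗ LinearMap.mulRight k (x k n)) (coordA hω p)
      (fun i => ?_) (fun i => ?_) c
    · rw [LinearMap.comp_apply, LinearMap.mulRight_apply, coordX_a_pow_mul_x hN, coordA_a_pow hN]
    · rw [LinearMap.comp_apply, LinearMap.mulRight_apply, mul_assoc, x_mul_x, mul_zero, map_zero,
        coordA_a_pow_mul_x]
  have h2 : coordX hω p (x k n * c) = -coordA hω p c := by
    refine linear_ext_apply hn.out.pos (coordX hω p ∘ₗ LinearMap.mulLeft k (x k n)) (-coordA hω p)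
      (fun i => ?_) (fun i => ?_) c
    · rw [LinearMap.comp_apply, LinearMap.mulLeft_apply, x_mul_a_pow_smul, map_smul,
        coordX_a_pow_mul_x hN, LinearMap.neg_apply, coordA_a_pow hN, smul_eq_mul]
      split_ifs with h
      · have h2 : p % 2 = i % 2 := (h.of_mul_right n : p ≡ i [MOD 2])
        have : Odd i := by rw [Nat.odd_iff, ← h2, Nat.odd_iff.mp hp]
        rw [this.neg_one_pow, mul_one]
      · simp
    · rw [LinearMap.comp_apply, LinearMap.mulLeft_apply, ← mul_assoc, x_mul_a_pow_smul,
        smul_mul_assoc, mul_assoc, x_mul_x, mul_zero, smul_zero, map_zero, LinearMap.neg_apply,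
        coordA_a_pow_mul_x, neg_zero]
  rw [Subring.mem_center_iff.mp hc, h1] at h2
  have h3 : (2 : k) * coordA hω p c = 0 := by linear_combination h2
  exact (mul_eq_zero.mp h3).resolve_left (two_ne_zero' hN)

/-- A central element is a combination of even powers of `a` and of the `a^p x`, and a reduced
functional vanishes on the latter. -/
theorem mem_setN_iff (h0 : lam ≠ 0) {ν : Radford k n →ₐ[k] k} (hν : IsDistinguished ν)
    (z : Radford k n) : z ∈ setN lam ν ↔ phi lam z 1 ∈ reduced k n ∧
      ∀ i, Even i → phi lam z 1 (a k n ^ i) = 0 := by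
  rw [setN, Set.mem_ofPred_eq, mem_setL_iff hN hω hlam h0 hν]
  refine and_congr_right fun hf => ⟨fun h i hi => ?_, fun h c hc => ?_⟩
  · rw [phi_one_apply]
    exact h _ (Subring.mem_center_iff.mpr fun g => (a_pow_even_central hi g).symm)
  · rw [← phi_one_apply, eq_sum_coord hω hN c, map_sum]
    refine Finset.sum_eq_zero fun p _ => ?_
    rw [map_add, map_smul, map_smul, hf p, smul_zero, add_zero]
    rcases Nat.even_or_odd p with hp | hp
    · rw [h p hp, smul_zero]
    · rw [coordA_center hN hω hc hp, zero_smul]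

omit hN hω hlam in
theorem phi_zElem_mem_reduced (d : ℕ) : phi lam (zElem k n d) 1 ∈ reduced k n := by
  intro i
  rw [phi_one_apply, zElem, Finset.sum_mul, map_sum]
  refine Finset.sum_eq_zero fun j _ => ?_
  rw [mul_x_mul_pow_mul_x, map_zero]

/-- For even `i` the product `z_d a^i` is the sum of the `a^(2dj + n + i) x`. It contains `a^n x`
when `2n` divides `2dj + i`, which has exactly one solution `j < n / d` if `2d` divides `i`, and
none otherwise. -/
theorem phi_zElem_a_pow {d : ℕ} (hd : d ∈ n.divisors) {i : ℕ} (hi : Even i) :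
    phi lam (zElem k n d) 1 (a k n ^ i) = if 2 * d ∣ i then lam (a k n ^ n * x k n) else 0 := by
  obtain ⟨m, hm⟩ := Nat.dvd_of_mem_divisors hd
  have hpos := hn.out.pos
  have hd0 : 0 < d := Nat.pos_of_mem_divisors hd
  have hm0 : 0 < m := Nat.pos_of_ne_zero (by rintro rfl; omega)
  have hj : ∀ j, (n ≡ 2 * d * j + n + i [MOD 2 * n]) ↔ 2 * n ∣ 2 * d * j + i := fun j => by
    rw [show 2 * d * j + n + i = n + (2 * d * j + i) by ring, Nat.ModEq.comm,
      Nat.add_modEq_left_iff]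
  have hterm : ∀ j, lam (a k n ^ (2 * d * j + n) * x k n * a k n ^ i) =
      if 2 * n ∣ 2 * d * j + i then lam (a k n ^ n * x k n) else 0 := fun j => by
    rw [mul_assoc, x_mul_a_pow_smul, hi.neg_one_pow, one_smul, ← mul_assoc, ← pow_add,
      dualRightIntegral_a_pow_mul_x hN hω hlam, if_congr (hj j) rfl rfl]
  rw [phi_one_apply, zElem, Finset.sum_mul, map_sum,
    show n / d = m from Nat.div_eq_of_eq_mul_right hd0 hm]
  simp only [hterm]
  split_ifs with h
  · obtain ⟨t, rfl⟩ := h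
    -- With `m = n / d` and `i = 2d t`, the solution is `j ≡ -t` modulo `m`, written `t (m - 1)`.
    have e := sum_range_ite (N := m) hm0.ne' (t * (m - 1)) (fun _ => lam (a k n ^ n * x k n))
    refine Eq.trans (Finset.sum_congr rfl fun j _ => if_congr ?_ rfl rfl) e
    have hmt : t * (m - 1) + t = m * t := by
      obtain ⟨q, rfl⟩ := Nat.exists_eq_succ_of_ne_zero hm0.ne'
      simp only [Nat.succ_eq_add_one, Nat.add_sub_cancel]
      ring
    have hnm : 2 * n = 2 * d * m := by rw [hm]; ring
    rw [hnm, ← mul_add, Nat.mul_dvd_mul_iff_left (by omega)]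
    constructor
    · intro h
      refine Nat.ModEq.add_right_cancel' t ?_
      rw [hmt]
      exact ((Nat.modEq_zero_iff_dvd).mpr h).trans (Nat.modEq_zero_iff_dvd.mpr ⟨t, rfl⟩).symm
    · intro h
      have := h.add_right t
      rw [hmt] at this
      exact Nat.modEq_zero_iff_dvd.mp (this.trans (Nat.modEq_zero_iff_dvd.mpr ⟨t, rfl⟩))
  · refine Finset.sum_eq_zero fun j _ => if_neg fun h' => h ?_
    have h2 : 2 * d ∣ 2 * d * j + i := (Dvd.intro m (by rw [hm]; ring)).trans h'
    exact (Nat.dvd_add_right (Dvd.intro j rfl)).mp h2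

theorem exists_smul_zElem_iff (h0 : lam ≠ 0) {ν : Radford k n →ₐ[k] k} (hν : IsDistinguished ν)
    {d : ℕ} (hd : d ∈ n.divisors) (α : k) (z : Radford k n) :
    (∃ w ∈ setN lam ν, z = α • zElem k n d + w) ↔ phi lam z 1 ∈ reduced k n ∧
      ∀ i, Even i → phi lam z 1 (a k n ^ i) =
        if 2 * d ∣ i then α * lam (a k n ^ n * x k n) else 0 := by
  have hphi : ∀ w, phi lam (α • zElem k n d + w) 1 = α • phi lam (zElem k n d) 1 + phi lam w 1 := by
    intro w
    ext y
    simp [phi, add_mul]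
  have hz := phi_zElem_mem_reduced (lam := lam) d
  constructor
  · rintro ⟨w, hw, rfl⟩
    obtain ⟨hw1, hw2⟩ := (mem_setN_iff hN hω hlam h0 hν w).mp hw
    rw [hphi]
    refine ⟨add_mem (Submodule.smul_mem _ _ hz) hw1, fun i hi => ?_⟩
    rw [LinearMap.add_apply, hw2 i hi, add_zero, LinearMap.smul_apply,
      phi_zElem_a_pow hN hω hlam hd hi, smul_eq_mul, mul_ite, mul_zero]
  · rintro ⟨h1, h2⟩
    refine ⟨z - α • zElem k n d, ?_, by abel⟩
    have h3 := hphi (z - α • zElem k n d)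
    rw [add_sub_cancel] at h3
    have h4 : phi lam (z - α • zElem k n d) 1 = phi lam z 1 - α • phi lam (zElem k n d) 1 := by
      rw [h3, add_sub_cancel_left]
    rw [mem_setN_iff hN hω hlam h0 hν, h4]
    refine ⟨Submodule.sub_mem _ h1 (Submodule.smul_mem _ _ hz), fun i hi => ?_⟩
    rw [LinearMap.sub_apply, h2 i hi, LinearMap.smul_apply, phi_zElem_a_pow hN hω hlam hd hi,
      smul_eq_mul, mul_ite, mul_zero, sub_self]

end

omit hN hω hn in
-- Where `G j ≠ 0` the equation cancels to `G (i + j) = G i`: elements of the support are periods,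
-- and `G` is constant on its support. If `G 0 ≠ 0`, the support consists of the multiples of its
-- least positive element `d`, and `d ∣ n` because `G n = G 0`. If `G 0 = 0`, then `G` vanishes and
-- any divisor will do.
theorem exists_dvd_eq_ite {G : ℕ → k} (hn0 : 0 < n) (hper : G n = G 0)
    (hG : ∀ i j, G (i + j) * G j = G i * G j) :
    ∃ d, d ∣ n ∧ ∀ j, G j = if d ∣ j then G 0 else 0 := by
  have h1 : ∀ i, G i ≠ 0 → G i = G 0 := fun i hi => by
    have := hG 0 i
    rw [zero_add] at this
    exact mul_right_cancel₀ hi this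
  by_cases h0 : G 0 = 0
  · refine ⟨1, one_dvd _, fun j => ?_⟩
    rw [if_pos (one_dvd _), h0]
    by_contra hj
    exact hj ((h1 j hj).trans h0)
  have hadd : ∀ i j, G j ≠ 0 → G (i + j) = G i := fun i j hj => mul_right_cancel₀ hj (hG i j)
  classical
  have hex : ∃ d, 0 < d ∧ G d ≠ 0 := ⟨n, hn0, by rwa [hper]⟩
  obtain ⟨hd0, hd⟩ := Nat.find_spec hex
  set d := Nat.find hex with hdef
  have hmul : ∀ q i, G (i + d * q) = G i := by
    intro q i
    induction q with
    | zero => simp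
    | succ q ih => rw [mul_add, mul_one, ← add_assoc, hadd _ _ hd, ih]
  have key : ∀ j, G j ≠ 0 ↔ d ∣ j := by
    intro j
    have e : G j = G (j % d) := by conv_lhs => rw [← Nat.mod_add_div j d, hmul]
    rw [e, Nat.dvd_iff_mod_eq_zero]
    constructor
    · intro hj
      by_contra hne
      exact Nat.find_min hex (Nat.mod_lt j hd0) ⟨Nat.pos_of_ne_zero hne, hj⟩
    · intro h
      rwa [h]
  refine ⟨d, (key n).mp (by rwa [hper]), fun j => ?_⟩
  split_ifs with h
  · exact h1 j ((key j).mpr h)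
  · by_contra hj
    exact h ((key j).mp hj)

/-- The function `G j = λ(z a^(2j))` has period `n` and satisfies the equation of the preceding
lemma. Evenness of `G` is no further restriction: a subgroup is closed under negation. -/
theorem mem_kirbySet_iff (hs : Odd s) {lam : Module.Dual k (Radford k n)}
    (hlam : IsDualRightIntegral lam) (h0 : lam ≠ 0) {ν : Radford k n →ₐ[k] k}
    (hν : IsDistinguished ν) (z : Radford k n) :
    z ∈ kirbySet (rMatrix n ω s β) (twist n ω s) lam ↔
      ∃ d ∈ n.divisors, ∃ α : k, ∃ w ∈ setN lam ν, z = α • zElem k n d + w := by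
  have hc := dualRightIntegral_apply_ne_zero hN hω hlam h0
  have hpos := hn.out.pos
  rw [kirbySet, Set.mem_ofPred_eq, mem_catKirby_iff hN hω hs]
  constructor
  · rintro ⟨hf, -, h2⟩
    obtain ⟨d, hd, hG⟩ := exists_dvd_eq_ite (G := fun j => phi lam z 1 (a k n ^ (2 * j))) hpos
      (by rw [a_pow, mul_zero, pow_zero])
      (fun i j => by simpa only [mul_add] using h2 (2 * i) (2 * j) (even_two_mul i) (even_two_mul j))
    have hd' : d ∈ n.divisors := Nat.mem_divisors.mpr ⟨hd, hpos.ne'⟩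
    refine ⟨d, hd', phi lam z 1 1 / lam (a k n ^ n * x k n), ?_⟩
    rw [exists_smul_zElem_iff hN hω hlam h0 hν hd']
    refine ⟨hf, fun i hi => ?_⟩
    obtain ⟨j, rfl⟩ := hi.two_dvd
    have := hG j
    simp only [mul_zero, pow_zero] at this
    rw [this, div_mul_cancel₀ _ hc]
    exact if_congr (Nat.mul_dvd_mul_iff_left two_pos).symm rfl rfl
  · rintro ⟨d, hd, α, hw⟩
    rw [exists_smul_zElem_iff hN hω hlam h0 hν hd] at hw
    obtain ⟨hf, h⟩ := hw
    have hdn := Nat.dvd_of_mem_divisors hd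
    refine ⟨hf, fun i hi => ?_, fun i j hi hj => ?_⟩
    · rw [h i hi, h _ (hi.mul_right _)]
      refine if_congr ?_ rfl rfl
      have h2 : 2 * d ∣ i * (2 * n - 1) + i := by
        have : i * (2 * n - 1) + i = 2 * n * i := by
          obtain ⟨m, hm⟩ : ∃ m, 2 * n = m + 1 := ⟨2 * n - 1, by omega⟩
          rw [hm, Nat.add_sub_cancel]
          ring
        rw [this]
        exact (mul_dvd_mul_left 2 hdn).mul_right i
      exact ⟨fun h' => (Nat.dvd_add_right h').mp h2, fun h' => h'.mul_right _⟩
    · rw [h _ (hi.add hj), h i hi, h j hj]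
      by_cases hj' : 2 * d ∣ j
      · rw [if_congr (Nat.dvd_add_left hj') rfl rfl]
      · rw [if_neg hj', mul_zero, mul_zero]

/-- The integral itself does not vanish on `a^n x`, so `φ_1` is not even `H`-linear. -/
theorem one_notMem_kirbySet (hs : Odd s) {lam : Module.Dual k (Radford k n)}
    (hlam : IsDualRightIntegral lam) (h0 : lam ≠ 0) :
    (1 : Radford k n) ∉ kirbySet (rMatrix n ω s β) (twist n ω s) lam := by
  rw [kirbySet, Set.mem_ofPred_eq, mem_catKirby_iff hN hω hs]
  rintro ⟨h, -⟩
  have := h n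
  rw [phi_one_apply, one_mul] at this
  exact dualRightIntegral_apply_ne_zero hN hω hlam h0 this

theorem divisor_unique {lam : Module.Dual k (Radford k n)}
    (hlam : IsDualRightIntegral lam) (h0 : lam ≠ 0) {ν : Radford k n →ₐ[k] k}
    (hν : IsDistinguished ν) {z : Radford k n} {d d' : ℕ} (hd : d ∈ n.divisors)
    (hd' : d' ∈ n.divisors) {α α' : k} (hα : α ≠ 0) (hα' : α' ≠ 0)
    (h : ∃ w ∈ setN lam ν, z = α • zElem k n d + w)
    (h' : ∃ w ∈ setN lam ν, z = α' • zElem k n d' + w) : d = d' := by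
  have hc := dualRightIntegral_apply_ne_zero hN hω hlam h0
  rw [exists_smul_zElem_iff hN hω hlam h0 hν hd] at h
  rw [exists_smul_zElem_iff hN hω hlam h0 hν hd'] at h'
  have key : ∀ j, 2 * d ∣ 2 * j ↔ 2 * d' ∣ 2 * j := by
    intro j
    have e := (h.2 _ (even_two_mul j)).symm.trans (h'.2 _ (even_two_mul j))
    constructor
    · intro hj
      by_contra hj'
      rw [if_pos hj, if_neg hj'] at e
      exact mul_ne_zero hα hc e
    · intro hj
      by_contra hj'
      rw [if_pos hj, if_neg hj'] at e
      exact mul_ne_zero hα' hc e.symm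
  have e1 := (key d').mpr dvd_rfl
  have e2 := (key d).mp dvd_rfl
  rw [Nat.mul_dvd_mul_iff_left two_pos] at e1 e2
  exact Nat.dvd_antisymm e1 e2

end

end Radford

/-! ### Quadratic Gauss sums over ideals of finite rings of odd order -/

namespace GaussSum

variable {k R : Type*} [Field k] [CommRing R] [Fintype R]

theorem natCard_ne_zero (hR : (Fintype.card R : k) ≠ 0) (K : AddSubgroup R) :
    (Nat.card K : k) ≠ 0 := by
  intro h
  apply hR
  obtain ⟨m, hm⟩ := K.card_addSubgroup_dvd_card
  rw [← Nat.card_eq_fintype_card, hm, Nat.cast_mul, h, zero_mul]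

open Classical in
theorem sum_mul_addChar (ψ : AddChar R k) (J : Ideal R) (v : R) :
    ∑ u : J, ψ (v * u) = if ∀ u ∈ J, ψ (v * u) = 1 then (Nat.card J : k) else 0 := by
  let χ : AddChar J k :=
    { toFun := fun u => ψ (v * u)
      map_zero_eq_one' := by simp
      map_add_eq_mul' := fun x y => by simp [mul_add, AddChar.map_add_eq_mul] }
  have h := AddChar.sum_eq_ite χ
  rw [← Nat.card_eq_fintype_card] at h
  refine h.trans (if_congr ?_ rfl rfl)
  rw [AddChar.eq_zero_iff]
  exact ⟨fun h u hu => h ⟨u, hu⟩, fun h u => h u u.2⟩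

open Classical in
-- The product of the sums for `u²` and `-u²` equals `|J|` times the order of the radical `K` of the
-- pairing `ψ(2 v u)` on `J`. Both orders divide powers of nothing but `|R|`, that is, they divide
-- `|R|`, and so are nonzero in `k`.
theorem sum_sq_ne_zero (hR : (Fintype.card R : k) ≠ 0) {t : R} (ht : 2 * t = 1) (ψ : AddChar R k)
    (J : Ideal R) : ∑ u : J, ψ ((u : R) ^ 2) ≠ 0 := by
  set K : AddSubgroup R :=
    { carrier := {v | v ∈ J ∧ ∀ u ∈ J, ψ (2 * v * u) = 1}
      zero_mem' := ⟨J.zero_mem, fun u _ => by simp⟩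
      add_mem' := fun {v w} hv hw => ⟨J.add_mem hv.1 hw.1, fun u hu => by
        rw [mul_add, add_mul, AddChar.map_add_eq_mul, hv.2 u hu, hw.2 u hu, one_mul]⟩
      neg_mem' := fun {v} hv => ⟨J.neg_mem hv.1, fun u hu => by
        rw [mul_neg, neg_mul, ← mul_neg, hv.2 _ (J.neg_mem hu)]⟩ } with hK
  have key : (∑ u : J, ψ ((u : R) ^ 2)) * ∑ u : J, ψ (-(u : R) ^ 2) =
      (Nat.card K : k) * Nat.card J := by
    -- The substitution `v ↦ v + u` turns `v² - u²` into `v² + 2 v u`.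
    have h1 : ∀ u : J, (∑ v : J, ψ ((v : R) ^ 2)) * ψ (-(u : R) ^ 2) =
        ∑ v : J, ψ ((v : R) ^ 2) * ψ (2 * v * u) := by
      intro u
      rw [← Equiv.sum_comp (Equiv.addRight u), Finset.sum_mul]
      refine Finset.sum_congr rfl fun v _ => ?_
      rw [← AddChar.map_add_eq_mul, ← AddChar.map_add_eq_mul]
      congr 1
      simp only [Equiv.coe_addRight, Submodule.coe_add]
      ring
    have h2 : ∀ v : J, ψ ((v : R) ^ 2) * ∑ u : J, ψ (2 * v * u) =
        if (v : R) ∈ K then (Nat.card J : k) else 0 := by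
      intro v
      rw [sum_mul_addChar]
      have hv : (v : R) ∈ K ↔ ∀ u ∈ J, ψ (2 * v * u) = 1 := ⟨fun h => h.2, fun h => ⟨v.2, h⟩⟩
      rw [hv]
      split_ifs with h
      -- For `v` in the radical, taking `u = t v` with `2 t = 1` gives `ψ(v²) = 1`. Here it matters
      -- that `J` is an ideal.
      · have h3 := h (t * v) (J.mul_mem_left t v.2)
        rw [show 2 * (v : R) * (t * v) = (2 * t) * (v : R) ^ 2 by ring, ht, one_mul] at h3
        rw [h3, one_mul]
      · rw [mul_zero]
    rw [Finset.mul_sum, Finset.sum_congr rfl fun u _ => h1 u, Finset.sum_comm]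
    simp only [← Finset.mul_sum, h2]
    rw [← Finset.sum_filter, Finset.sum_const, nsmul_eq_mul]
    congr 2
    rw [← Fintype.card_subtype, ← Nat.card_eq_fintype_card]
    exact Nat.card_congr
      ⟨fun v => ⟨v.1, v.2⟩, fun v => ⟨⟨v.1, v.2.1⟩, v.2⟩, fun _ => rfl, fun _ => rfl⟩
  intro h
  rw [h, zero_mul] at key
  exact mul_ne_zero (natCard_ne_zero hR K) (natCard_ne_zero hR J.toAddSubgroup) key.symm

end GaussSum

/-! ### Fourier coefficients modulo `n`, and the values on the twist -/

namespace Radford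

open RootCalculus RibbonHopf

variable {k : Type u} [Field k] {n : ℕ} {ω : k} {s : ℕ} {β : k}

instance neZero_of_odd [hn : Fact (Odd n)] : NeZero n := ⟨hn.out.pos.ne'⟩

/-- The sum of the values of `f` at the idempotents `e_l` with `l` in a given class modulo `n`. -/
noncomputable def fiber (ω : k) (f : Module.Dual k (Radford k n)) (r : ZMod n) : k :=
  ∑ l : Fin (2 * n), if ((l : ℕ) : ZMod n) = r then f (eig (2 * n) ω l (a k n)) else 0

section
variable (hN : ((2 * n : ℕ) : k) ≠ 0) (hω : IsPrimitiveRoot ω (2 * n)) [hn : Fact (Odd n)]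

omit hn in
include hN in
theorem natCast_ne_zero' : (n : k) ≠ 0 := by
  intro h
  apply hN
  rw [Nat.cast_mul, h, mul_zero]

include hN hω in
-- Both `(-1)^n` and `ω^(n s)` equal `-1`. The extra sign in `-ω^s` is what makes a character of
-- `ℤ/n` out of a root of unity of order dividing `2n`.
theorem neg_pow_pow (hs : Odd s) : (-ω ^ s) ^ n = 1 := by
  rw [neg_pow, hn.out.neg_one_pow, ← pow_mul, mul_comm s, pow_mul, pow_half_eq_neg_one hN hω,
    hs.neg_one_pow]
  simp

/-- The character of `ℤ/n` with `1 ↦ -ω ^ s`. -/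
noncomputable def signChar (hs : Odd s) : AddChar (ZMod n) k :=
  AddChar.zmodChar n (neg_pow_pow hN hω hs)

theorem signChar_natCast (hs : Odd s) (l : ℕ) :
    signChar hN hω hs (l : ZMod n) = (-ω ^ s) ^ l :=
  AddChar.zmodChar_apply' _ _

omit hn in
include hω in
theorem pow_two_pow : (ω ^ 2) ^ n = 1 := by
  rw [← pow_mul, hω.pow_eq_one]

/-- The factor `a^n` contributes `(-1)^l = (-1)^(l²)`, which joins `ω^(s l²)` to form `(-ω^s)^(l²)`.
Hence the twist only sees `l` modulo `n`. -/
theorem character_twist_eq (hs : Odd s) (l : ℕ) :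
    character (n := n) (ω ^ l) (pow_pow_eq_one hω l) (twist n ω s) =
      signChar hN hω hs ((l : ZMod n) ^ 2) := by
  rw [character_twist hN hω, ← Nat.cast_pow, signChar_natCast, neg_pow, ← pow_mul, mul_comm l n,
    pow_mul, pow_half_eq_neg_one hN hω]
  congr 1
  rcases Nat.even_or_odd l with h | h
  · rw [h.neg_one_pow, (h.pow_of_ne_zero two_ne_zero).neg_one_pow]
  · rw [h.neg_one_pow, (h.pow).neg_one_pow]

theorem character_inv_twist_eq (hs : Odd s) (l : ℕ) :
    character (n := n) (ω ^ l) (pow_pow_eq_one hω l) (Ring.inverse (twist n ω s)) =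
      signChar hN hω hs (-(l : ZMod n) ^ 2) := by
  have h1 := congrArg (character (n := n) (ω ^ l) (pow_pow_eq_one hω l))
    (Ring.mul_inverse_cancel _ (isUnit_twist hN hω s))
  rw [map_mul, map_one, character_twist_eq hN hω hs] at h1
  rw [AddChar.map_neg_eq_inv]
  exact eq_inv_of_mul_eq_one_right h1

include hN hω in
theorem reduced_apply {f : Module.Dual k (Radford k n)} (hf : f ∈ reduced k n) (y : Radford k n) :
    f y = ∑ l : Fin (2 * n), f (eig (2 * n) ω l (a k n)) *
      character (ω ^ (l : ℕ)) (pow_pow_eq_one hω l) y := by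
  conv_lhs => rw [reduced_eq_sum hN hω hf]
  rw [Finset.sum_range, LinearMap.sum_apply]
  rfl

theorem sum_mul_eq_sum_fiber (f : Module.Dual k (Radford k n)) (Φ : ZMod n → k) :
    ∑ l : Fin (2 * n), f (eig (2 * n) ω l (a k n)) * Φ ((l : ℕ) : ZMod n) =
      ∑ r, fiber ω f r * Φ r := by
  simp only [fiber, Finset.sum_mul, ite_mul, zero_mul]
  rw [Finset.sum_comm]
  refine Finset.sum_congr rfl fun l _ => ?_
  rw [Finset.sum_ite_eq, if_pos (Finset.mem_univ _)]

theorem apply_twist (hs : Odd s) {f : Module.Dual k (Radford k n)} (hf : f ∈ reduced k n) :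
    f (twist n ω s) = ∑ r, fiber ω f r * signChar hN hω hs (r ^ 2) := by
  rw [reduced_apply hN hω hf, ← sum_mul_eq_sum_fiber]
  simp only [character_twist_eq hN hω hs]

theorem apply_inv_twist (hs : Odd s) {f : Module.Dual k (Radford k n)} (hf : f ∈ reduced k n) :
    f (Ring.inverse (twist n ω s)) = ∑ r, fiber ω f r * signChar hN hω hs (-r ^ 2) := by
  rw [reduced_apply hN hω hf, ← sum_mul_eq_sum_fiber (Φ := fun r => signChar hN hω hs (-r ^ 2))]
  simp only [character_inv_twist_eq hN hω hs]

include hN hω in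
-- On `e_l` the element `a^(2j)` acts as `ω^(2 l j)`, which depends on `l` modulo `n` only. So the
-- values at even powers are the Fourier transform of `fiber`, and this is the inversion formula.
theorem card_mul_fiber {f : Module.Dual k (Radford k n)} (hf : f ∈ reduced k n) (r : ZMod n) :
    (n : k) * fiber ω f r = ∑ j : ZMod n,
      AddChar.zmodChar n (pow_two_pow hω) (-(r * j)) * f (a k n ^ (2 * j.val)) := by
  set φ := AddChar.zmodChar n (pow_two_pow hω) with hφ
  have hprim : φ.IsPrimitive := AddChar.zmodChar_primitive_of_primitive_root n
    (hω.pow (by have := hn.out.pos; omega) rfl)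
  have h1 : ∀ j : ZMod n, f (a k n ^ (2 * j.val)) = ∑ q, fiber ω f q * φ (q * j) := by
    intro j
    rw [reduced_apply hN hω hf, ← sum_mul_eq_sum_fiber (Φ := fun q => φ (q * j))]
    refine Finset.sum_congr rfl fun l _ => ?_
    rw [map_pow, character_a, ← pow_mul]
    congr 1
    conv_rhs => rw [← ZMod.natCast_zmod_val j, ← Nat.cast_mul, hφ, AddChar.zmodChar_apply']
    rw [← pow_mul]
    congr 1
    ring
  simp only [h1, Finset.mul_sum]
  rw [Finset.sum_comm]
  have h2 : ∀ q, ∑ j : ZMod n, φ (-(r * j)) * (fiber ω f q * φ (q * j)) =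
      if q = r then fiber ω f q * n else 0 := by
    intro q
    have h3 : ∀ j, φ (-(r * j)) * (fiber ω f q * φ (q * j)) = fiber ω f q * φ (j * (q - r)) := by
      intro j
      rw [mul_left_comm, ← AddChar.map_add_eq_mul]
      congr 2
      ring
    simp only [h3, ← Finset.mul_sum]
    rw [AddChar.sum_mulShift (q - r) hprim]
    by_cases hqr : q = r
    · rw [if_pos (sub_eq_zero.mpr hqr), if_pos hqr, ZMod.card]
    · rw [if_neg (sub_ne_zero.mpr hqr), if_neg hqr, Nat.cast_zero, mul_zero]
  simp only [h2, Finset.sum_ite_eq', Finset.mem_univ, if_true]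
  rw [mul_comm]

/-- The annihilator, with respect to the character `1 ↦ ω ^ 2`, of the ideal generated by `d`. -/
def annihilator (d : ℕ) : Ideal (ZMod n) where
  carrier := {r | ∀ j ∈ Ideal.span {(d : ZMod n)},
    AddChar.zmodChar n (pow_two_pow hω) (r * j) = 1}
  zero_mem' j _ := by simp
  add_mem' h h' j hj := by rw [add_mul, AddChar.map_add_eq_mul, h j hj, h' j hj, one_mul]
  smul_mem' c r h j hj := by
    rw [smul_eq_mul, mul_right_comm, mul_comm, mul_comm c]
    exact h _ (Ideal.mul_mem_right _ _ hj)

include hN in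
open Classical in
-- The Fourier transform of the indicator of an ideal is supported on its annihilator and constant
-- there.
theorem fiber_eq {f : Module.Dual k (Radford k n)} (hf : f ∈ reduced k n) {d : ℕ} (hd : d ∣ n)
    {C : k} (h : ∀ i, Even i → f (a k n ^ i) = if 2 * d ∣ i then C else 0) (r : ZMod n) :
    fiber ω f r = if r ∈ annihilator hω d then
      C * Nat.card (Ideal.span {(d : ZMod n)}) / n else 0 := by
  have hn0 := natCast_ne_zero' hN
  rw [← mul_right_inj' hn0, card_mul_fiber hN hω hf]
  -- Since `d ∣ n`, divisibility of the representative `j.val` by `d` is the same as membership of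
  -- `j` in the ideal generated by `d`.
  have h1 : ∀ j : ZMod n, f (a k n ^ (2 * j.val)) =
      if j ∈ Ideal.span {(d : ZMod n)} then C else 0 := by
    intro j
    rw [h _ (even_two_mul _)]
    refine if_congr ?_ rfl rfl
    rw [Nat.mul_dvd_mul_iff_left two_pos, Ideal.mem_span_singleton]
    constructor
    · rintro ⟨q, hq⟩
      refine ⟨(q : ZMod n), ?_⟩
      rw [← Nat.cast_mul, ← hq, ZMod.natCast_zmod_val]
    · rintro ⟨q, hq⟩
      rw [← ZMod.natCast_zmod_val j, ← ZMod.natCast_zmod_val q, ← Nat.cast_mul,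
        ZMod.natCast_eq_natCast_iff] at hq
      have := (hq.of_dvd hd).trans (Nat.modEq_zero_iff_dvd.mpr (Dvd.intro _ rfl))
      exact Nat.modEq_zero_iff_dvd.mp this
  simp only [h1, mul_ite, mul_zero]
  rw [← Finset.sum_filter, ← Finset.sum_mul]
  have h2 := GaussSum.sum_mul_addChar (AddChar.zmodChar n (pow_two_pow hω))
    (Ideal.span {(d : ZMod n)}) (-r)
  rw [Finset.sum_subtype _ (p := fun j => j ∈ Ideal.span {(d : ZMod n)}) (by simp)]
  simp only [← neg_mul]
  rw [h2]
  have h3 : r ∈ annihilator hω d ↔ -r ∈ annihilator hω d := (neg_mem_iff).symm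
  rw [h3]
  have h4 : -r ∈ annihilator hω d ↔ ∀ u ∈ Ideal.span {(d : ZMod n)},
    AddChar.zmodChar n (pow_two_pow hω) (-r * u) = 1 := Iff.rfl
  by_cases hr : -r ∈ annihilator hω d
  · rw [if_pos hr, if_pos (h4.mp hr)]
    field_simp
  · rw [if_neg hr, if_neg (mt h4.mpr hr), zero_mul]

include hn in
theorem exists_half : ∃ t : ZMod n, 2 * t = 1 := by
  obtain ⟨m, hm⟩ := hn.out
  refine ⟨-(m : ZMod n), ?_⟩
  have : ((2 * m + 1 : ℕ) : ZMod n) = 0 := by rw [← hm]; simp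
  push_cast at this
  linear_combination -this

include hN hω in
-- The sum is a nonzero constant times a quadratic Gauss sum over the annihilator. An arbitrary `ψ`
-- is allowed so that the inverse twist, which leads to the inverse character, is covered as well.
theorem sum_fiber_ne_zero {f : Module.Dual k (Radford k n)} (hf : f ∈ reduced k n) {d : ℕ}
    (hd : d ∣ n) {C : k} (hC : C ≠ 0)
    (h : ∀ i, Even i → f (a k n ^ i) = if 2 * d ∣ i then C else 0) (ψ : AddChar (ZMod n) k) :
    ∑ r, fiber ω f r * ψ (r ^ 2) ≠ 0 := by
  classical
  obtain ⟨t, ht⟩ := exists_half (n := n)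
  have hR : (Fintype.card (ZMod n) : k) ≠ 0 := by rw [ZMod.card]; exact natCast_ne_zero' hN
  have h1 := GaussSum.sum_sq_ne_zero hR ht ψ (annihilator hω d)
  have h2 := GaussSum.natCard_ne_zero hR (Ideal.span {(d : ZMod n)}).toAddSubgroup
  simp only [fiber_eq hN hω hf hd h, ite_mul, zero_mul]
  rw [← Finset.sum_filter, ← Finset.mul_sum,
    Finset.sum_subtype _ (p := fun r => r ∈ annihilator hω d) (by simp)]
  exact mul_ne_zero (div_ne_zero (mul_ne_zero hC h2) (natCast_ne_zero' hN)) h1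

theorem thetaA_apply {H : Type u} [Ring H] [HopfAlgebra k H] [FiniteDimensional k H]
    (t : H) (f : Module.Dual k H) : thetaA t f = f t := by
  simp [thetaA, atOne, regularRep]

theorem thetaA_comp_phi_ne_zero_iff {H : Type u} [Ring H] [HopfAlgebra k H] [FiniteDimensional k H]
    (t z : H) (lam : Module.Dual k H) : thetaA t ∘ₗ phi lam z ≠ 0 ↔ phi lam z 1 t ≠ 0 := by
  rw [not_iff_not, LinearMap.ext_ring_iff, LinearMap.comp_apply, thetaA_apply,
    LinearMap.zero_apply]

include hN hω in
theorem mem_kirbySetNorm_iff (hs : Odd s) {lam : Module.Dual k (Radford k n)}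
    (hlam : IsDualRightIntegral lam) (h0 : lam ≠ 0) {ν : Radford k n →ₐ[k] k}
    (hν : IsDistinguished ν) (z : Radford k n) :
    z ∈ kirbySetNorm (rMatrix n ω s β) (twist n ω s) lam ↔
      ∃ d ∈ n.divisors, ∃ α : k, α ≠ 0 ∧ ∃ w ∈ setN lam ν, z = α • zElem k n d + w := by
  have hc := dualRightIntegral_apply_ne_zero hN hω hlam h0
  have h1 : z ∈ kirbySetNorm (rMatrix n ω s β) (twist n ω s) lam ↔
      z ∈ kirbySet (rMatrix n ω s β) (twist n ω s) lam ∧ phi lam z 1 (twist n ω s) ≠ 0 ∧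
        phi lam z 1 (Ring.inverse (twist n ω s)) ≠ 0 := by
    rw [← thetaA_comp_phi_ne_zero_iff, ← thetaA_comp_phi_ne_zero_iff]
    rfl
  rw [h1, mem_kirbySet_iff hN hω hs hlam h0 hν]
  constructor
  · rintro ⟨⟨d, hd, α, hw⟩, h2, -⟩
    refine ⟨d, hd, α, ?_, hw⟩
    rintro rfl
    rw [exists_smul_zElem_iff hN hω hlam h0 hν hd] at hw
    apply h2
    rw [apply_twist hN hω hs hw.1]
    refine Finset.sum_eq_zero fun r _ => ?_
    rw [fiber_eq hN hω hw.1 (Nat.dvd_of_mem_divisors hd) hw.2]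
    simp
  · rintro ⟨d, hd, α, hα, hw⟩
    refine ⟨⟨d, hd, α, hw⟩, ?_⟩
    rw [exists_smul_zElem_iff hN hω hlam h0 hν hd] at hw
    rw [apply_twist hN hω hs hw.1, apply_inv_twist hN hω hs hw.1]
    have hdn := Nat.dvd_of_mem_divisors hd
    refine ⟨sum_fiber_ne_zero hN hω hw.1 hdn (mul_ne_zero hα hc) hw.2 _, ?_⟩
    have := sum_fiber_ne_zero hN hω hw.1 hdn (mul_ne_zero hα hc) hw.2 (signChar hN hω hs)⁻¹
    simpa only [AddChar.inv_apply] using this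

end

end Radford

/-! ### Signs of permutations and of coloured braids -/

namespace Equiv.Perm

variable {α : Type*} [Fintype α] [LinearOrder α]

open Classical in
-- Every nontrivial cycle has one least element and fixed points are least in their cycles, so the
-- number of factors `-1` is the size of the support minus the number of nontrivial cycles.
theorem sign_eq_prod_sameCycle (π : Perm α) :
    sign π = ∏ q, if ∀ q', π.SameCycle q q' → q ≤ q' then (1 : ℤˣ) else -1 := by
  set B : Finset α := Finset.univ.filter fun q => ∀ q', π.SameCycle q q' → q ≤ q' with hB
  have hmem : ∀ q, q ∈ B ↔ ∀ q', π.SameCycle q q' → q ≤ q' := fun q => by simp [hB]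
  have hcard : (π.support ∩ B).card = π.cycleFactorsFinset.card := by
    refine Finset.card_bij (fun p _ => π.cycleOf p) ?_ ?_ ?_
    · intro p hp
      rw [cycleOf_mem_cycleFactorsFinset_iff]
      exact (Finset.mem_inter.mp hp).1
    · intro p hp q hq h
      have hp' := (hmem p).mp (Finset.mem_inter.mp hp).2
      have hq' := (hmem q).mp (Finset.mem_inter.mp hq).2
      have hpq : π.SameCycle p q := by
        rw [← mem_support_cycleOf_iff' (mem_support.mp (Finset.mem_inter.mp hp).1), h,
          mem_support_cycleOf_iff' (mem_support.mp (Finset.mem_inter.mp hq).1)]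
      exact le_antisymm (hp' q hpq) (hq' p hpq.symm)
    · intro c hc
      have hne : c.support.Nonempty := by
        rw [Finset.nonempty_iff_ne_empty, Ne, support_eq_empty_iff]
        exact (mem_cycleFactorsFinset_iff.mp hc).1.ne_one
      have hmin := Finset.min'_mem _ hne
      set p := c.support.min' hne with hp
      have hcp : π.cycleOf p = c := (cycle_is_cycleOf hmin hc).symm
      have hps : p ∈ π.support := mem_cycleFactorsFinset_support_le hc hmin
      refine ⟨p, Finset.mem_inter.mpr ⟨hps, (hmem p).mpr fun q hq => ?_⟩, hcp⟩
      refine Finset.min'_le _ _ ?_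
      rw [← hcp, mem_support_cycleOf_iff' (mem_support.mp hps)]
      exact hq
  have hsupp : (Finset.univ.filter fun q => ¬ ∀ q', π.SameCycle q q' → q ≤ q') = π.support \ B := by
    ext q
    simp only [Finset.mem_filter, Finset.mem_univ, true_and, Finset.mem_sdiff, hmem]
    refine ⟨fun h => ⟨?_, h⟩, fun h => h.2⟩
    by_contra hq
    apply h
    intro q' hq'
    rw [notMem_support] at hq
    exact (hq'.eq_of_left hq).le
  rw [Finset.prod_ite, Finset.prod_const_one, one_mul, Finset.prod_const, hsupp,
    sign_of_cycleType, sum_cycleType, cycleType_def, Multiset.card_map, Finset.card_val,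
    ← hcard, ← Finset.card_sdiff_add_card_inter π.support B, add_assoc, pow_add, ← two_mul,
    pow_mul]
  simp

end Equiv.Perm

namespace BraidWord

open Equiv

theorem perm_lt_iff {m : ℕ} {w : BraidWord} (hw : ∀ l ∈ w, BraidLetter.Fits m l) (x : ℕ) :
    perm w x < m ↔ x < m := by
  induction w generalizing x with
  | nil => rfl
  | cons l w ih =>
    rw [perm, Perm.mul_apply, ih fun l' hl' => hw l' (List.mem_cons_of_mem _ hl')]
    have hl := hw l List.mem_cons_self
    cases l with
    | crossing i s =>
      simp only [BraidLetter.Fits] at hl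
      simp only [BraidLetter.perm, swap_apply_def]
      split_ifs <;> omega
    | twist i s => rfl

/-- The sign `(-1) ^ r`, where `r` is the number of crossings at which both colours are odd. -/
def oddSign : BraidWord → (ℕ → ℕ) → ℤˣ
  | [], _ => 1
  | .crossing i _ :: w, b => (-1) ^ (b i * b (i + 1)) * oddSign w (b ∘ swap i (i + 1))
  | .twist _ _ :: w, b => oddSign w b

/-- The pair `(τ, ι)` records the order of the odd strands at the current height: `ι` relabels their
positions monotonically and `τ` sends labels to bottom positions. Only a crossing of two odd strands
changes `τ`, by a transposition, so its sign counts such crossings. -/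
theorem exists_perm_sign_eq_oddSign {m : ℕ} {b : ℕ → ℕ} {P : ℕ → Prop} [DecidablePred P]
    [Fintype (Subtype P)] (hP : ∀ x, P x ↔ x < m ∧ Odd (b x)) (w : BraidWord)
    (hw : ∀ l ∈ w, BraidLetter.Fits m l) (e : Perm ℕ) (he : ∀ x, e x < m ↔ x < m)
    (τ : Perm (Subtype P)) (ι : ℕ → ℕ) (h1 : ∀ p, P (e p) → Perm.ofSubtype τ (ι p) = e p)
    (h2 : StrictMonoOn ι {p | P (e p)}) :
    ∃ (τ' : Perm (Subtype P)) (ι' : ℕ → ℕ),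
      (∀ p, P ((e * (perm w)⁻¹) p) → Perm.ofSubtype τ' (ι' p) = (e * (perm w)⁻¹) p) ∧
      StrictMonoOn ι' {p | P ((e * (perm w)⁻¹) p)} ∧
      Perm.sign τ' = Perm.sign τ * oddSign w (b ∘ e) := by
  induction w generalizing e τ ι with
  | nil => exact ⟨τ, ι, h1, h2, by simp [oddSign]⟩
  | cons l w ih =>
    have hw' : ∀ l ∈ w, BraidLetter.Fits m l := fun l' hl' => hw l' (List.mem_cons_of_mem _ hl')
    have hl := hw l List.mem_cons_self
    cases l with
    | twist i s =>
      obtain ⟨τ', ι', h⟩ := ih hw' e he τ ι h1 h2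
      exact ⟨τ', ι', by simpa [perm, BraidLetter.perm, oddSign] using h⟩
    | crossing i s =>
      simp only [BraidLetter.Fits] at hl
      have hperm : e * (perm (.crossing i s :: w))⁻¹ = e * swap i (i + 1) * (perm w)⁻¹ := by
        rw [perm, mul_inv_rev, ← mul_assoc]
        rfl
      have hE : ∀ x, (e * swap i (i + 1)) x < m ↔ x < m := fun x => by
        rw [Perm.mul_apply, he, swap_apply_def]
        split_ifs <;> omega
      have hcol : b ∘ ⇑(e * swap i (i + 1)) = (b ∘ e) ∘ swap i (i + 1) := rfl
      rw [hperm, oddSign]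
      by_cases hodd : P (e i) ∧ P (e (i + 1))
      · obtain ⟨hA, hB⟩ := hodd
        have hne : e i ≠ e (i + 1) := fun h => absurd (e.injective h) (by omega)
        have hiff : ∀ p, P ((e * swap i (i + 1)) p) ↔ P (e p) := by
          intro p
          rw [Perm.mul_apply, swap_apply_def]
          split_ifs with hp hp'
          · subst hp
            exact iff_of_true hB hA
          · subst hp'
            exact iff_of_true hA hB
          · rfl
        -- Both strands are odd: the positions they occupy are unchanged and `τ` acquires a
        -- transposition.
        obtain ⟨τ', ι', g1, g2, g3⟩ := ih hw' (e * swap i (i + 1)) hE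
          (swap ⟨e i, hA⟩ ⟨e (i + 1), hB⟩ * τ) ι
          (fun p hp => by
            rw [map_mul, Perm.mul_apply, h1 p ((hiff p).mp hp), Perm.ofSubtype_swap_eq,
              mul_swap_eq_swap_mul, Perm.mul_apply])
          (by simpa only [hiff] using h2)
        refine ⟨τ', ι', g1, g2, ?_⟩
        have ho : Odd ((b ∘ e) i * (b ∘ e) (i + 1)) := ((hP _).mp hA).2.mul ((hP _).mp hB).2
        rw [g3, hcol, map_mul, Perm.sign_swap (by simpa using hne), ho.neg_one_pow]
        simp only [neg_mul, one_mul, mul_neg]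
      -- At most one strand is odd: the order of the odd strands is unchanged, and the relabelling
      -- is composed with the swap.
      · obtain ⟨τ', ι', g1, g2, g3⟩ := ih hw' (e * swap i (i + 1)) hE τ (ι ∘ swap i (i + 1))
          (fun p hp => h1 _ hp)
          (fun p hp q hq hpq => by
            refine h2 hp hq ?_
            simp only [Set.mem_ofPred_eq, Perm.mul_apply, swap_apply_def] at hp hq ⊢
            split_ifs at hp hq ⊢ with a1 a2 a3 a4 a5 a6 a7 <;> first | omega | skip
            exact absurd ⟨hq, hp⟩ hodd)
        refine ⟨τ', ι', g1, g2, ?_⟩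
        have ho : Even ((b ∘ e) i * (b ∘ e) (i + 1)) := by
          rw [hP, hP, he, he, ← and_and_and_comm] at hodd
          have := fun h => hodd ⟨⟨by omega, by omega⟩, h⟩
          rw [← Nat.not_odd_iff_even, Nat.odd_mul]
          exact this
        rw [g3, hcol, ho.neg_one_pow, one_mul]

open Classical in
-- At the top the colours are again those of the bottom, so the recorded permutation is the inverse
-- of the braid permutation restricted to the odd strands; its sign is counted by the strands that
-- are not least on their component.
theorem oddSign_eq {m : ℕ} {w : BraidWord} (hw : ∀ l ∈ w, BraidLetter.Fits m l) {b : ℕ → ℕ}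
    (hb : ∀ p, b (perm w p) = b p) :
    oddSign w b = ∏ q : Fin m, if w.IsBase q then 1 else (-1) ^ b q := by
  set P : ℕ → Prop := fun x => x < m ∧ Odd (b x) with hP
  have : Finite (Subtype P) := Set.Finite.subset (Set.finite_lt_nat m) fun x hx => hx.1
  have : Fintype (Subtype P) := Fintype.ofFinite _
  have hPσ : ∀ x, P (perm w x) ↔ P x := fun x => by rw [hP]; simp only [perm_lt_iff hw, hb]
  have hPσ' : ∀ x, P ((perm w)⁻¹ x) ↔ P x := fun x => by
    rw [← hPσ, ← Perm.mul_apply, mul_inv_cancel, Perm.one_apply]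
  obtain ⟨τ, ι, h1, h2, h3⟩ := exists_perm_sign_eq_oddSign (m := m) (b := b) (P := P)
    (fun _ => Iff.rfl) w hw 1 (fun _ => Iff.rfl) 1 id (fun p _ => by simp) (fun p _ q _ h => h)
  simp only [one_mul, map_one, hPσ'] at h1 h2 h3
  have hι : ∀ p, P p → P (ι p) := fun p hp => by
    have h4 : P (Perm.ofSubtype τ (ι p)) := by rw [h1 p hp]; exact (hPσ' p).mpr hp
    by_contra h5
    rw [Perm.ofSubtype_apply_of_not_mem τ h5] at h4
    exact h5 h4
  -- A strictly monotone self-map of a finite linear order is the identity.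
  have hid : ∀ p, P p → ι p = p := by
    set j : Subtype P → Subtype P := fun p => ⟨ι p, hι p p.2⟩ with hj
    have hmono : StrictMono j := fun p q hpq => h2 p.2 q.2 hpq
    intro p hp
    have h4 : j ⟨p, hp⟩ = ⟨p, hp⟩ := le_antisymm hmono.apply_le hmono.le_apply
    exact congrArg Subtype.val h4
  have hτ : τ⁻¹ = (perm w).subtypePerm hPσ := by
    rw [inv_eq_iff_eq_inv]
    ext p
    have h4 := h1 p p.2
    rw [hid p p.2, Perm.ofSubtype_apply_of_mem τ p.2] at h4
    exact h4
  have h5 : oddSign w b = Perm.sign ((perm w).subtypePerm hPσ) := by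
    rw [← hτ, Perm.sign_inv, h3]
    rfl
  have h7 : Perm.sign ((perm w).subtypePerm hPσ) = ∏ q : Subtype P,
      if ∀ q', ((perm w).subtypePerm hPσ).SameCycle q q' → q ≤ q' then (1 : ℤˣ) else -1 := by
    convert Perm.sign_eq_prod_sameCycle ((perm w).subtypePerm hPσ)
  rw [h5, h7]
  have hbase : ∀ q : Subtype P, (∀ q', ((perm w).subtypePerm hPσ).SameCycle q q' → q ≤ q') ↔
      w.IsBase q := by
    intro q
    constructor
    · intro h q' hq'
      have hq2 : P q' := by
        obtain ⟨i, hi⟩ := hq'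
        rw [← hi]
        have : ((perm w).subtypePerm hPσ ^ i) q = (perm w ^ i) q := by simp
        rw [← this]
        exact Subtype.prop _
      exact h ⟨q', hq2⟩ (by rw [Perm.sameCycle_subtypePerm]; exact hq')
    · intro h q' hq'
      rw [Perm.sameCycle_subtypePerm] at hq'
      exact h q' hq'
  simp only [hbase]
  rw [Fin.prod_univ_eq_prod_range (fun q => if w.IsBase q then (1 : ℤˣ) else (-1) ^ b q) m]
  have h6 : ∏ q ∈ Finset.range m, (if w.IsBase q then (1 : ℤˣ) else (-1) ^ b q) =
      ∏ q ∈ (Finset.range m).filter P, if w.IsBase q then (1 : ℤˣ) else -1 := by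
    rw [Finset.prod_filter]
    refine Finset.prod_congr rfl fun q hq => ?_
    rcases Nat.even_or_odd (b q) with ho | ho
    · have : ¬ P q := fun h => (Nat.not_odd_iff_even.mpr ho) h.2
      rw [if_neg this, ho.neg_one_pow, ite_self]
    · have h8 : P q := ⟨Finset.mem_range.mp hq, ho⟩
      rw [if_pos h8, ho.neg_one_pow]
  rw [h6, Finset.prod_subtype _ (p := P) (fun x => by simp [hP])]

end BraidWord

/-! ### Traces of operators on tensor powers -/

namespace RibbonHopf

variable {k H : Type u} [Field k] [Ring H] [HopfAlgebra k H] {m : ℕ}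

/-- The product of characters of the factors of a tensor power. -/
noncomputable def charTensor (χ : Fin m → H →ₐ[k] k) : (⨂[k] _ : Fin m, H) →ₐ[k] k :=
  PiTensorProduct.liftAlgHom
    ((MultilinearMap.mkPiAlgebra k (Fin m) k).compLinearMap fun i => (χ i).toLinearMap)
    (by simp) (fun x y => by simp [Finset.prod_mul_distrib])

theorem charTensor_tprod (χ : Fin m → H →ₐ[k] k) (y : Fin m → H) :
    charTensor χ (PiTensorProduct.tprod k y) = ∏ i, χ i (y i) := by
  have : charTensor χ (PiTensorProduct.tprod k y) = PiTensorProduct.lift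
    ((MultilinearMap.mkPiAlgebra k (Fin m) k).compLinearMap fun i => (χ i).toLinearMap)
    (PiTensorProduct.tprod k y) := rfl
  rw [this, PiTensorProduct.lift.tprod]
  simp

theorem singleAlgHom_apply (q : Fin m) (h : H) :
    PiTensorProduct.singleAlgHom (R := k) (A := fun _ : Fin m => H) q h =
      PiTensorProduct.tprod k (Pi.mulSingle q h) := rfl

theorem charTensor_single (χ : Fin m → H →ₐ[k] k) (q : Fin m) (h : H) :
    charTensor χ (PiTensorProduct.singleAlgHom (R := k) (A := fun _ : Fin m => H) q h) = χ q h := by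
  rw [singleAlgHom_apply, charTensor_tprod, Finset.prod_eq_single q]
  · simp
  · intro i _ hi
    rw [Pi.mulSingle_eq_of_ne hi, map_one]
  · simp

/-- The character `u ⊗ v ↦ χ(u) χ'(v)`. -/
def pairChar (χ χ' : H →ₐ[k] k) : H ⊗[k] H →ₐ[k] k :=
  (Algebra.TensorProduct.lmul' k).comp (Algebra.TensorProduct.map χ χ')

theorem pairChar_eq (χ χ' : H →ₐ[k] k) (R : H ⊗[k] H) : pairChar χ χ' R =
    TensorProduct.lid k k (TensorProduct.map χ.toLinearMap χ'.toLinearMap R) := by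
  induction R with
  | zero => simp
  | add t t' h h' => rw [map_add, map_add, map_add, h, h']
  | tmul u v => simp [pairChar]

theorem charTensor_place (χ : Fin m → H →ₐ[k] k) (i j : Fin m) (R : H ⊗[k] H) :
    charTensor χ (place i j R) = pairChar (χ i) (χ j) R := by
  induction R with
  | zero => simp [place]
  | add t t' h h' =>
    rw [map_add, ← h, ← h', ← map_add]
    simp [place]
  | tmul u v =>
    have : place (k := k) i j (u ⊗ₜ v) =
      PiTensorProduct.singleAlgHom (R := k) (A := fun _ : Fin m => H) i u *
        PiTensorProduct.singleAlgHom (R := k) (A := fun _ : Fin m => H) j v := rfl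
    rw [this, map_mul, charTensor_single, charTensor_single]
    simp [pairChar]

theorem permuteFactors_tprod (e : Equiv.Perm (Fin m)) (y : Fin m → H) :
    permuteFactors (k := k) e (PiTensorProduct.tprod k y) = PiTensorProduct.tprod k fun i => y (e.symm i) :=
  PiTensorProduct.reindex_tprod _ _

theorem charTensor_permuteFactors (χ : Fin m → H →ₐ[k] k) (e : Equiv.Perm (Fin m))
    (v : ⨂[k] _ : Fin m, H) :
    charTensor χ (permuteFactors e v) = charTensor (fun i => χ (e i)) v := by
  induction v using PiTensorProduct.induction_on with
  | smul_tprod r y =>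
    rw [map_smul, map_smul, map_smul, permuteFactors_tprod, charTensor_tprod, charTensor_tprod,
      ← Equiv.prod_comp e]
    refine congrArg _ (Finset.prod_congr rfl fun i _ => ?_)
    rw [Equiv.symm_apply_apply]
  | add u v hu hv => rw [map_add, map_add, map_add, hu, hv]

theorem permuteFactors_mul (e : Equiv.Perm (Fin m)) (v w : ⨂[k] _ : Fin m, H) :
    permuteFactors e (v * w) = permuteFactors e v * permuteFactors e w := by
  induction v using PiTensorProduct.induction_on with
  | smul_tprod r y =>
    induction w using PiTensorProduct.induction_on with
    | smul_tprod r' y' =>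
      simp only [smul_mul_assoc, mul_smul_comm, map_smul, PiTensorProduct.tprod_mul_tprod (R := k) (A := fun _ : Fin m => H), permuteFactors_tprod]
      rfl
    | add u v hu hv => rw [mul_add, map_add, map_add, mul_add, hu, hv]
  | add u v hu hv => rw [add_mul, map_add, map_add, add_mul, hu, hv]

theorem permuteFactors_single (e : Equiv.Perm (Fin m)) (q : Fin m) (h : H) :
    permuteFactors (k := k) e (PiTensorProduct.singleAlgHom (R := k) (A := fun _ : Fin m => H) q h) =
      PiTensorProduct.singleAlgHom (R := k) (A := fun _ : Fin m => H) (e q) h := by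
  rw [singleAlgHom_apply, singleAlgHom_apply, permuteFactors_tprod]
  congr 1
  ext i
  rw [Pi.mulSingle_apply, Pi.mulSingle_apply]
  exact if_congr (Equiv.symm_apply_eq e) rfl rfl

theorem swap_val {i j : ℕ} (hi : i < m) (hj : j < m) (q : Fin m) :
    ((Equiv.swap (⟨i, hi⟩ : Fin m) ⟨j, hj⟩ q : Fin m) : ℕ) = Equiv.swap i j q := by
  rw [Equiv.swap_apply_def, Equiv.swap_apply_def]
  simp only [Fin.ext_iff]
  split_ifs <;> rfl

/-- Letters act by left multiplications and permutations of factors, so a right multiplication is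
merely carried along its strand. -/
theorem letterOp_mul_single (R : H ⊗[k] H) (θ : H) {l : BraidLetter} (hl : l.Fits m)
    (v : ⨂[k] _ : Fin m, H) {q q' : Fin m} (hq : l.perm q = q') (h : H) :
    letterOp R θ m l (v * PiTensorProduct.singleAlgHom (R := k) (A := fun _ : Fin m => H) q h) =
      letterOp R θ m l v *
        PiTensorProduct.singleAlgHom (R := k) (A := fun _ : Fin m => H) q' h := by
  cases l with
  | crossing i s =>
    have hl' : i + 1 < m := hl
    have hswap : Equiv.swap (⟨i, by omega⟩ : Fin m) ⟨i + 1, hl'⟩ q = q' := by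
      ext
      rw [swap_val]
      exact hq
    cases s
    · simp only [letterOp, dif_pos hl', Module.End.mul_apply, LinearMap.mulLeft_apply,
        permuteFactors_mul, permuteFactors_single, hswap, mul_assoc]
    · simp only [letterOp, dif_pos hl', Module.End.mul_apply, LinearMap.mulLeft_apply,
        permuteFactors_mul, permuteFactors_single, hswap, ← mul_assoc]
  | twist i s =>
    have hl' : i < m := hl
    have : q = q' := Fin.ext hq
    subst this
    simp only [letterOp, dif_pos hl', LinearMap.mulLeft_apply, mul_assoc]

theorem braidOp_mul_single (R : H ⊗[k] H) (θ : H) {w : BraidWord}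
    (hw : ∀ l ∈ w, BraidLetter.Fits m l) (v : ⨂[k] _ : Fin m, H) {q q' : Fin m}
    (hq : w.perm q = q') (h : H) :
    braidOp R θ m w (v * PiTensorProduct.singleAlgHom (R := k) (A := fun _ : Fin m => H) q h) =
      braidOp R θ m w v *
        PiTensorProduct.singleAlgHom (R := k) (A := fun _ : Fin m => H) q' h := by
  induction w generalizing v q with
  | nil =>
    have : q = q' := Fin.ext hq
    subst this
    rfl
  | cons l w ih =>
    have hl := hw l List.mem_cons_self
    have hlt : l.perm q < m :=
      (BraidWord.perm_lt_iff (w := [l]) (fun l' hl' => by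
        rw [List.mem_singleton] at hl'; rwa [hl']) q).mpr q.2
    rw [braidOp, Module.End.mul_apply, letterOp_mul_single R θ hl v (q' := ⟨l.perm q, hlt⟩) rfl,
      ih (fun l' hl' => hw l' (List.mem_cons_of_mem _ hl')) _ (q := ⟨l.perm q, hlt⟩) hq]
    rfl

/-- The endomorphism `y ↦ χ(y) 1`. -/
noncomputable def charEnd (χ : H →ₐ[k] k) : Module.End k H :=
  LinearMap.toSpanSingleton k H 1 ∘ₗ χ.toLinearMap

theorem charEnd_apply (χ : H →ₐ[k] k) (y : H) : charEnd χ y = χ y • (1 : H) := rfl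

theorem map_mul_single (F : Fin m → Module.End k H) {q : Fin m} {χ : H →ₐ[k] k}
    (hF : F q = charEnd χ) (v : ⨂[k] _ : Fin m, H) (h : H) :
    PiTensorProduct.map F
      (v * PiTensorProduct.singleAlgHom (R := k) (A := fun _ : Fin m => H) q h) =
      χ h • PiTensorProduct.map F v := by
  induction v using PiTensorProduct.induction_on with
  | smul_tprod r y =>
    rw [smul_mul_assoc, map_smul, map_smul, smul_comm (χ h)]
    congr 1
    rw [singleAlgHom_apply, PiTensorProduct.tprod_mul_tprod (R := k) (A := fun _ : Fin m => H), PiTensorProduct.map_tprod, PiTensorProduct.map_tprod]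
    have : (fun i => F i ((y * Pi.mulSingle (M := fun _ : Fin m => H) q h : Fin m → H) i)) =
        Function.update (fun i => F i (y i)) q (χ h • F q (y q)) := by
      ext i
      by_cases hi : i = q
      · subst hi
        rw [Function.update_self, Pi.mul_apply, Pi.mulSingle_eq_same, hF, charEnd_apply,
          charEnd_apply, map_mul, smul_smul, mul_comm]
      · rw [Function.update_of_ne hi, Pi.mul_apply, Pi.mulSingle_eq_of_ne hi, mul_one]
    rw [this, MultilinearMap.map_update_smul, Function.update_eq_self]
  | add u v hu hv => rw [add_mul, map_add, map_add, smul_add, hu, hv]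

/-- The entry in factor `q` can be split off as a right multiplication. It passes through `Y` to the
factor `q'`, where only its character value remains; the entry may as well be replaced by that
scalar beforehand. -/
theorem map_comp_eq_comp_update (F : Fin m → Module.End k H) {q q' : Fin m} {χ : H →ₐ[k] k}
    (hF : F q' = charEnd χ) {Y : Module.End k (⨂[k] _ : Fin m, H)}
    (hY : ∀ v h, Y (v * PiTensorProduct.singleAlgHom (R := k) (A := fun _ : Fin m => H) q h) =
      Y v * PiTensorProduct.singleAlgHom (R := k) (A := fun _ : Fin m => H) q' h) :
    PiTensorProduct.map F ∘ₗ Y = PiTensorProduct.map F ∘ₗ Y ∘ₗ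
      PiTensorProduct.map (Function.update (fun _ => LinearMap.id) q (charEnd χ)) := by
  refine PiTensorProduct.ext (MultilinearMap.ext fun y => ?_)
  simp only [LinearMap.compMultilinearMap_apply, LinearMap.comp_apply, PiTensorProduct.map_tprod]
  have h1 : PiTensorProduct.tprod k y = PiTensorProduct.tprod k (Function.update y q 1) *
      PiTensorProduct.singleAlgHom (R := k) (A := fun _ : Fin m => H) q (y q) := by
    rw [singleAlgHom_apply, PiTensorProduct.tprod_mul_tprod (R := k) (A := fun _ : Fin m => H)]
    congr 1
    ext i
    by_cases hi : i = q
    · subst hi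
      simp
    · simp [hi]
  have h2 : (fun i => Function.update (fun _ => LinearMap.id) q (charEnd χ) i (y i)) =
      Function.update y q (χ (y q) • (1 : H)) := by
    ext i
    by_cases hi : i = q
    · subst hi
      simp [charEnd_apply]
    · simp [hi]
  rw [h1, hY, map_mul_single F hF, h2, MultilinearMap.map_update_smul, map_smul, map_smul]

variable [FiniteDimensional k H]

/-- The new `charEnd` at `q` is brought to the other side by cyclicity of the trace, where it meets
multiplication by `g` and gives `χ(g)`. -/
theorem trace_map_comp_update (F : Fin m → Module.End k H) {q q' : Fin m} {χ : H →ₐ[k] k} {g : H}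
    (hF : F q' = charEnd χ) (hFq : F q = LinearMap.mulLeft k g)
    {Y : Module.End k (⨂[k] _ : Fin m, H)}
    (hY : ∀ v h, Y (v * PiTensorProduct.singleAlgHom (R := k) (A := fun _ : Fin m => H) q h) =
      Y v * PiTensorProduct.singleAlgHom (R := k) (A := fun _ : Fin m => H) q' h) :
    LinearMap.trace k _ (PiTensorProduct.map F ∘ₗ Y) = χ g *
      LinearMap.trace k _ (PiTensorProduct.map (Function.update F q (charEnd χ)) ∘ₗ Y) := by
  rw [map_comp_eq_comp_update F hF hY, ← LinearMap.comp_assoc, LinearMap.trace_comp_comm',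
    ← LinearMap.comp_assoc, ← PiTensorProduct.map_comp]
  have h1 : (fun i => Function.update (fun _ => LinearMap.id) q (charEnd χ) i ∘ₗ F i) =
      Function.update F q (χ g • charEnd χ) := by
    funext i
    by_cases hi : i = q
    · subst hi
      rw [Function.update_self, Function.update_self, hFq]
      ext y
      simp [charEnd_apply, smul_smul]
    · rw [Function.update_of_ne hi, Function.update_of_ne hi, LinearMap.id_comp]
  rw [h1, PiTensorProduct.map_update_smul, LinearMap.smul_comp, map_smul, smul_eq_mul]

open Classical in
-- Starting from `S`, one walks backwards along the strands: a factor `q` outside `S` with `σ q` in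
-- `S` can be added to `S` at the cost of `χ q g`. Once every factor carries its character, the
-- operator factors through a functional and its trace is the value on `1`.
theorem trace_map_charEnd_comp (σ : Equiv.Perm (Fin m)) {Y : Module.End k (⨂[k] _ : Fin m, H)}
    (hY : ∀ q v h, Y (v * PiTensorProduct.singleAlgHom (R := k) (A := fun _ : Fin m => H) q h) =
      Y v * PiTensorProduct.singleAlgHom (R := k) (A := fun _ : Fin m => H) (σ q) h)
    (χ : Fin m → H →ₐ[k] k) (hχ : ∀ q, χ (σ q) = χ q) (g : H) (S : Finset (Fin m))
    (hS : ∀ q, ∃ j : ℕ, (σ ^ j) q ∈ S) :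
    LinearMap.trace k _ (PiTensorProduct.map
      (fun p => if p ∈ S then charEnd (χ p) else LinearMap.mulLeft k g) ∘ₗ Y) =
      (∏ p, if p ∈ S then 1 else χ p g) * charTensor χ (Y 1) := by
  induction hc : Sᶜ.card generalizing S with
  | zero =>
    have hS' : ∀ p, p ∈ S := by
      intro p
      by_contra hp
      have : Sᶜ = ∅ := Finset.card_eq_zero.mp hc
      exact absurd (Finset.mem_compl.mpr hp) (by rw [this]; exact Finset.notMem_empty _)
    simp only [hS', if_true, Finset.prod_const_one, one_mul]
    have : PiTensorProduct.map (fun p => charEnd (χ p)) ∘ₗ Y =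
        ((charTensor χ).toLinearMap ∘ₗ Y).smulRight 1 := by
      have h1 : PiTensorProduct.map (fun p => charEnd (χ p)) =
          (charTensor χ).toLinearMap.smulRight (1 : ⨂[k] _ : Fin m, H) := by
        refine PiTensorProduct.ext (MultilinearMap.ext fun y => ?_)
        simp only [LinearMap.compMultilinearMap_apply, PiTensorProduct.map_tprod, LinearMap.smulRight_apply,
          AlgHom.toLinearMap_apply, charTensor_tprod, charEnd_apply]
        exact MultilinearMap.map_smul_univ _ _ _
      rw [h1]
      rfl
    rw [this, LinearMap.trace_smulRight]
    rfl
  | succ c ih =>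
    -- The last point before the orbit of an element outside `S` first enters `S`.
    obtain ⟨q, hq, hq'⟩ : ∃ q, q ∉ S ∧ σ q ∈ S := by
      have hne : Sᶜ.Nonempty := by rw [← Finset.card_pos]; omega
      obtain ⟨q, hq⟩ := hne
      rw [Finset.mem_compl] at hq
      set j := Nat.find (hS q) with hj
      have h1 : (σ ^ j) q ∈ S := Nat.find_spec (hS q)
      have h0 : j ≠ 0 := by
        intro h
        rw [h] at h1
        exact hq h1
      obtain ⟨i, hi⟩ := Nat.exists_eq_succ_of_ne_zero h0
      refine ⟨(σ ^ i) q, Nat.find_min (hS q) (by omega), ?_⟩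
      rw [hi, Nat.succ_eq_add_one, pow_succ', Equiv.Perm.mul_apply] at h1
      exact h1
    have hne : σ q ≠ q := fun h => hq (h ▸ hq')
    rw [trace_map_comp_update (q := q) (q' := σ q) (χ := χ q) (g := g) _
      (by rw [if_pos hq', hχ]) (by rw [if_neg hq]) (hY q)]
    have h1 : Function.update (fun p => if p ∈ S then charEnd (χ p) else LinearMap.mulLeft k g) q
        (charEnd (χ q)) =
        fun p => if p ∈ insert q S then charEnd (χ p) else LinearMap.mulLeft k g := by
      funext p
      by_cases hp : p = q
      · subst hp
        simp
      · simp [hp]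
    rw [h1, ih (insert q S) (fun p => (hS p).imp fun j hj => Finset.mem_insert_of_mem hj)
      (by rw [Finset.compl_insert, Finset.card_erase_of_mem (Finset.mem_compl.mpr hq), hc]; rfl),
      ← mul_assoc]
    congr 1
    rw [← Finset.mul_prod_erase _ _ (Finset.mem_univ q),
      ← Finset.mul_prod_erase _ (fun p => if p ∈ S then 1 else χ p g) (Finset.mem_univ q),
      if_pos (Finset.mem_insert_self _ _), if_neg hq, one_mul]
    congr 1
    refine Finset.prod_congr rfl fun p hp => ?_
    simp [(Finset.mem_erase.mp hp).1]

end RibbonHopf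

/-! ### Colourings of links and the linking form -/

namespace BraidWord

open Equiv

/-- The sign of a letter. -/
def unitSign (R : Type*) [CommRing R] (s : Bool) : R := if s then 1 else -1

/-- The value of the linking form on a colouring `c` of the bottom positions: a crossing of strands
with colours `u` and `v` contributes `± u v`, a twist of a strand with colour `u` contributes
`± u²`. -/
def form {R : Type*} [CommRing R] : BraidWord → (ℕ → R) → R
  | [], _ => 0
  | .crossing i s :: w, c => unitSign R s * (c i * c (i + 1)) + form w (c ∘ swap i (i + 1))
  | .twist i s :: w, c => unitSign R s * c i ^ 2 + form w c

end BraidWord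

namespace FramedBraid

open Equiv

variable (L : FramedBraid)

theorem exists_component (q : Fin L.strands) :
    ∃ p : L.Component, L.word.SameComponent q (p : Fin L.strands) := by
  classical
  have hex : ∃ p, L.word.SameComponent q p := ⟨q, Perm.SameCycle.refl _ _⟩
  have hle : Nat.find hex ≤ q := Nat.find_min' hex (Perm.SameCycle.refl _ _)
  have hspec := Nat.find_spec hex
  refine ⟨⟨⟨Nat.find hex, hle.trans_lt q.2⟩, fun q' hq' => ?_⟩, hspec⟩
  exact Nat.find_min' hex (Perm.SameCycle.trans hspec hq')

/-- The component of a strand. -/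
noncomputable def componentOf (q : Fin L.strands) : L.Component := (L.exists_component q).choose

theorem sameComponent_componentOf (q : Fin L.strands) :
    L.word.SameComponent q (L.componentOf q : Fin L.strands) := (L.exists_component q).choose_spec

theorem component_ext {p p' : L.Component}
    (h : L.word.SameComponent (p : Fin L.strands) (p' : Fin L.strands)) : p = p' :=
  Subtype.ext (Fin.ext (le_antisymm (p.2 _ h) (p'.2 _ (Perm.SameCycle.symm h))))

theorem componentOf_eq_iff {q : Fin L.strands} {p : L.Component} :
    L.componentOf q = p ↔ L.word.SameComponent q (p : Fin L.strands) := by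
  constructor
  · rintro rfl
    exact L.sameComponent_componentOf q
  · intro h
    exact L.component_ext ((L.sameComponent_componentOf q).symm.trans h)

theorem componentOf_coe (p : L.Component) : L.componentOf p = p :=
  L.componentOf_eq_iff.mpr (Perm.SameCycle.refl _ _)

theorem componentOf_perm (q : Fin L.strands) (h : L.word.perm q < L.strands) :
    L.componentOf ⟨L.word.perm q, h⟩ = L.componentOf q := by
  rw [componentOf_eq_iff]
  exact (Perm.sameCycle_apply_left).mpr (L.sameComponent_componentOf q)

/-- The colouring of the strands given by a colouring of the components. -/
noncomputable def coloring {R : Type*} [Zero R] (r : L.Component → R) (q : ℕ) : R :=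
  if h : q < L.strands then r (L.componentOf ⟨q, h⟩) else 0

section
variable {R : Type*} [Zero R]

theorem coloring_of_lt (r : L.Component → R) {q : ℕ} (h : q < L.strands) :
    L.coloring r q = r (L.componentOf ⟨q, h⟩) := dif_pos h

theorem coloring_of_not_lt (r : L.Component → R) {q : ℕ} (h : ¬ q < L.strands) :
    L.coloring r q = 0 := dif_neg h

theorem coloring_coe (r : L.Component → R) (p : L.Component) :
    L.coloring r (p : Fin L.strands) = r p := by
  rw [coloring_of_lt _ _ (p : Fin L.strands).2]
  exact congrArg r (L.componentOf_coe p)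

theorem coloring_perm (r : L.Component → R) (q : ℕ) :
    L.coloring r (L.word.perm q) = L.coloring r q := by
  by_cases h : q < L.strands
  · have h' := (BraidWord.perm_lt_iff L.fits q).mpr h
    rw [coloring_of_lt _ _ h, coloring_of_lt _ _ h']
    exact congrArg r (L.componentOf_perm ⟨q, h⟩ h')
  · have h' := mt (BraidWord.perm_lt_iff L.fits q).mp h
    rw [coloring_of_not_lt _ _ h, coloring_of_not_lt _ _ h']

theorem comp_coloring {R' : Type*} [Zero R'] (f : R → R') (hf : f 0 = 0) (r : L.Component → R) :
    f ∘ L.coloring r = L.coloring (f ∘ r) := by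
  funext q
  simp only [coloring, Function.comp_apply]
  split_ifs
  · rfl
  · exact hf

end

end FramedBraid

/-! ### Evaluating braid operators by characters -/

namespace Radford

open RootCalculus RibbonHopf BraidWord

variable {k : Type u} [Field k] {n : ℕ} {ω : k} {s : ℕ} {β : k} {m : ℕ}

section
variable (hN : ((2 * n : ℕ) : k) ≠ 0) (hω : IsPrimitiveRoot ω (2 * n)) [hn : Fact (Odd n)]

/-- The product of the characters `a ↦ ω ^ b p`. -/
noncomputable def colorChar (m : ℕ) (b : ℕ → ℕ) :
    (⨂[k] _ : Fin m, Radford k n) →ₐ[k] k :=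
  charTensor fun p => character (ω ^ b p) (pow_pow_eq_one hω (b p))

/-- Rewriting `ω^(s p q)` as `(-1)^(p q) (-ω^s)^(p q)` separates a parity sign from a term that
depends on residues modulo `n` only. -/
theorem pairChar_rMatrix (hs : Odd s) (p q : ℕ) :
    pairChar (character (ω ^ p) (pow_pow_eq_one hω p)) (character (ω ^ q) (pow_pow_eq_one hω q))
      (rMatrix n ω s β) = (((-1 : ℤˣ) ^ (p * q) : ℤˣ) : ℤ) *
        signChar hN hω hs ((p : ZMod n) * q) := by
  rw [pairChar_eq, lid_map_rMatrix hN hω, character_a, ← Nat.cast_mul, signChar_natCast, neg_pow (ω ^ s),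
    ← mul_assoc, ← pow_mul, ← pow_mul]
  push_cast
  rw [← mul_pow, neg_one_mul, neg_neg, one_pow, one_mul]
  congr 1
  ring

theorem pairChar_inv_rMatrix (hs : Odd s) (p q : ℕ) :
    pairChar (character (ω ^ p) (pow_pow_eq_one hω p)) (character (ω ^ q) (pow_pow_eq_one hω q))
      (Ring.inverse (rMatrix n ω s β)) = (((-1 : ℤˣ) ^ (p * q) : ℤˣ) : ℤ) *
        signChar hN hω hs (-((p : ZMod n) * q)) := by
  have h1 := congrArg (pairChar (character (ω ^ p) (pow_pow_eq_one hω p))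
    (character (n := n) (ω ^ q) (pow_pow_eq_one hω q)))
    (Ring.mul_inverse_cancel _ (isUnit_rMatrix (s := s) (β := β) hN hω))
  rw [map_mul, map_one, pairChar_rMatrix hN hω hs] at h1
  rw [eq_inv_of_mul_eq_one_right h1, mul_inv, AddChar.map_neg_eq_inv]
  congr 1
  rcases neg_one_pow_eq_or ℤˣ (p * q) with h | h <;> rw [h] <;> simp

theorem colorChar_letterOp (hs : Odd s) {l : BraidLetter} (hl : l.Fits m) (b : ℕ → ℕ)
    (v : ⨂[k] _ : Fin m, Radford k n) :
    colorChar hω m (b ∘ l.perm) (letterOp (rMatrix n ω s β) (twist n ω s) m l v) =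
      ((oddSign [l] b : ℤˣ) : ℤ) * signChar hN hω hs (form [l] fun p => (b p : ZMod n)) *
        colorChar hω m b v := by
  cases l with
  | crossing i t =>
    have hl' : i + 1 < m := hl
    have hperm : ∀ v, colorChar hω m (b ∘ Equiv.swap i (i + 1)) (permuteFactors (k := k)
        (H := Radford k n) (Equiv.swap ⟨i, by omega⟩ ⟨i + 1, hl'⟩) v) = colorChar hω m b v := by
      intro v
      rw [colorChar, charTensor_permuteFactors, colorChar]
      congr 2
      funext p
      have : (b ∘ Equiv.swap i (i + 1)) (Equiv.swap (⟨i, by omega⟩ : Fin m) ⟨i + 1, hl'⟩ p : Fin m) =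
          b p := by
        rw [Function.comp_apply, swap_val, Equiv.swap_apply_self]
      simp only [this]
    cases t
    · simp only [letterOp, dif_pos hl', Module.End.mul_apply, LinearMap.mulLeft_apply]
      rw [map_mul]
      rw [show BraidLetter.perm (.crossing i false) = Equiv.swap i (i + 1) from rfl, hperm]
      congr 1
      rw [colorChar, charTensor_place, pairChar_inv_rMatrix hN hω hs]
      simp [oddSign, form, unitSign, mul_comm]
    · simp only [letterOp, dif_pos hl', Module.End.mul_apply, LinearMap.mulLeft_apply]
      rw [show BraidLetter.perm (.crossing i true) = Equiv.swap i (i + 1) from rfl, hperm, map_mul]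
      congr 1
      rw [colorChar, charTensor_place, pairChar_rMatrix hN hω hs]
      simp [oddSign, form, unitSign]
  | twist i t =>
    have hl' : i < m := hl
    rw [show BraidLetter.perm (.twist i t) = 1 from rfl, Equiv.Perm.coe_one, Function.comp_id]
    simp only [letterOp, dif_pos hl', LinearMap.mulLeft_apply]
    rw [map_mul]
    congr 1
    rw [colorChar, charTensor_single]
    cases t
    · simp [character_inv_twist_eq hN hω hs, oddSign, form, unitSign]
    · simp [character_twist_eq hN hω hs, oddSign, form, unitSign]

theorem oddSign_cons (l : BraidLetter) (w : BraidWord) (b : ℕ → ℕ) :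
    oddSign (l :: w) b = oddSign [l] b * oddSign w (b ∘ l.perm) := by
  cases l <;> simp [oddSign, BraidLetter.perm]

theorem form_cons {R : Type*} [CommRing R] (l : BraidLetter) (w : BraidWord) (c : ℕ → R) :
    form (l :: w) c = form [l] c + form w (c ∘ l.perm) := by
  cases l <;> simp [form, BraidLetter.perm]

theorem colorChar_braidOp (hs : Odd s) {w : BraidWord} (hw : ∀ l ∈ w, BraidLetter.Fits m l)
    (b b' : ℕ → ℕ) (hb : ∀ p, b' (w.perm p) = b p) (v : ⨂[k] _ : Fin m, Radford k n) :
    colorChar hω m b' (braidOp (rMatrix n ω s β) (twist n ω s) m w v) =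
      ((oddSign w b : ℤˣ) : ℤ) * signChar hN hω hs (form w fun p => (b p : ZMod n)) *
        colorChar hω m b v := by
  induction w generalizing b v with
  | nil =>
    have : b' = b := funext hb
    subst this
    simp [braidOp, oddSign, form]
  | cons l w ih =>
    have hll : ∀ p, l.perm (l.perm p) = p := fun p => by
      cases l <;> simp [BraidLetter.perm]
    rw [braidOp, Module.End.mul_apply,
      ih (fun l' hl' => hw l' (List.mem_cons_of_mem _ hl')) (b ∘ l.perm) (fun p => by
        rw [Function.comp_apply, ← hb, perm, Equiv.Perm.mul_apply, hll]),
      colorChar_letterOp hN hω hs (hw l List.mem_cons_self), oddSign_cons l w, form_cons l w,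
      AddChar.map_add_eq_mul]
    push_cast
    have : (fun p => ((b ∘ l.perm) p : ZMod n)) = (fun p => (b p : ZMod n)) ∘ l.perm := rfl
    rw [this]
    ring

include hN hω in
theorem inverse_special : Ring.inverse (special (rMatrix n ω s β) (twist n ω s)) = a k n ^ n := by
  rw [special_rMatrix hN hω]
  exact Ring.inverse_unit ⟨_, _, a_pow_n_mul_a_pow_n, a_pow_n_mul_a_pow_n⟩

end

end Radford

namespace FramedBraid

open Equiv

/-- The permutation of the strands of a framed braid. -/
def strandPerm (L : FramedBraid) : Perm (Fin L.strands) where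
  toFun q := ⟨L.word.perm q, (BraidWord.perm_lt_iff L.fits q).mpr q.2⟩
  invFun q := ⟨(L.word.perm)⁻¹ q, by
    rw [← BraidWord.perm_lt_iff L.fits, ← Perm.mul_apply, mul_inv_cancel]; exact q.2⟩
  left_inv q := by ext; simp
  right_inv q := by ext; simp

theorem strandPerm_val (L : FramedBraid) (q : Fin L.strands) :
    ((L.strandPerm q : Fin L.strands) : ℕ) = L.word.perm q := rfl

theorem strandPerm_inv_val (L : FramedBraid) (q : Fin L.strands) :
    ((L.strandPerm⁻¹ q : Fin L.strands) : ℕ) = (L.word.perm)⁻¹ q := rfl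

theorem strandPerm_zpow_val (L : FramedBraid) (i : ℤ) (q : Fin L.strands) :
    (((L.strandPerm ^ i) q : Fin L.strands) : ℕ) = (L.word.perm ^ i) q := by
  have h1 : ∀ (j : ℕ), (((L.strandPerm ^ j) q : Fin L.strands) : ℕ) = (L.word.perm ^ j) q := by
    intro j
    induction j with
    | zero => rfl
    | succ j ih =>
      rw [pow_succ', pow_succ', Perm.mul_apply, Perm.mul_apply, strandPerm_val, ih]
  have h2 : ∀ (j : ℕ), (((L.strandPerm⁻¹ ^ j) q : Fin L.strands) : ℕ) =
      ((L.word.perm)⁻¹ ^ j) q := by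
    intro j
    induction j with
    | zero => rfl
    | succ j ih =>
      rw [pow_succ', pow_succ', Perm.mul_apply, Perm.mul_apply, strandPerm_inv_val, ih]
  cases i with
  | ofNat j => exact h1 j
  | negSucc j => rw [zpow_negSucc, zpow_negSucc, ← inv_pow, ← inv_pow, h2]

theorem exists_strandPerm_pow_isBase (L : FramedBraid) (q : Fin L.strands) :
    ∃ j : ℕ, L.word.IsBase ((L.strandPerm ^ j) q : Fin L.strands) := by
  obtain ⟨i, hi⟩ := L.sameComponent_componentOf q
  have h : L.strandPerm.SameCycle q (L.componentOf q : Fin L.strands) :=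
    ⟨i, Fin.ext (by rw [strandPerm_zpow_val, hi])⟩
  obtain ⟨j, -, hj⟩ := h.exists_pow_eq'
  exact ⟨j, by rw [hj]; exact (L.componentOf q).2⟩

end FramedBraid

/-! ### The link invariant as a sum over colourings -/

namespace Radford

open RootCalculus RibbonHopf BraidWord

variable {k : Type u} [Field k] {n : ℕ} {ω : k} {s : ℕ} {β : k} {m : ℕ}

section
variable (hN : ((2 * n : ℕ) : k) ≠ 0) (hω : IsPrimitiveRoot ω (2 * n)) [hn : Fact (Odd n)]

open Classical in
-- The strands that are not cut carry `a^n`, which the character of a strand with colour `b` sends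
-- to `(-1)^b`. By `oddSign_eq` the product of these signs equals the product of the crossing signs,
-- and the square of a sign is `1`.
theorem trace_coloring (hs : Odd s) (L : FramedBraid) (l : L.Component → ℕ) :
    LinearMap.trace k _ (PiTensorProduct.map (fun p : Fin L.strands =>
      if L.word.IsBase p then charEnd (character (ω ^ L.coloring l p) (pow_pow_eq_one hω _))
      else LinearMap.mulLeft k (a k n ^ n)) ∘ₗ
        braidOp (rMatrix n ω s β) (twist n ω s) L.strands L.word) =
    signChar hN hω hs (form L.word (L.coloring fun p => (l p : ZMod n))) := by
  have h1 := trace_map_charEnd_comp L.strandPerm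
    (Y := braidOp (rMatrix n ω s β) (twist n ω s) L.strands L.word)
    (fun q v h => braidOp_mul_single _ _ L.fits v (L.strandPerm_val q).symm h)
    (fun p => character (ω ^ L.coloring l p) (pow_pow_eq_one hω _))
    (fun q => by
      have := L.coloring_perm l q
      simp only [FramedBraid.strandPerm_val, this])
    (a k n ^ n) (Finset.univ.filter fun p : Fin L.strands => L.word.IsBase p)
    (fun q => (L.exists_strandPerm_pow_isBase q).imp fun j hj => by simpa using hj)
  simp only [Finset.mem_filter, Finset.mem_univ, true_and] at h1
  rw [h1]
  have h2 : charTensor (fun p : Fin L.strands => character (ω ^ L.coloring l p)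
      (pow_pow_eq_one (n := n) hω _)) = colorChar hω L.strands (L.coloring l) := rfl
  rw [h2, colorChar_braidOp hN hω hs L.fits _ _ (L.coloring_perm l), map_one, mul_one]
  have h3 : ∏ p : Fin L.strands, (if L.word.IsBase p then 1 else
      character (ω ^ L.coloring l p) (pow_pow_eq_one (n := n) hω _) (a k n ^ n)) =
      ((oddSign L.word (L.coloring l) : ℤˣ) : ℤ) := by
    rw [oddSign_eq L.fits (L.coloring_perm l)]
    push_cast
    refine Finset.prod_congr rfl fun p _ => ?_
    split_ifs
    · simp
    · rw [map_pow, character_a, ← pow_mul, mul_comm, pow_mul, pow_half_eq_neg_one hN hω]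
      push_cast
      rfl
  have h4 : (fun p => ((L.coloring l p : ℕ) : ZMod n)) = L.coloring fun p => (l p : ZMod n) :=
    L.comp_coloring (fun x : ℕ => (x : ZMod n)) Nat.cast_zero l
  have h5 : (((oddSign L.word (L.coloring l) : ℤˣ) : ℤ) : k) *
      ((oddSign L.word (L.coloring l) : ℤˣ) : ℤ) = 1 := by
    rcases Int.units_eq_one_or (oddSign L.word (L.coloring l)) with h | h <;> rw [h] <;> simp
  rw [h3, h4, ← mul_assoc, h5, one_mul]

theorem sum_prod_eq_sum_prod_fiber {C : Type*} [Fintype C] [DecidableEq C] (f : Module.Dual k (Radford k n))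
    (Φ : (C → ZMod n) → k) :
    ∑ l : C → Fin (2 * n), (∏ p, f (eig (2 * n) ω (l p) (a k n))) *
      Φ (fun p => ((l p : ℕ) : ZMod n)) = ∑ r : C → ZMod n, (∏ p, fiber ω f (r p)) * Φ r := by
  classical
  have h1 : ∀ r : C → ZMod n, ∏ p, fiber ω f (r p) = ∑ l : C → Fin (2 * n),
      if r = (fun p => ((l p : ℕ) : ZMod n)) then ∏ p, f (eig (2 * n) ω (l p) (a k n)) else 0 := by
    intro r
    simp only [fiber, Finset.prod_univ_sum, Fintype.piFinset_univ]
    refine Finset.sum_congr rfl fun l _ => ?_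
    split_ifs with h
    · refine Finset.prod_congr rfl fun p _ => if_pos (congrFun h p).symm
    · obtain ⟨p, hp⟩ := Function.ne_iff.mp h
      exact Finset.prod_eq_zero (Finset.mem_univ p) (if_neg (Ne.symm hp))
  simp only [h1, Finset.sum_mul, ite_mul, zero_mul]
  rw [Finset.sum_comm]
  refine Finset.sum_congr rfl fun l _ => ?_
  rw [Finset.sum_ite_eq', if_pos (Finset.mem_univ _)]

/-- The endomorphism at a cut is a combination of the `charEnd` of characters, and the trace is
expanded multilinearly over the components. Each term depends only on the exponents modulo `n`, so
exponents are collected by residue. -/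
theorem tauLink_eq (hs : Odd s) {lam : Module.Dual k (Radford k n)} {z : Radford k n}
    (hf : phi lam z 1 ∈ reduced k n) (L : FramedBraid) :
    tauLink (rMatrix n ω s β) (twist n ω s) lam z L = ∑ r : L.Component → ZMod n,
      (∏ p, fiber ω (phi lam z 1) (r p)) * signChar hN hω hs (form L.word (L.coloring r)) := by
  classical
  set f := phi lam z 1 with hfdef
  have h1 : LinearMap.toSpanSingleton k (Radford k n) 1 ∘ₗ lam ∘ₗ LinearMap.mulLeft k z =
      ∑ l : Fin (2 * n), f (eig (2 * n) ω l (a k n)) •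
        charEnd (character (n := n) (ω ^ (l : ℕ)) (pow_pow_eq_one hω _)) := by
    ext y
    have : lam (z * y) = f y := (phi_one_apply lam z y).symm
    simp only [LinearMap.comp_apply, LinearMap.toSpanSingleton_apply, LinearMap.mulLeft_apply,
      this, LinearMap.sum_apply, LinearMap.smul_apply, charEnd_apply, smul_smul]
    rw [← Finset.sum_smul, reduced_apply hN hω hf]
  have h2 : PiTensorProduct.map (fun p : Fin L.strands =>
      if L.word.IsBase p then LinearMap.toSpanSingleton k (Radford k n) 1 ∘ₗ lam ∘ₗ
        LinearMap.mulLeft k z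
      else LinearMap.mulLeft k (Ring.inverse (special (rMatrix n ω s β) (twist n ω s)))) =
      ∑ l : L.Component → Fin (2 * n), (∏ p, f (eig (2 * n) ω (l p) (a k n))) •
        PiTensorProduct.map (fun p : Fin L.strands => if L.word.IsBase p then
          charEnd (character (n := n) (ω ^ L.coloring (fun p => (l p : ℕ)) p) (pow_pow_eq_one hω _))
          else LinearMap.mulLeft k (a k n ^ n)) := by
    -- Only the factors of the base strands vary; the others are fixed as multiplication by `a^n`,
    -- so that the expansion runs over components.
    set M := (PiTensorProduct.mapMultilinear k (fun _ : Fin L.strands => Radford k n)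
      (fun _ : Fin L.strands => Radford k n)).domDomRestrict
        (fun p : Fin L.strands => L.word.IsBase p) (fun _ => LinearMap.mulLeft k (a k n ^ n)) with hM
    have h3 := M.map_sum (fun (p : L.Component) (l : Fin (2 * n)) =>
      f (eig (2 * n) ω l (a k n)) •
        charEnd (character (n := n) (ω ^ (l : ℕ)) (pow_pow_eq_one hω _)))
    rw [← h1] at h3
    simp only [MultilinearMap.map_smul_univ] at h3
    refine Eq.trans ?_ (h3.trans (Finset.sum_congr rfl fun l _ => congrArg _ ?_))
    · rw [inverse_special hN hω]
      refine congrArg PiTensorProduct.map (funext fun p => ?_)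
      split_ifs <;> rfl
    · refine congrArg PiTensorProduct.map (funext fun p => ?_)
      by_cases hp : L.word.IsBase p
      · have := L.coloring_coe (fun p => (l p : ℕ)) ⟨p, hp⟩
        simp only at this
        rw [dif_pos hp, if_pos hp]
        simp only [this]
      · rw [dif_neg hp, if_neg hp]
  have h4 : tauLink (rMatrix n ω s β) (twist n ω s) lam z L =
      ∑ l : L.Component → Fin (2 * n), (∏ p, f (eig (2 * n) ω (l p) (a k n))) *
        signChar hN hω hs (form L.word (L.coloring fun p => ((l p : ℕ) : ZMod n))) := by
    rw [tauLink, h2]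
    have hsum : ∀ (F : (L.Component → Fin (2 * n)) → Module.End k (⨂[k] _ : Fin L.strands, Radford k n))
        (Y : Module.End k (⨂[k] _ : Fin L.strands, Radford k n)),
        (∑ l, F l) ∘ₗ Y = ∑ l, F l ∘ₗ Y := fun F Y => Finset.sum_mul _ F Y
    rw [hsum, map_sum]
    refine Finset.sum_congr rfl fun l _ => ?_
    rw [LinearMap.smul_comp, map_smul, smul_eq_mul, trace_coloring hN hω hs L fun p => (l p : ℕ)]
  rw [h4]
  exact sum_prod_eq_sum_prod_fiber f (fun r => signChar hN hω hs (form L.word (L.coloring r)))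

end

end Radford

/-! ### Colourings as a module, and Kirby moves that preserve the linking form -/

namespace BraidWord

open Equiv

theorem perm_append (u v : BraidWord) : perm (u ++ v) = perm v * perm u := by
  induction u with
  | nil => simp [perm]
  | cons l u ih => rw [List.cons_append, perm, perm, ih, mul_assoc]

section
variable {R : Type*} [CommRing R]

theorem unitSign_not (s : Bool) : unitSign R (!s) = -unitSign R s := by
  cases s <;> simp [unitSign]

theorem perm_letter_mul_self (l : BraidLetter) : l.perm * l.perm = 1 := by
  cases l <;> simp [BraidLetter.perm]

theorem form_append (u v : BraidWord) (c : ℕ → R) :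
    form (u ++ v) c = form u c + form v (c ∘ ⇑(perm u)⁻¹) := by
  induction u generalizing c with
  | nil => simp [perm, form]
  | cons l u ih =>
    rw [List.cons_append, Radford.form_cons, ih, Radford.form_cons l u, add_assoc]
    congr 3
    rw [perm, mul_inv_rev, ← mul_eq_one_iff_eq_inv.mp (perm_letter_mul_self l)]
    rfl

theorem form_congr {m : ℕ} {w : BraidWord} (hw : ∀ l ∈ w, BraidLetter.Fits m l) {c c' : ℕ → R}
    (h : ∀ q < m, c q = c' q) : form w c = form w c' := by
  induction w generalizing c c' with
  | nil => rfl
  | cons l w ih =>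
    have hl := hw l List.mem_cons_self
    rw [Radford.form_cons, Radford.form_cons l w c']
    congr 1
    · cases l with
      | crossing i s =>
        have hl : i + 1 < m := hl
        simp only [form, h i (by omega), h (i + 1) hl]
      | twist i s => simp only [form, h i hl]
    · refine ih (fun l' hl' => hw l' (List.mem_cons_of_mem _ hl')) fun q hq => h _ ?_
      have := perm_lt_iff (m := m) (w := [l]) (by simpa using hl) q
      rw [show perm [l] = l.perm from one_mul _] at this
      exact this.mpr hq

theorem LocalRel.perm_eq {x y : BraidWord} (h : LocalRel x y) : perm x = perm y := by
  cases h with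
  | cancel l => cases l <;> simp [perm, BraidLetter.perm, BraidLetter.inv]
  | commute l l' h =>
    cases l <;> cases l' <;> simp only [perm, BraidLetter.perm, one_mul, mul_one]
    rename_i i s j t
    refine (Perm.Disjoint.commute ?_).eq
    intro q
    simp only [BraidLetter.support, Finset.disjoint_insert_left, Finset.disjoint_singleton_left,
      Finset.mem_insert, Finset.mem_singleton, not_or] at h
    by_cases hq : q = i ∨ q = i + 1
    · left
      exact swap_apply_of_ne_of_ne (by omega) (by omega)
    · right
      exact swap_apply_of_ne_of_ne (by omega) (by omega)
  | braid i =>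
    simp only [perm, BraidLetter.perm, one_mul]
    ext q
    simp only [Perm.mul_apply, swap_apply_def]
    split_ifs <;> omega
  | twist_left i => simp [perm, BraidLetter.perm]
  | twist_right i => simp [perm, BraidLetter.perm]

theorem LocalRel.form_eq {x y : BraidWord} (h : LocalRel x y) (c : ℕ → R) :
    form x c = form y c := by
  cases h with
  | cancel l =>
    cases l
    · simp only [form, BraidLetter.inv, unitSign_not, Function.comp_apply, swap_apply_left,
        swap_apply_right]
      ring
    · simp only [form, BraidLetter.inv, unitSign_not]
      ring
  | commute l l' h =>
    cases l with
    | crossing i s =>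
      cases l' with
      | crossing j t =>
        simp only [BraidLetter.support, Finset.disjoint_insert_left,
          Finset.disjoint_singleton_left, Finset.mem_insert, Finset.mem_singleton, not_or] at h
        simp only [form, Function.comp_apply]
        rw [swap_apply_of_ne_of_ne (x := j) (by omega) (by omega),
          swap_apply_of_ne_of_ne (x := j + 1) (by omega) (by omega),
          swap_apply_of_ne_of_ne (x := i) (by omega) (by omega),
          swap_apply_of_ne_of_ne (x := i + 1) (by omega) (by omega)]
        ring
      | twist j t =>
        simp only [BraidLetter.support, Finset.disjoint_insert_left,
          Finset.disjoint_singleton_left, Finset.mem_singleton] at h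
        simp only [form, Function.comp_apply]
        rw [swap_apply_of_ne_of_ne (x := j) (by omega) (by omega)]
        ring
    | twist i s =>
      cases l' with
      | crossing j t =>
        simp only [BraidLetter.support, Finset.disjoint_singleton_left, Finset.mem_insert,
          Finset.mem_singleton, not_or] at h
        simp only [form, Function.comp_apply]
        rw [swap_apply_of_ne_of_ne (x := i) (by omega) (by omega)]
        ring
      | twist j t =>
        simp only [form]
        ring
  | braid i =>
    simp only [form, Function.comp_apply, swap_apply_left, swap_apply_right]
    rw [swap_apply_of_ne_of_ne (x := i + 1 + 1) (a := i) (by omega) (by omega),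
      swap_apply_of_ne_of_ne (x := i) (a := i + 1) (by omega) (by omega), swap_apply_left,
      swap_apply_right]
    ring
  | twist_left i =>
    simp only [form, Function.comp_apply, swap_apply_right]
    ring
  | twist_right i =>
    simp only [form, Function.comp_apply, swap_apply_left]
    ring

end

end BraidWord

namespace FramedBraid

open Equiv BraidWord

variable (R : Type*) [CommRing R] (L : FramedBraid)

/-- The colourings of the strands of a framed braid that are constant on the components of its
closure. -/
def colorings : Submodule R (ℕ → R) where
  carrier := {c | (∀ q, c (L.word.perm q) = c q) ∧ ∀ q, L.strands ≤ q → c q = 0}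
  add_mem' {c c'} h h' := ⟨fun q => by simp [h.1, h'.1], fun q hq => by simp [h.2 q hq, h'.2 q hq]⟩
  zero_mem' := ⟨fun _ => rfl, fun _ _ => rfl⟩
  smul_mem' t c h := ⟨fun q => by simp [h.1], fun q hq => by simp [h.2 q hq]⟩

variable {R L}

theorem apply_inv_of_invariant {α : Type*} {π : Perm ℕ} {c : ℕ → α} (h : ∀ q, c (π q) = c q)
    (q : ℕ) : c (π⁻¹ q) = c q := by
  rw [← h, ← Perm.mul_apply, mul_inv_cancel, Perm.one_apply]

theorem apply_eq_of_sameCycle {α : Type*} {π : Perm ℕ} {c : ℕ → α} (h : ∀ q, c (π q) = c q)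
    {p q : ℕ} (hpq : π.SameCycle p q) : c p = c q := by
  obtain ⟨i, rfl⟩ := hpq
  induction i with
  | zero => rfl
  | succ i ih => rw [add_comm, zpow_add, zpow_one, Perm.mul_apply, h, ih]
  | pred i ih =>
    rw [sub_eq_add_neg, add_comm, zpow_add, zpow_neg_one, Perm.mul_apply,
      apply_inv_of_invariant h, ih]

variable (R L) in
/-- Colourings of the components as colourings of the strands. -/
noncomputable def coloringsEquiv : (L.Component → R) ≃ₗ[R] L.colorings R where
  toFun r := ⟨L.coloring r, L.coloring_perm r, fun _ hq => L.coloring_of_not_lt r (not_lt.mpr hq)⟩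
  map_add' r r' := by
    ext q
    by_cases h : q < L.strands <;> simp [coloring, h]
  map_smul' t r := by
    ext q
    by_cases h : q < L.strands <;> simp [coloring, h]
  invFun c p := (c : ℕ → R) (p : Fin L.strands)
  left_inv r := by
    funext p
    exact L.coloring_coe r p
  right_inv c := by
    ext q
    change L.coloring (fun p : L.Component => (c : ℕ → R) (p : Fin L.strands)) q = (c : ℕ → R) q
    by_cases h : q < L.strands
    · exact (L.coloring_of_lt _ h).trans
        (apply_eq_of_sameCycle c.2.1 (L.sameComponent_componentOf ⟨q, h⟩)).symm
    · exact (L.coloring_of_not_lt _ h).trans (c.2.2 q (not_lt.mp h)).symm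

theorem forall_coloring_mem_iff (J : Ideal R) (r : L.Component → R) :
    (∀ q, L.coloring r q ∈ J) ↔ ∀ p, r p ∈ J := by
  constructor
  · intro h p
    rw [← L.coloring_coe r p]
    exact h _
  · intro h q
    by_cases hq : q < L.strands
    · rw [L.coloring_of_lt r hq]
      exact h _
    · rw [L.coloring_of_not_lt r hq]
      exact J.zero_mem

variable (R) in
/-- The colourings of two links correspond to each other, so that the linking forms agree. -/
def Isometric (L L' : FramedBraid) : Prop :=
  ∃ e : L.colorings R ≃ₗ[R] L'.colorings R,
    (∀ c, form L'.word (e c : ℕ → R) = form L.word (c : ℕ → R)) ∧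
    ∀ (J : Ideal R) (c : L.colorings R), (∀ q, (c : ℕ → R) q ∈ J) ↔ ∀ q, (e c : ℕ → R) q ∈ J

/-- Both maps have to respect ideals, because the Gauss sums run over the colourings with values in
an ideal. -/
theorem Isometric.of_maps {L L' : FramedBraid} (f g : (ℕ → R) →ₗ[R] (ℕ → R))
    (hf : ∀ c ∈ L.colorings R, f c ∈ L'.colorings R)
    (hg : ∀ c ∈ L'.colorings R, g c ∈ L.colorings R)
    (hgf : ∀ c ∈ L.colorings R, g (f c) = c) (hfg : ∀ c ∈ L'.colorings R, f (g c) = c)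
    (hform : ∀ c ∈ L.colorings R, form L'.word (f c) = form L.word c)
    (hfJ : ∀ (J : Ideal R) c, (∀ q, c q ∈ J) → ∀ q, f c q ∈ J)
    (hgJ : ∀ (J : Ideal R) c, (∀ q, c q ∈ J) → ∀ q, g c q ∈ J) : Isometric R L L' := by
  refine ⟨LinearEquiv.ofLinearMap (f.restrict hf) (g.restrict hg)
    (LinearMap.ext fun c => Subtype.ext (hfg c c.2))
    (LinearMap.ext fun c => Subtype.ext (hgf c c.2)), fun c => hform c c.2, fun J c => ?_⟩
  refine ⟨hfJ J c, fun h => ?_⟩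
  have := hgJ J _ h
  change ∀ q, g (f c) q ∈ J at this
  rwa [hgf c c.2] at this

theorem isometric_local_rel (m : ℕ) (u v x y : BraidWord) (hx hy) (h : LocalRel x y) :
    Isometric R ⟨m, u ++ x ++ v, hx⟩ ⟨m, u ++ y ++ v, hy⟩ := by
  have hp : perm (u ++ x ++ v) = perm (u ++ y ++ v) := by
    simp only [perm_append, h.perm_eq]
  refine Isometric.of_maps LinearMap.id LinearMap.id (fun c hc => ⟨?_, hc.2⟩)
    (fun c hc => ⟨?_, hc.2⟩) (fun _ _ => rfl) (fun _ _ => rfl) (fun c _ => ?_)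
    (fun _ _ h => h) (fun _ _ h => h)
  · have := hc.1
    simp only [hp] at this
    exact this
  · have := hc.1
    simp only [← hp] at this
    exact this
  · simp only [LinearMap.id_apply, form_append, perm_append, h.perm_eq, h.form_eq]

/-- The colours are transported upwards through `u`: the colouring at the height between `u` and `v`
is the bottom colouring of the conjugated braid. -/
theorem isometric_conj (m : ℕ) (u v : BraidWord) (h h') :
    Isometric R ⟨m, u ++ v, h⟩ ⟨m, v ++ u, h'⟩ := by
  have hu : ∀ l ∈ u, BraidLetter.Fits m l := fun l hl => h l (List.mem_append_left _ hl)
  have hum (q : ℕ) : m ≤ perm u q ↔ m ≤ q := by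
    rw [← not_lt, perm_lt_iff hu, not_lt]
  have huv (q : ℕ) : (perm u)⁻¹ (perm u q) = q := by
    rw [← Perm.mul_apply, inv_mul_cancel, Perm.one_apply]
  have hvu (q : ℕ) : perm u ((perm u)⁻¹ q) = q := by
    rw [← Perm.mul_apply, mul_inv_cancel, Perm.one_apply]
  refine Isometric.of_maps (LinearMap.funLeft R R ⇑(perm u)⁻¹) (LinearMap.funLeft R R ⇑(perm u))
    (fun c hc => ⟨fun q => ?_, fun q hq => ?_⟩) (fun c hc => ⟨fun q => ?_, fun q hq => ?_⟩)
    (fun c _ => ?_) (fun c _ => ?_) (fun c hc => ?_) (fun _ _ h q => h _) (fun _ _ h q => h _)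
  · have := hc.1 ((perm u)⁻¹ q)
    simp only [perm_append, Perm.mul_apply, hvu, LinearMap.funLeft_apply] at this ⊢
    rw [huv, this]
  · refine hc.2 _ ?_
    change m ≤ _
    rw [← hum, hvu]
    exact hq
  · have := hc.1 (perm u q)
    simp only [perm_append, Perm.mul_apply, LinearMap.funLeft_apply] at this ⊢
    exact this
  · exact hc.2 _ ((hum q).mpr hq)
  · funext q
    simp only [LinearMap.funLeft_apply, huv]
  · funext q
    simp only [LinearMap.funLeft_apply, hvu]
  · change form (v ++ u) (c ∘ ⇑(perm u)⁻¹) = form (u ++ v) c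
    rw [form_append, form_append, add_comm]
    congr 2
    funext q
    have := apply_inv_of_invariant hc.1 q
    simp only [perm_append, mul_inv_rev] at this
    exact this

/-- The new strand joins the component of strand `m` and inherits its colour. The crossing then
contributes `± c_m²`, cancelled by the twist of opposite sign. -/
theorem isometric_markov (m : ℕ) (w : BraidWord) (s : Bool) (h h') :
    Isometric R ⟨m + 1, w, h⟩ ⟨m + 2, w ++ [.crossing m s, .twist (m + 1) !s], h'⟩ := by
  have hw (q : ℕ) : perm w q < m + 1 ↔ q < m + 1 := perm_lt_iff h q
  have hw' : perm w (m + 1) = m + 1 := by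
    have h1 := perm_lt_iff (m := m + 2) (w := w) (fun l hl => h' l (List.mem_append_left _ hl))
      (m + 1)
    have h2 := hw (m + 1)
    omega
  have hwi : (perm w)⁻¹ (m + 1) = m + 1 := by
    rw [Perm.inv_eq_iff_eq, hw']
  have hne {q : ℕ} (hq : q ≠ m + 1) : perm w q ≠ m + 1 := fun h => hq <| by
    rw [← hw'] at h
    exact (perm w).injective h
  have hperm : perm (w ++ [.crossing m s, .twist (m + 1) !s]) = swap m (m + 1) * perm w := by
    rw [perm_append]
    simp [perm, BraidLetter.perm]
  let f : (ℕ → R) →ₗ[R] (ℕ → R) := LinearMap.pi fun q =>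
    if q = m + 1 then LinearMap.proj m else LinearMap.proj q
  let g : (ℕ → R) →ₗ[R] (ℕ → R) := LinearMap.pi fun q =>
    if q = m + 1 then 0 else LinearMap.proj q
  have hf1 (c : ℕ → R) : f c (m + 1) = c m := by simp [f]
  have hf2 (c : ℕ → R) {q : ℕ} (hq : q ≠ m + 1) : f c q = c q := by simp [f, hq]
  have hg1 (c : ℕ → R) : g c (m + 1) = 0 := by simp [g]
  have hg2 (c : ℕ → R) {q : ℕ} (hq : q ≠ m + 1) : g c q = c q := by simp [g, hq]
  have hfw {c : ℕ → R} (hc : ∀ q, c (perm w q) = c q) (q : ℕ) : f c (perm w q) = f c q := by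
    by_cases hq : q = m + 1
    · rw [hq, hw']
    · rw [hf2 _ hq, hf2 _ (hne hq), hc]
  have hfs (c : ℕ → R) (q : ℕ) : f c (swap m (m + 1) q) = f c q := by
    rw [swap_apply_def]
    split_ifs with h1 h2
    · rw [hf1, hf2 _ (by omega), h1]
    · rw [h2, hf1, hf2 _ (by omega)]
    · rfl
  refine Isometric.of_maps f g (fun c hc => ⟨fun q => ?_, fun q hq => ?_⟩)
    (fun c hc => ?_) (fun c hc => ?_) (fun c hc => ?_) (fun c hc => ?_)
    (fun J c hc q => ?_) (fun J c hc q => ?_)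
  · rw [hperm, Perm.mul_apply, hfs, hfw hc.1]
  · change m + 2 ≤ q at hq
    rw [hf2 _ (by omega)]
    exact hc.2 q (show m + 1 ≤ q by omega)
  · have h1 : ∀ q, c (swap m (m + 1) (perm w q)) = c q := by
      have := hc.1
      simp only [hperm, Perm.mul_apply] at this
      exact this
    have h2 : c m = c (m + 1) := by
      have := h1 (m + 1)
      rwa [hw', swap_apply_right] at this
    refine ⟨fun q => ?_, fun q hq => ?_⟩
    · change g c (perm w q) = g c q
      by_cases hq : q = m + 1
      · rw [hq, hw']
      · rw [hg2 _ hq, hg2 _ (hne hq), ← h1 q, swap_apply_def]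
        split_ifs with h3 h4
        · rw [h3, h2]
        · exact absurd h4 (hne hq)
        · rfl
    · change m + 1 ≤ q at hq
      by_cases hq' : q = m + 1
      · rw [hq', hg1]
      · rw [hg2 _ hq']
        exact hc.2 q (show m + 2 ≤ q by omega)
  · funext q
    by_cases hq : q = m + 1
    · rw [hq, hg1, hc.2 (m + 1) le_rfl]
    · rw [hg2 _ hq, hf2 _ hq]
  · funext q
    by_cases hq : q = m + 1
    · have := hc.1 (m + 1)
      simp only [hperm, Perm.mul_apply, hw', swap_apply_right] at this
      rw [hq, hf1, hg2 _ (by omega), this]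
    · rw [hf2 _ hq, hg2 _ hq]
  · change form (w ++ _) (f c) = form w c
    rw [form_append, form_congr h (c' := c) fun q hq => hf2 c (by omega)]
    simp only [form, Function.comp_apply, swap_apply_right, unitSign_not,
      apply_inv_of_invariant (hfw hc.1), hf1]
    rw [hf2 _ (by omega)]
    ring
  · by_cases hq : q = m + 1
    · rw [hq, hf1]; exact hc _
    · rw [hf2 _ hq]; exact hc _
  · by_cases hq : q = m + 1
    · rw [hq, hg1]; exact J.zero_mem
    · rw [hg2 _ hq]; exact hc _

end FramedBraid

/-! ### Cables and handle slides -/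

namespace BraidWord

open Equiv

theorem offset_zero (D : Finset ℕ) : offset D 0 = 0 := by simp [offset]

theorem offset_succ (D : Finset ℕ) (i : ℕ) :
    offset D (i + 1) = offset D i + 1 + if i ∈ D then 1 else 0 := by
  have h : D.filter (· < i + 1) = D.filter (· < i) ∪ D.filter (· = i) := by
    ext q
    simp only [Finset.mem_filter, Finset.mem_union]
    rw [← and_or_left, Nat.lt_succ_iff, le_iff_lt_or_eq]
  have hd : Disjoint (D.filter (· < i)) (D.filter (· = i)) :=
    Finset.disjoint_filter.mpr fun q _ h1 h2 => by omega
  rw [offset, offset, h, Finset.card_union_of_disjoint hd, Finset.filter_eq']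
  split_ifs <;> simp <;> omega

theorem offset_succ_of_mem {D : Finset ℕ} {i : ℕ} (h : i ∈ D) :
    offset D (i + 1) = offset D i + 2 := by rw [offset_succ, if_pos h]

theorem offset_succ_of_notMem {D : Finset ℕ} {i : ℕ} (h : i ∉ D) :
    offset D (i + 1) = offset D i + 1 := by rw [offset_succ, if_neg h]

theorem offset_strictMono (D : Finset ℕ) : StrictMono (offset D) :=
  strictMono_nat_of_lt_succ fun i => by rw [offset_succ]; omega

theorem offset_one {D : Finset ℕ} (h : 0 ∉ D) : offset D 1 = 1 := by
  rw [show (1 : ℕ) = 0 + 1 from rfl, offset_succ_of_notMem h, offset_zero]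

theorem offset_add_one_ne {D : Finset ℕ} {i : ℕ} (h : i ∈ D) (j : ℕ) :
    offset D j ≠ offset D i + 1 := by
  intro h'
  have h1 : i < j := (offset_strictMono D).lt_iff_lt.mp (by omega)
  have h2 := (offset_strictMono D).monotone (show i + 1 ≤ j from h1)
  have := offset_succ_of_mem h
  omega

theorem exists_eq_offset (D : Finset ℕ) (p : ℕ) :
    (∃ i, p = offset D i) ∨ ∃ i ∈ D, p = offset D i + 1 := by
  induction p with
  | zero => exact Or.inl ⟨0, (offset_zero D).symm⟩
  | succ p ih =>
    rcases ih with ⟨i, rfl⟩ | ⟨i, hi, rfl⟩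
    · by_cases hi : i ∈ D
      · exact Or.inr ⟨i, hi, rfl⟩
      · exact Or.inl ⟨i + 1, (offset_succ_of_notMem hi).symm⟩
    · exact Or.inl ⟨i + 1, (offset_succ_of_mem hi).symm⟩

theorem offset_congr {D D' : Finset ℕ} {j : ℕ} (h : ∀ q < j, q ∈ D ↔ q ∈ D') :
    offset D j = offset D' j := by
  rw [offset, offset]
  congr 2
  ext q
  simp only [Finset.mem_filter]
  exact ⟨fun ⟨h1, h2⟩ => ⟨(h q h2).mp h1, h2⟩, fun ⟨h1, h2⟩ => ⟨(h q h2).mpr h1, h2⟩⟩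

theorem mem_map_perm {D : Finset ℕ} {π : Perm ℕ} {q : ℕ} :
    π q ∈ D.map π.toEmbedding ↔ q ∈ D := by
  simp

/-- The part of a cable that replaces one letter. -/
def block (D : Finset ℕ) : BraidLetter → BraidWord
  | .twist i s => if i ∈ D then
        [.twist (offset D i) s, .twist (offset D i + 1) s,
          .crossing (offset D i) s, .crossing (offset D i) s]
      else [.twist (offset D i) s]
  | .crossing i s => if i ∈ D then
        if i + 1 ∈ D then
          [.crossing (offset D i + 1) s, .crossing (offset D i) s,
            .crossing (offset D i + 2) s, .crossing (offset D i + 1) s]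
        else [.crossing (offset D i + 1) s, .crossing (offset D i) s]
      else
        if i + 1 ∈ D then [.crossing (offset D i) s, .crossing (offset D i + 1) s]
        else [.crossing (offset D i) s]

theorem cable_cons (D : Finset ℕ) (l : BraidLetter) (w : BraidWord) :
    cable D (l :: w) = block D l ++ cable (D.map l.perm.toEmbedding) w := by
  cases l with
  | crossing i s => rw [cable, block, BraidLetter.perm]
  | twist i s =>
    rw [cable, block, BraidLetter.perm]
    congr 2
    exact Finset.map_refl.symm

section swap

variable (D : Finset ℕ) (i : ℕ)

theorem mem_map_swap_iff (q : ℕ) :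
    q ∈ D.map (swap i (i + 1)).toEmbedding ↔ swap i (i + 1) q ∈ D := by
  rw [← mem_map_perm (π := swap i (i + 1)) (D := D), swap_apply_self]

theorem offset_map_swap_of_le {j : ℕ} (h : j ≤ i) :
    offset (D.map (swap i (i + 1)).toEmbedding) j = offset D j :=
  offset_congr fun q hq => by
    rw [mem_map_swap_iff, swap_apply_of_ne_of_ne (by omega) (by omega)]

theorem offset_map_swap_succ : offset (D.map (swap i (i + 1)).toEmbedding) (i + 1) =
    offset D i + 1 + if i + 1 ∈ D then 1 else 0 := by
  rw [offset_succ, offset_map_swap_of_le D i le_rfl]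
  simp only [mem_map_swap_iff, swap_apply_left]

theorem offset_map_swap_of_lt {j : ℕ} (h : i + 1 < j) :
    offset (D.map (swap i (i + 1)).toEmbedding) j = offset D j := by
  induction j, h using Nat.le_induction with
  | base =>
    rw [offset_succ, offset_map_swap_succ, offset_succ D (i + 1), offset_succ D i]
    simp only [mem_map_swap_iff, swap_apply_right]
    omega
  | succ j hj ih =>
    rw [offset_succ, ih, offset_succ D j]
    simp only [mem_map_swap_iff]
    rw [swap_apply_of_ne_of_ne (by omega) (by omega)]

end swap

/-- The cables at `i` and `i + 1` are exchanged as blocks, each moving by the width of the other. -/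
theorem perm_block_crossing (D : Finset ℕ) (i : ℕ) (s : Bool) (p : ℕ) :
    perm (block D (.crossing i s)) p =
      if p < offset D i then p else if p < offset D (i + 1) then
        p + 1 + (if i + 1 ∈ D then 1 else 0) else if p < offset D (i + 2) then
        p - 1 - (if i ∈ D then 1 else 0) else p := by
  rw [offset_succ D (i + 1), offset_succ D i, block]
  generalize offset D i = o
  by_cases h : i ∈ D <;> by_cases h' : i + 1 ∈ D <;>
    simp only [h, h', if_true, if_false, perm, BraidLetter.perm, one_mul, Perm.mul_apply,
      add_zero, tsub_zero]
  · obtain hp | rfl | rfl | rfl | rfl | hp : p < o ∨ p = o ∨ p = o + 1 ∨ p = o + 2 ∨ p = o + 3 ∨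
      o + 3 < p := by omega
    · iterate 4 rw [swap_apply_of_ne_of_ne (x := p) (by omega) (by omega)]
      rw [if_pos hp]
    · simp [swap_apply_def, add_assoc]
    · simp [swap_apply_def, add_assoc]
    · simp [swap_apply_def, add_assoc]
    · simp [swap_apply_def, add_assoc]
    · iterate 4 rw [swap_apply_of_ne_of_ne (x := p) (by omega) (by omega)]
      rw [if_neg (by omega), if_neg (by omega), if_neg (by omega)]
  · simp only [swap_apply_def]
    split_ifs <;> omega
  · simp only [swap_apply_def]
    split_ifs <;> omega
  · simp only [swap_apply_def]
    split_ifs <;> omega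

theorem perm_block_twist (D : Finset ℕ) (i : ℕ) (s : Bool) : perm (block D (.twist i s)) = 1 := by
  rw [block]
  split_ifs <;> simp [perm, BraidLetter.perm]

theorem perm_block_add (D : Finset ℕ) (l : BraidLetter) (j t : ℕ)
    (ht : t = 0 ∨ t = 1 ∧ j ∈ D) :
    perm (block D l) (offset D j + t) = offset (D.map l.perm.toEmbedding) (l.perm j) + t := by
  have ht' : offset D j + t < offset D (j + 1) := by
    rcases ht with rfl | ⟨rfl, h⟩
    · exact offset_strictMono D (Nat.lt_succ_self j)
    · rw [offset_succ_of_mem h]; omega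
  have hle := fun {a b : ℕ} (h : a ≤ b) => (offset_strictMono D).monotone h
  cases l with
  | twist i s =>
    rw [perm_block_twist]
    change offset D j + t = offset (D.map (Equiv.refl ℕ).toEmbedding) j + t
    rw [show (Equiv.refl ℕ).toEmbedding = Function.Embedding.refl ℕ from rfl, Finset.map_refl]
  | crossing i s =>
    rw [perm_block_crossing, BraidLetter.perm]
    rcases lt_trichotomy j i with h | rfl | h
    · rw [swap_apply_of_ne_of_ne (by omega) (by omega), offset_map_swap_of_le D i h.le,
        if_pos (ht'.trans_le (hle h))]
    · rw [swap_apply_left, offset_map_swap_succ, if_neg (by omega), if_pos ht']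
      omega
    · rcases (show i + 1 ≤ j from h).eq_or_lt with rfl | h
      · have := offset_succ D i
        rw [swap_apply_right, offset_map_swap_of_le D i le_rfl, if_neg (by omega),
          if_neg (by omega), if_pos ht']
        omega
      · have h1 := hle (show i + 2 ≤ j from h)
        have h2 := hle (show i ≤ i + 1 by omega)
        have h3 := hle (show i + 1 ≤ i + 2 by omega)
        rw [swap_apply_of_ne_of_ne (by omega) (by omega), offset_map_swap_of_lt D i h,
          if_neg (by omega), if_neg (by omega), if_neg (by omega)]

theorem perm_cable_add (D : Finset ℕ) (w : BraidWord) (j t : ℕ) (ht : t = 0 ∨ t = 1 ∧ j ∈ D) :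
    perm (cable D w) (offset D j + t) =
      offset (D.map (perm w).toEmbedding) (perm w j) + t := by
  induction w generalizing D j with
  | nil =>
    change offset D j + t = offset (D.map (Function.Embedding.refl ℕ)) j + t
    rw [Finset.map_refl]
  | cons l w ih =>
    rw [cable_cons, perm_append, Perm.mul_apply, perm_block_add D l j t ht,
      ih _ _ (ht.imp_right (And.imp_right mem_map_perm.mpr)), Finset.map_map]
    rfl

section
variable {R : Type*} [CommRing R]

/-- The colours of the strands given by the colours of the strands of a cable: the colours of the
two copies of a doubled strand are added. -/
def merge (D : Finset ℕ) : (ℕ → R) →ₗ[R] (ℕ → R) := LinearMap.pi fun i =>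
  (LinearMap.proj (offset D i) : (ℕ → R) →ₗ[R] R) +
    if i ∈ D then LinearMap.proj (offset D i + 1) else 0

theorem merge_of_mem {D : Finset ℕ} {i : ℕ} (h : i ∈ D) (d : ℕ → R) :
    merge D d i = d (offset D i) + d (offset D i + 1) := by simp [merge, h]

theorem merge_of_notMem {D : Finset ℕ} {i : ℕ} (h : i ∉ D) (d : ℕ → R) :
    merge D d i = d (offset D i) := by simp [merge, h]

theorem merge_apply_map {D : Finset ℕ} {π τ : Perm ℕ}
    (h : ∀ j t, (t = 0 ∨ t = 1 ∧ j ∈ D) →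
      τ (offset D j + t) = offset (D.map π.toEmbedding) (π j) + t) (d : ℕ → R) :
    merge (D.map π.toEmbedding) d ∘ π = merge D (d ∘ τ) := by
  funext j
  have h0 := h j 0 (Or.inl rfl)
  rw [add_zero, add_zero] at h0
  rw [Function.comp_apply]
  by_cases hj : j ∈ D
  · rw [merge_of_mem (mem_map_perm.mpr hj), merge_of_mem hj, Function.comp_apply,
      Function.comp_apply, h0, h j 1 (Or.inr ⟨rfl, hj⟩)]
  · rw [merge_of_notMem (mt mem_map_perm.mp hj), merge_of_notMem hj, Function.comp_apply, h0]

/-- A crossing of cables expands a product of sums of colours. For a twist, `(u + v)² = u² + v² + 2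
u v` explains why a doubled twist needs two additional crossings. -/
theorem form_block (D : Finset ℕ) (l : BraidLetter) (d : ℕ → R) :
    form (block D l) d = form [l] (merge D d) := by
  cases l with
  | twist i s =>
    by_cases h : i ∈ D
    · simp only [block, h, if_true, form, merge_of_mem h, Function.comp_apply, swap_apply_left,
        swap_apply_right]
      ring
    · simp only [block, h, if_false, form, merge_of_notMem h]
  | crossing i s =>
    by_cases h : i ∈ D <;> by_cases h' : i + 1 ∈ D
    · simp only [block, h, h', if_true, form, merge_of_mem h, merge_of_mem h',
        offset_succ_of_mem h, Function.comp_apply, swap_apply_def]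
      simp [add_assoc]
      ring
    · simp only [block, h, h', if_true, if_false, form, merge_of_mem h, merge_of_notMem h',
        offset_succ_of_mem h, Function.comp_apply, swap_apply_def]
      simp [add_assoc]
      ring
    · simp only [block, h, h', if_true, if_false, form, merge_of_notMem h, merge_of_mem h',
        offset_succ_of_notMem h, Function.comp_apply, swap_apply_def]
      simp [add_assoc]
      ring
    · simp only [block, h, h', if_false, form, merge_of_notMem h, merge_of_notMem h',
        offset_succ_of_notMem h]

theorem form_cable (D : Finset ℕ) (w : BraidWord) (d : ℕ → R) :
    form (cable D w) d = form w (merge D d) := by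
  induction w generalizing D d with
  | nil => rfl
  | cons l w ih =>
    rw [cable_cons, form_append, form_block, ih, Radford.form_cons l w]
    congr 2
    have h := merge_apply_map (perm_block_add D l) (d ∘ ⇑(perm (block D l))⁻¹)
    have h1 : (d ∘ ⇑(perm (block D l))⁻¹) ∘ ⇑(perm (block D l)) = d := by
      funext q
      simp
    have h2 : ∀ q, l.perm (l.perm q) = q := fun q => by
      rw [← Perm.mul_apply, perm_letter_mul_self, Perm.one_apply]
    rw [h1] at h
    rw [← h]
    funext q
    simp [h2]

end

end BraidWord

namespace FramedBraid

open Equiv BraidWord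

variable {R : Type*} [CommRing R]

theorem exists_perm_pow_eq (L : FramedBraid) {q : ℕ} (hq : q < L.strands) :
    ∃ j : ℕ, (L.word.perm ^ (j + 1)) q = q := by
  refine ⟨orderOf L.strandPerm - 1, ?_⟩
  rw [Nat.sub_add_cancel (orderOf_pos _)]
  have h := L.strandPerm_zpow_val (orderOf L.strandPerm) ⟨q, hq⟩
  rw [zpow_natCast, zpow_natCast, pow_orderOf_eq_one] at h
  exact h.symm

/-- If `c` is constant along the orbit of `1` under `π`, except that the value at `0` takes the place
of the value at `1`, then the two values agree. -/
theorem apply_zero_eq_apply_one {α : Type*} {π : Perm ℕ} {c : ℕ → α}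
    (hc : ∀ i, c (π i) = c (swap 0 1 i)) (h01 : ¬ π.SameCycle 0 1) {j : ℕ}
    (hj : (π ^ (j + 1)) 1 = 1) : c 0 = c 1 := by
  have key : ∀ i, c ((π ^ (i + 1)) 1) = c 0 ∨ c 0 = c 1 := by
    intro i
    induction i with
    | zero =>
      left
      rw [zero_add, pow_one, hc, swap_apply_right]
    | succ i ih =>
      rcases ih with ih | ih
      · by_cases h1 : (π ^ (i + 1)) 1 = 1
        · right
          rw [← ih, h1]
        · have h0 : (π ^ (i + 1)) 1 ≠ 0 := fun h0 => h01 (Perm.SameCycle.symm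
            ⟨(i + 1 : ℕ), by rw [zpow_natCast, h0]⟩)
          left
          rw [pow_succ', Perm.mul_apply, hc, swap_apply_of_ne_of_ne h0 h1, ih]
      · exact Or.inr ih
  rcases key j with h | h
  · rw [← h, hj]
  · exact h

/-- The colouring of a handle slide. -/
noncomputable def slideMap (D : Finset ℕ) : (ℕ → R) →ₗ[R] (ℕ → R) := LinearMap.pi
  (Function.extend (offset D)
    (fun i => if i ∈ D then (LinearMap.proj 0 : (ℕ → R) →ₗ[R] R) else LinearMap.proj i)
    (fun _ => (LinearMap.proj 1 : (ℕ → R) →ₗ[R] R) - LinearMap.proj 0))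

section
variable (D : Finset ℕ) (c : ℕ → R) {i : ℕ}

theorem slideMap_offset_of_mem (h : i ∈ D) : slideMap D c (offset D i) = c 0 := by
  rw [slideMap, LinearMap.pi_apply, (offset_strictMono D).injective.extend_apply, if_pos h]
  rfl

theorem slideMap_offset_of_notMem (h : i ∉ D) : slideMap D c (offset D i) = c i := by
  rw [slideMap, LinearMap.pi_apply, (offset_strictMono D).injective.extend_apply, if_neg h]
  rfl

theorem slideMap_offset_add_one (h : i ∈ D) : slideMap D c (offset D i + 1) = c 1 - c 0 := by
  rw [slideMap, LinearMap.pi_apply, Function.extend_apply']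
  · rfl
  · rintro ⟨j, hj⟩
    exact offset_add_one_ne h j hj

end

open Classical in
-- After the slide, component `0` runs along the first copies of the strands of component `1`. The
-- new colouring is `c 0` on these and `c 1 - c 0` on the second copies, so that `merge` recovers
-- `c`, and the form of the cable is the form of `w` at `c`. The extra crossing contributes `± (c
-- 0)²`, which the framing correction cancels.
theorem isometric_slide (m : ℕ) (w : BraidWord) (s : Bool) (D : Finset ℕ)
    (hD : D = (Finset.range m).filter (w.SameComponent 1)) (hm : 2 ≤ m)
    (h01 : ¬ w.SameComponent 0 1) (h h') :
    Isometric R ⟨m, w, h⟩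
      ⟨m + D.card, [.crossing 0 s, .twist 0 !s] ++ BraidWord.cable D w, h'⟩ := by
  have hw := fun q => perm_lt_iff h q
  have hmem (q : ℕ) : q ∈ D ↔ q < m ∧ (perm w).SameCycle 1 q := by
    simp [hD, SameComponent]
  have h0D : 0 ∉ D := fun h0 => h01 ((hmem 0).mp h0).2.symm
  have h1D : 1 ∈ D := (hmem 1).mpr ⟨hm, Perm.SameCycle.refl _ _⟩
  have hwD (q : ℕ) : perm w q ∈ D ↔ q ∈ D := by
    rw [hmem, hmem, hw, Perm.sameCycle_apply_right]
  have hDD : D.map (perm w).toEmbedding = D := by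
    ext q
    obtain ⟨q, rfl⟩ := (perm w).surjective q
    rw [mem_map_perm, hwD]
  have ho0 := offset_zero D
  have ho1 := offset_one h0D
  have hom : offset D m = m + D.card := by
    rw [offset, Finset.filter_true_of_mem fun q hq => ((hmem q).mp hq).1]
  have hadd (j t : ℕ) (ht : t = 0 ∨ t = 1 ∧ j ∈ D) :
      perm (cable D w) (offset D j + t) = offset D (perm w j) + t := by
    have := perm_cable_add D w j t ht
    rwa [hDD] at this
  have hperm : perm ([.crossing 0 s, .twist 0 !s] ++ cable D w) = perm (cable D w) * swap 0 1 := by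
    simp [perm, BraidLetter.perm]
  have hadd0 (j : ℕ) : perm (cable D w) (offset D j) = offset D (perm w j) := hadd j 0 (Or.inl rfl)
  have hadd1 {j : ℕ} (hj : j ∈ D) :
      perm (cable D w) (offset D j + 1) = offset D (perm w j) + 1 := hadd j 1 (Or.inr ⟨rfl, hj⟩)
  have hmerge (d : ℕ → R) (hd : ∀ q, d (perm (cable D w) q) = d q) (i : ℕ) :
      merge D d (perm w i) = merge D d i := by
    by_cases hi : i ∈ D
    · rw [merge_of_mem hi, merge_of_mem ((hwD i).mpr hi), ← hadd1 hi, ← hadd0, hd, hd]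
    · rw [merge_of_notMem hi, merge_of_notMem (mt (hwD i).mp hi), ← hadd0, hd]
  -- The colouring is constant along the first copies of component `1`, except that the leading
  -- crossing puts the value at `0` in place of the value at `1`; following the cycle back to `1`
  -- identifies the two.
  have hd01 {d : ℕ → R}
      (hd : ∀ q, d (perm ([.crossing 0 s, .twist 0 !s] ++ cable D w) q) = d q) : d 0 = d 1 := by
    have hd' (q : ℕ) : d (perm (cable D w) q) = d (swap 0 1 q) := by
      rw [← hd (swap 0 1 q), hperm, Perm.mul_apply, swap_apply_self]
    obtain ⟨j, hj⟩ := exists_perm_pow_eq ⟨m, w, h⟩ (q := 1) hm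
    have := apply_zero_eq_apply_one (c := d ∘ offset D) (π := perm w) (fun i => ?_) h01 hj
    · simpa only [Function.comp_apply, ho0, ho1] using this
    · rw [Function.comp_apply, Function.comp_apply, ← hadd0, hd']
      congr 1
      rw [swap_apply_def, swap_apply_def]
      rcases lt_trichotomy i 1 with h2 | rfl | h2
      · obtain rfl : i = 0 := by omega
        simp [ho0, ho1]
      · simp [ho0, ho1]
      · have := offset_strictMono D h2
        rw [if_neg (by omega), if_neg (by omega), if_neg (by omega), if_neg (by omega)]
  have hdP {d : ℕ → R}
      (hd : ∀ q, d (perm ([.crossing 0 s, .twist 0 !s] ++ cable D w) q) = d q) (q : ℕ) :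
      d (perm (cable D w) q) = d q := by
    have h1 := hd (swap 0 1 q)
    rw [hperm, Perm.mul_apply, swap_apply_self] at h1
    rw [h1, swap_apply_def]
    split_ifs with h2 h3
    · rw [h2, hd01 hd]
    · rw [h3, hd01 hd]
    · rfl
  have hms {c : ℕ → R} (hc : ∀ q, c (perm w q) = c q) : merge D (slideMap D c) = c := by
    funext i
    by_cases hi : i ∈ D
    · rw [merge_of_mem hi, slideMap_offset_of_mem _ _ hi, slideMap_offset_add_one _ _ hi,
        add_sub_cancel, apply_eq_of_sameCycle hc ((hmem i).mp hi).2]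
    · rw [merge_of_notMem hi, slideMap_offset_of_notMem _ _ hi]
  have hs0 (c : ℕ → R) : slideMap D c 0 = c 0 := by
    rw [← slideMap_offset_of_notMem D c h0D, ho0]
  have hs1 (c : ℕ → R) : slideMap D c 1 = c 0 := by
    rw [← slideMap_offset_of_mem D c h1D, ho1]
  have hss (c : ℕ → R) : slideMap D c ∘ swap 0 1 = slideMap D c := by
    funext q
    rw [Function.comp_apply, swap_apply_def]
    split_ifs with h1 h2
    · rw [h1, hs0, hs1]
    · rw [h2, hs0, hs1]
    · rfl
  refine Isometric.of_maps (slideMap D) (merge D) (fun c hc => ⟨fun q => ?_, fun q hq => ?_⟩)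
    (fun d hd => ⟨hmerge d (hdP hd.1), fun q hq => ?_⟩) (fun c hc => hms hc.1) (fun d hd => ?_)
    (fun c hc => ?_) (fun J c hc q => ?_) (fun J d hd q => ?_)
  · change slideMap D c (perm ([.crossing 0 s, .twist 0 !s] ++ cable D w) q) = _
    rw [hperm, Perm.mul_apply, ← congrFun (hss c) q, Function.comp_apply]
    rcases exists_eq_offset D (swap 0 1 q) with ⟨i, hi⟩ | ⟨i, hiD, hi⟩
    · rw [hi, hadd0]
      by_cases hiD : i ∈ D
      · rw [slideMap_offset_of_mem _ _ hiD, slideMap_offset_of_mem _ _ ((hwD i).mpr hiD)]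
      · rw [slideMap_offset_of_notMem _ _ hiD, slideMap_offset_of_notMem _ _ (mt (hwD i).mp hiD)]
        exact hc.1 i
    · rw [hi, hadd1 hiD, slideMap_offset_add_one _ _ hiD,
        slideMap_offset_add_one _ _ ((hwD i).mpr hiD)]
  · change m + D.card ≤ q at hq
    rw [← hom] at hq
    rcases exists_eq_offset D q with ⟨i, rfl⟩ | ⟨i, hiD, rfl⟩
    · rw [(offset_strictMono D).le_iff_le] at hq
      rw [slideMap_offset_of_notMem _ _ fun hi => (((hmem i).mp hi).1.trans_le hq).false]
      exact hc.2 i hq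
    · have h1 := (offset_strictMono D).monotone (Nat.succ_le_of_lt ((hmem i).mp hiD).1)
      have h2 := offset_succ_of_mem hiD
      change offset D (i + 1) ≤ _ at h1
      omega
  · change m ≤ q at hq
    rw [merge_of_notMem fun hi => (((hmem q).mp hi).1.trans_le hq).false]
    refine hd.2 _ ?_
    change m + D.card ≤ _
    rw [← hom]
    exact (offset_strictMono D).monotone hq
  · have hd1 := hdP hd.1
    have h01' := hd01 hd.1
    funext q
    rcases exists_eq_offset D q with ⟨i, rfl⟩ | ⟨i, hiD, rfl⟩
    · by_cases hi : i ∈ D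
      · rw [slideMap_offset_of_mem _ _ hi, merge_of_notMem h0D, ho0, h01', ← ho1]
        refine apply_eq_of_sameCycle (c := d ∘ offset D) (π := perm w) (fun j => ?_)
          ((hmem i).mp hi).2
        rw [Function.comp_apply, Function.comp_apply, ← hadd0, hd1]
      · rw [slideMap_offset_of_notMem _ _ hi, merge_of_notMem hi]
    · rw [slideMap_offset_add_one _ _ hiD, merge_of_notMem h0D, merge_of_mem h1D, ho0, ho1, h01',
        add_sub_cancel_left]
      have := apply_eq_of_sameCycle (c := fun j => if j ∈ D then d (offset D j + 1) else 0)
        (π := perm w) (fun j => ?_) ((hmem i).mp hiD).2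
      · simpa only [h1D, hiD, if_true, ho1] using this
      · simp only [hwD]
        split_ifs with hj
        · rw [← hadd1 hj, hd1]
        · rfl
  · change form ([.crossing 0 s, .twist 0 !s] ++ cable D w) (slideMap D c) = form w c
    rw [form_append, form_cable]
    have h1 : perm [.crossing 0 s, .twist 0 !s] = swap 0 1 := by simp [perm, BraidLetter.perm]
    rw [h1, swap_inv, hss, hms hc.1]
    simp only [form, unitSign_not, Function.comp_apply, swap_apply_left, zero_add, hs0, hs1]
    ring
  · rcases exists_eq_offset D q with ⟨i, rfl⟩ | ⟨i, hiD, rfl⟩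
    · by_cases hi : i ∈ D
      · rw [slideMap_offset_of_mem _ _ hi]; exact hc _
      · rw [slideMap_offset_of_notMem _ _ hi]; exact hc _
    · rw [slideMap_offset_add_one _ _ hiD]; exact J.sub_mem (hc _) (hc _)
  · by_cases hi : q ∈ D
    · rw [merge_of_mem hi]; exact J.add_mem (hd _) (hd _)
    · rw [merge_of_notMem hi]; exact hd _

end FramedBraid

/-! ### Blow-ups, and the number of negative eigenvalues -/

namespace FramedBraid

open Equiv BraidWord

section
variable (R : Type*) [CommRing R]

theorem Isometric.exists_equiv {L L' : FramedBraid} (h : Isometric R L L') :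
    ∃ e : (L.Component → R) ≃ₗ[R] (L'.Component → R),
      (∀ r, form L'.word (L'.coloring (e r)) = form L.word (L.coloring r)) ∧
      ∀ (J : Ideal R) r, (∀ p, e r p ∈ J) ↔ ∀ p, r p ∈ J := by
  obtain ⟨e, he, hJ⟩ := h
  have key (r : L.Component → R) : L'.coloring ((coloringsEquiv R L').symm
      (e (coloringsEquiv R L r))) = (e (coloringsEquiv R L r) : ℕ → R) :=
    congrArg Subtype.val ((coloringsEquiv R L').apply_symm_apply _)
  refine ⟨(coloringsEquiv R L).trans (e.trans (coloringsEquiv R L').symm), fun r => ?_,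
    fun J r => ?_⟩
  · change form L'.word (L'.coloring ((coloringsEquiv R L').symm (e (coloringsEquiv R L r)))) = _
    rw [key, he]
    rfl
  · rw [← forall_coloring_mem_iff, ← forall_coloring_mem_iff]
    change (∀ q, L'.coloring ((coloringsEquiv R L').symm (e (coloringsEquiv R L r))) q ∈ J) ↔ _
    rw [key, ← hJ]
    rfl

/-- `L'` is obtained from `L` by adding an unlinked unknot with framing `±1`, on the level of
colourings and linking forms. -/
def IsBlowUp (s : Bool) (L L' : FramedBraid) : Prop :=
  ∃ e : ((L.Component → R) × R) ≃ₗ[R] (L'.Component → R),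
    (∀ x, form L'.word (L'.coloring (e x)) =
      form L.word (L.coloring x.1) + unitSign R s * x.2 ^ 2) ∧
    ∀ (J : Ideal R) x, (∀ p, e x p ∈ J) ↔ (∀ p, x.1 p ∈ J) ∧ x.2 ∈ J

/-- The new strand is a component by itself and meets no crossing, so its colour is free and enters
only through the twist. -/
theorem isBlowUp (m : ℕ) (w : BraidWord) (s : Bool) (h h') :
    IsBlowUp R s ⟨m, w, h⟩ ⟨m + 1, w ++ [.twist m s], h'⟩ := by
  set L : FramedBraid := ⟨m, w, h⟩ with hL
  set L' : FramedBraid := ⟨m + 1, w ++ [.twist m s], h'⟩ with hL'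
  have hperm : perm (w ++ [.twist m s]) = perm w := by
    rw [perm_append]
    simp [perm, BraidLetter.perm]
  have hm : perm w m = m := by
    have h1 := perm_lt_iff (m := m + 1) h' m
    rw [hperm] at h1
    have h2 := perm_lt_iff h m
    omega
  have hne {q : ℕ} : perm w q = m ↔ q = m := by
    rw [← (perm w).injective.eq_iff (a := q) (b := m), hm]
  let e : (L.colorings R × R) ≃ₗ[R] L'.colorings R :=
    { toFun x := ⟨fun q => if q = m then x.2 else (x.1 : ℕ → R) q, fun q => by
          change (if perm (w ++ [.twist m s]) q = m then _ else _) = _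
          rw [hperm]
          simp only [hne]
          split_ifs
          · rfl
          · exact x.1.2.1 q, fun q hq => by
          change m + 1 ≤ q at hq
          change (if q = m then _ else _) = _
          rw [if_neg (by omega)]
          exact x.1.2.2 q (show m ≤ q by omega)⟩
      map_add' x y := by
        ext q
        by_cases hq : q = m <;> simp [hq]
      map_smul' t x := by
        ext q
        by_cases hq : q = m <;> simp [hq]
      invFun c := (⟨fun q => if q = m then 0 else (c : ℕ → R) q, fun q => by
          change (if perm w q = m then _ else _) = _
          simp only [hne]
          split_ifs
          · rfl
          · rw [← c.2.1 q]
            change _ = (c : ℕ → R) (perm (w ++ [.twist m s]) q)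
            rw [hperm], fun q hq => by
          change m ≤ q at hq
          change (if q = m then _ else _) = _
          split_ifs
          · rfl
          · exact c.2.2 q (show m + 1 ≤ q by omega)⟩, (c : ℕ → R) m)
      left_inv x := by
        refine Prod.ext (Subtype.ext (funext fun q => ?_)) (if_pos rfl)
        change (if q = m then 0 else if q = m then _ else _) = _
        split_ifs with hq
        · rw [hq]
          exact (x.1.2.2 m le_rfl).symm
        · rfl
      right_inv c := by
        refine Subtype.ext (funext fun q => ?_)
        change (if q = m then _ else if q = m then _ else _) = _
        split_ifs with hq
        · rw [hq]
        · rfl }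
  have he (x) (q : ℕ) : (e x : ℕ → R) q = if q = m then x.2 else (x.1 : ℕ → R) q := rfl
  have key (x : (L.Component → R) × R) : L'.coloring ((coloringsEquiv R L').symm
      (e (coloringsEquiv R L x.1, x.2))) = (e (coloringsEquiv R L x.1, x.2) : ℕ → R) :=
    congrArg Subtype.val ((coloringsEquiv R L').apply_symm_apply _)
  refine ⟨((coloringsEquiv R L).prodCongr (LinearEquiv.refl R R)).trans
    (e.trans (coloringsEquiv R L').symm), fun x => ?_, fun J x => ?_⟩
  · change form _ (L'.coloring ((coloringsEquiv R L').symm (e (coloringsEquiv R L x.1, x.2)))) = _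
    rw [key, form_append, form_congr h (c' := L.coloring x.1) fun q hq => by
      rw [he, if_neg (by omega)]; rfl]
    simp only [form, Function.comp_apply, add_zero]
    rw [Perm.inv_eq_iff_eq.mpr hm.symm, he, if_pos rfl]
  · rw [← forall_coloring_mem_iff, ← forall_coloring_mem_iff]
    change (∀ q, L'.coloring ((coloringsEquiv R L').symm
      (e (coloringsEquiv R L x.1, x.2))) q ∈ J) ↔ _
    rw [key]
    constructor
    · intro hx
      refine ⟨fun q => ?_, ?_⟩
      · by_cases hq : q < m
        · have := hx q
          rwa [he, if_neg (by omega)] at this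
        · rw [L.coloring_of_not_lt _ hq]
          exact J.zero_mem
      · have := hx m
        rwa [he, if_pos rfl] at this
    · rintro ⟨h1, h2⟩ q
      rw [he]
      split_ifs
      · exact h2
      · exact h1 q

end

open Classical in
-- A crossing enters the entries `(p, q)` and `(q, p)` of its components with weight one half each,
-- so the quadratic form collects the full product of the two colours; a twist is the case of equal
-- strands.
theorem sum_crossings (L : FramedBraid) (r : L.Component → ℝ) {w : BraidWord}
    (hw : ∀ l ∈ w, BraidLetter.Fits L.strands l) (e : Perm ℕ)
    (he : ∀ q, q < L.strands → e q < L.strands) :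
    ∑ p : L.Component, ∑ q : L.Component, r p * ((crossings w e).map fun c =>
      (if c.2.2 then (1 / 2 : ℝ) else -1 / 2) *
        ((if L.word.SameComponent c.1 p ∧ L.word.SameComponent c.2.1 q then 1 else 0) +
          (if L.word.SameComponent c.2.1 p ∧ L.word.SameComponent c.1 q then 1 else 0))).sum * r q =
      form w (L.coloring r ∘ e) := by
  have hcomp {a : ℕ} (ha : a < L.strands) (p : L.Component) :
      L.word.SameComponent a (p : Fin L.strands) ↔ L.componentOf ⟨a, ha⟩ = p :=
    (L.componentOf_eq_iff (q := ⟨a, ha⟩)).symm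
  have key (s : Bool) {a b : ℕ} (ha : a < L.strands) (hb : b < L.strands) :
      ∑ p : L.Component, ∑ q : L.Component, r p * ((if s then (1 / 2 : ℝ) else -1 / 2) *
        ((if L.word.SameComponent a p ∧ L.word.SameComponent b q then 1 else 0) +
          (if L.word.SameComponent b p ∧ L.word.SameComponent a q then 1 else 0))) * r q =
      unitSign ℝ s * (L.coloring r a * L.coloring r b) := by
    simp only [hcomp ha, hcomp hb, mul_add, add_mul, Finset.sum_add_distrib, ite_and, mul_ite,
      ite_mul, mul_one, mul_zero, zero_mul,
      L.coloring_of_lt r ha, L.coloring_of_lt r hb]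
    simp only [Finset.sum_ite_irrel, Finset.sum_ite_eq, Finset.mem_univ, if_true,
      Finset.sum_const_zero]
    cases s <;> simp [unitSign] <;> ring
  induction w generalizing e with
  | nil => simp [crossings, form]
  | cons l w ih =>
    have hw' : ∀ l ∈ w, BraidLetter.Fits L.strands l := fun l' hl' =>
      hw l' (List.mem_cons_of_mem _ hl')
    have hl := hw l List.mem_cons_self
    cases l with
    | crossing i s =>
      have hl : i + 1 < L.strands := hl
      simp only [crossings, List.map_cons, List.sum_cons, mul_add (r _), add_mul,
        Finset.sum_add_distrib, form]
      rw [ih hw' (e * swap i (i + 1)) fun q hq => he _ ?_]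
      · rw [key s (he i (by omega)) (he (i + 1) hl)]
        rfl
      · rw [swap_apply_def]
        split_ifs <;> omega
    | twist i s =>
      simp only [crossings, List.map_cons, List.sum_cons, mul_add (r _), add_mul,
        Finset.sum_add_distrib, form]
      rw [ih hw' e he]
      rw [key s (he i hl) (he i hl), sq]
      rfl

theorem linkingMatrix_toQuadraticForm (L : FramedBraid) (r : L.Component → ℝ) :
    L.linkingMatrix.toQuadraticForm' r = form L.word (L.coloring r) := by
  classical
  have := L.sum_crossings r L.fits 1 fun q hq => hq
  rw [Perm.coe_one, Function.comp_id] at this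
  rw [← this, Matrix.toQuadraticForm', LinearMap.BilinMap.toQuadraticMap_apply,
    Matrix.toLinearMap₂'_apply]
  refine Finset.sum_congr rfl fun p _ => Finset.sum_congr rfl fun q _ => ?_
  simp only [linkingMatrix, Matrix.of_apply, smul_eq_mul]
  ring

/-- Real colourings are the space on which the linking matrix defines its quadratic form. Hence an
isometry over `ℝ` preserves the index of negativity, and its dimension count preserves the number of
components. -/
theorem Isometric.bMinus_eq {L L' : FramedBraid} (h : Isometric ℝ L L') : L'.bMinus = L.bMinus := by
  obtain ⟨e, he, -⟩ := h.exists_equiv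
  refine (QuadraticMap.Equivalent.sigNeg_eq ⟨⟨e, fun r => ?_⟩⟩).symm
  rw [linkingMatrix_toQuadraticForm, linkingMatrix_toQuadraticForm]
  exact he r

theorem Isometric.card_eq {L L' : FramedBraid} (h : Isometric ℝ L L') :
    Fintype.card L'.Component = Fintype.card L.Component := by
  obtain ⟨e, -⟩ := h.exists_equiv
  simpa using e.finrank_eq.symm

theorem IsBlowUp.card_eq {s : Bool} {L L' : FramedBraid} (h : IsBlowUp ℝ s L L') :
    Fintype.card L'.Component = Fintype.card L.Component + 1 := by
  obtain ⟨e, -⟩ := h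
  have := e.finrank_eq
  rw [Module.finrank_prod, Module.finrank_fintype_fun_eq_card, Module.finrank_fintype_fun_eq_card,
    Module.finrank_self] at this
  exact this.symm

/-- The number of negative squares of a form `Q(v) + u t²`. -/
theorem sigNeg_of_equiv_prod {V V' : Type*} [AddCommGroup V] [Module ℝ V] [FiniteDimensional ℝ V]
    [AddCommGroup V'] [Module ℝ V'] (Q : QuadraticForm ℝ V) (Q' : QuadraticForm ℝ V') (u : ℝ)
    (e : (V × ℝ) ≃ₗ[ℝ] V') (he : ∀ x, Q' (e x) = Q x.1 + u * x.2 ^ 2) :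
    sigNeg Q' = sigNeg Q + if u < 0 then 1 else 0 := by
  obtain ⟨w, ⟨f⟩⟩ := QuadraticForm.equivalent_weightedSumSquares Q
  -- The weights of a diagonalization of `Q`, with `u` adjoined at `none`.
  let w' : Option (Fin (Module.finrank ℝ V)) → ℝ := fun i => i.elim u w
  have hw' : QuadraticMap.Equivalent Q' (QuadraticMap.weightedSumSquares ℝ w') := by
    let g : V' ≃ₗ[ℝ] (Option (Fin (Module.finrank ℝ V)) → ℝ) :=
      e.symm.trans ((f.toLinearEquiv.prodCongr (LinearEquiv.refl ℝ ℝ)).trans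
        ((LinearEquiv.prodComm ℝ _ _).trans (LinearEquiv.piOptionEquivProd ℝ (M := fun _ => ℝ)).symm))
    refine ⟨⟨g, fun v => ?_⟩⟩
    obtain ⟨x, rfl⟩ := e.surjective v
    have h1 : g (e x) none = x.2 := by
      simp [g]
      rfl
    have h2 (i) : g (e x) (some i) = f x.1 i := by
      simp [g]
      rfl
    change QuadraticMap.weightedSumSquares ℝ w' (g (e x)) = _
    rw [QuadraticMap.weightedSumSquares_apply, Fintype.sum_option, h1, he, ← f.map_app,
      QuadraticMap.weightedSumSquares_apply]
    simp only [h2, w', Option.elim, smul_eq_mul]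
    ring
  rw [QuadraticForm.sigNeg_of_equiv_weightedSumSquares hw',
    QuadraticForm.sigNeg_of_equiv_weightedSumSquares ⟨f⟩]
  have himg : (some '' {i | w i < 0}).ncard = {i | w i < 0}.ncard :=
    Set.ncard_image_of_injective _ (Option.some_injective _)
  rw [← himg]
  split_ifs with hu
  · rw [← Set.ncard_insert_of_notMem (a := none) (by simp)]
    congr 1
    ext i
    cases i <;> simp [w', hu]
  · congr 1
    ext i
    cases i <;> simp [w', hu]

theorem IsBlowUp.bMinus_eq {s : Bool} {L L' : FramedBraid} (h : IsBlowUp ℝ s L L') :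
    L'.bMinus = L.bMinus + if s then 0 else 1 := by
  obtain ⟨e, he, -⟩ := h
  rw [bMinus, bMinus, sigNeg_of_equiv_prod _ _ (unitSign ℝ s) e fun x => ?_]
  · congr 1
    cases s
    · rw [if_pos (by simp [unitSign]), if_neg (by simp)]
    · rw [if_neg (by simp [unitSign]), if_pos rfl]
  · rw [linkingMatrix_toQuadraticForm, linkingMatrix_toQuadraticForm]
    exact he x

end FramedBraid

/-! ### Invariance under the Kirby moves -/

namespace FramedBraid

open BraidWord

section
variable {R : Type*} [CommRing R] [Fintype R] {k : Type*} [Field k]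

open Classical in
/-- The Gauss sum of the linking form over the colourings with values in an ideal. -/
noncomputable def linkSum (J : Ideal R) (ψ : AddChar R k) (L : FramedBraid) : k :=
  ∑ r : L.Component → R, if ∀ p, r p ∈ J then ψ (form L.word (L.coloring r)) else 0

open Classical in
/-- The Gauss sum `∑ ψ(± t²)` over an ideal. -/
noncomputable def unknotSum (J : Ideal R) (ψ : AddChar R k) (s : Bool) : k :=
  ∑ t : R, if t ∈ J then ψ (unitSign R s * t ^ 2) else 0

theorem Isometric.linkSum_eq {L L' : FramedBraid} (h : Isometric R L L') (J : Ideal R)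
    (ψ : AddChar R k) : linkSum J ψ L' = linkSum J ψ L := by
  classical
  obtain ⟨e, he, hJ⟩ := h.exists_equiv
  rw [linkSum, ← e.toEquiv.sum_comp]
  refine Finset.sum_congr rfl fun r _ => ?_
  change (if ∀ p, e r p ∈ J then ψ (form L'.word (L'.coloring (e r))) else 0) = _
  rw [he]
  exact if_congr (hJ J r) rfl rfl

theorem IsBlowUp.linkSum_eq {s : Bool} {L L' : FramedBraid} (h : IsBlowUp R s L L') (J : Ideal R)
    (ψ : AddChar R k) : linkSum J ψ L' = linkSum J ψ L * unknotSum J ψ s := by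
  classical
  obtain ⟨e, he, hJ⟩ := h
  rw [linkSum, ← e.toEquiv.sum_comp, Fintype.sum_prod_type, linkSum, unknotSum,
    Finset.sum_mul_sum]
  refine Finset.sum_congr rfl fun r _ => Finset.sum_congr rfl fun t _ => ?_
  change (if ∀ p, e (r, t) p ∈ J then ψ (form L'.word (L'.coloring (e (r, t)))) else 0) = _
  rw [he, if_congr (hJ J (r, t)) rfl rfl, ite_zero_mul_ite_zero, AddChar.map_add_eq_mul]

/-- A normalized Gauss sum of the linking form, with weight `γ` for each component. -/
noncomputable def gaussInvariant (J : Ideal R) (ψ : AddChar R k) (γ : k) (L : FramedBraid) : k :=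
  (γ * unknotSum J ψ true) ^ ((L.bMinus : ℤ) - (Fintype.card L.Component : ℤ)) *
    (γ * unknotSum J ψ false) ^ (-(L.bMinus : ℤ)) *
    (γ ^ Fintype.card L.Component * linkSum J ψ L)

variable {J : Ideal R} {ψ : AddChar R k} {γ : k}

theorem Isometric.gaussInvariant_eq {L L' : FramedBraid} (h : Isometric R L L')
    (h' : Isometric ℝ L L') : gaussInvariant J ψ γ L' = gaussInvariant J ψ γ L := by
  rw [gaussInvariant, h'.bMinus_eq, h'.card_eq, h.linkSum_eq]
  rfl

/-- The unnormalized sum is multiplied by `γ` times the unknot sum of sign `s`. A negative blow-up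
raises both `b₋` and the number of components, lowering only the second exponent by one; a positive
one lowers only the first. -/
theorem IsBlowUp.gaussInvariant_eq {s : Bool} {L L' : FramedBraid} (h : IsBlowUp R s L L')
    (h' : IsBlowUp ℝ s L L') (hγ : ∀ s, γ * unknotSum J ψ s ≠ 0) :
    gaussInvariant J ψ γ L' = gaussInvariant J ψ γ L := by
  rw [gaussInvariant, h'.bMinus_eq, h'.card_eq, h.linkSum_eq, gaussInvariant]
  have hf := hγ false
  have ht := hγ true
  have h0 := left_ne_zero_of_mul ht
  have h1 := right_ne_zero_of_mul ht
  have h2 := right_ne_zero_of_mul hf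
  cases s
  · simp only [Bool.false_eq_true, if_false, Nat.cast_add, Nat.cast_one, add_sub_add_right_eq_sub]
    rw [neg_add, zpow_add₀ hf (-(L.bMinus : ℤ)), zpow_neg_one, pow_succ]
    field_simp
  · simp only [if_true, add_zero, Nat.cast_add, Nat.cast_one]
    rw [← sub_sub, zpow_sub_one₀ ht, pow_succ]
    field_simp

/-- Every move other than a blow-up is an isometry over each commutative ring. It is used over `R`
for the sum and over `ℝ` for the exponents. -/
theorem KirbyStep.gaussInvariant_eq {L L' : FramedBraid} (h : KirbyStep L L')
    (hγ : ∀ s, γ * unknotSum J ψ s ≠ 0) :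
    gaussInvariant J ψ γ L' = gaussInvariant J ψ γ L := by
  cases h with
  | local_rel m u v x y hx hy h =>
    exact (isometric_local_rel m u v x y hx hy h).gaussInvariant_eq
      (isometric_local_rel m u v x y hx hy h)
  | conj m u v h h' =>
    exact (isometric_conj m u v h h').gaussInvariant_eq (isometric_conj m u v h h')
  | markov m w s h h' =>
    exact (isometric_markov m w s h h').gaussInvariant_eq (isometric_markov m w s h h')
  | blow_up m w s h h' =>
    exact (isBlowUp R m w s h h').gaussInvariant_eq (isBlowUp ℝ m w s h h') hγ
  | slide m w s D hD hm h01 h h' =>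
    exact (isometric_slide m w s D hD hm h01 h h').gaussInvariant_eq
      (isometric_slide m w s D hD hm h01 h h')

/-- The exponents of `α` are `b₋ - n_L`, `-b₋` and `n_L`, which add up to zero. -/
theorem gaussInvariant_mul {α : k} (hα : α ≠ 0) (L : FramedBraid) :
    gaussInvariant J ψ (α * γ) L = gaussInvariant J ψ γ L := by
  have h : α ^ ((L.bMinus : ℤ) - (Fintype.card L.Component : ℤ)) * α ^ (-(L.bMinus : ℤ)) *
      α ^ Fintype.card L.Component = 1 := by
    rw [← zpow_natCast α (Fintype.card L.Component), ← zpow_add₀ hα, ← zpow_add₀ hα]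
    convert zpow_zero α using 2
    ring
  rw [gaussInvariant, mul_assoc α, mul_assoc α, mul_zpow α, mul_zpow α, mul_pow, gaussInvariant]
  linear_combination (γ * unknotSum J ψ true) ^ ((L.bMinus : ℤ) - (Fintype.card L.Component : ℤ)) *
    (γ * unknotSum J ψ false) ^ (-(L.bMinus : ℤ)) *
    (γ ^ Fintype.card L.Component * linkSum J ψ L) * h

end

end FramedBraid

/-! ### The invariants `τ_{(H_n, z_d)}` and the main theorem -/

namespace Radford

open RootCalculus RibbonHopf BraidWord FramedBraid

variable {k : Type u} [Field k] {n : ℕ} {ω : k} {s : ℕ} {β : k}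
  (hN : ((2 * n : ℕ) : k) ≠ 0) (hω : IsPrimitiveRoot ω (2 * n)) [hn : Fact (Odd n)]
  (hs : Odd s) {lam : Module.Dual k (Radford k n)} {z : Radford k n}

section
variable {J : Ideal (ZMod n)} {γ : k}

open Classical in
theorem apply_twist_eq (hf : phi lam z 1 ∈ reduced k n)
    (hfib : ∀ r, fiber ω (phi lam z 1) r = if r ∈ J then γ else 0) :
    lam (z * twist n ω s) = γ * unknotSum J (signChar hN hω hs) true := by
  rw [← phi_one_apply, apply_twist hN hω hs hf, unknotSum, Finset.mul_sum]
  refine Finset.sum_congr rfl fun r _ => ?_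
  rw [hfib, ite_mul, zero_mul, mul_ite, mul_zero, unitSign, if_pos rfl, one_mul]

open Classical in
theorem apply_inv_twist_eq (hf : phi lam z 1 ∈ reduced k n)
    (hfib : ∀ r, fiber ω (phi lam z 1) r = if r ∈ J then γ else 0) :
    lam (z * Ring.inverse (twist n ω s)) = γ * unknotSum J (signChar hN hω hs) false := by
  rw [← phi_one_apply, apply_inv_twist hN hω hs hf, unknotSum, Finset.mul_sum]
  refine Finset.sum_congr rfl fun r _ => ?_
  rw [hfib, ite_mul, zero_mul, mul_ite, mul_zero, unitSign, if_neg Bool.false_ne_true,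
    neg_one_mul]

open Classical in
-- When `fiber` is `γ` times the indicator of an ideal, the product over components restricts the
-- colourings to that ideal and contributes one `γ` for each component.
theorem tau_eq_gaussInvariant (hf : phi lam z 1 ∈ reduced k n)
    (hfib : ∀ r, fiber ω (phi lam z 1) r = if r ∈ J then γ else 0) (L : FramedBraid) :
    tau (rMatrix n ω s β) (twist n ω s) lam z L =
      gaussInvariant J (signChar hN hω hs) γ L := by
  rw [tau, apply_twist_eq hN hω hs hf hfib, apply_inv_twist_eq hN hω hs hf hfib,
    tauLink_eq hN hω hs hf, gaussInvariant, linkSum]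
  congr 1
  rw [Finset.mul_sum]
  refine Finset.sum_congr rfl fun r _ => ?_
  simp only [hfib]
  rw [Finset.prod_ite_zero, Finset.prod_const, Finset.card_univ]
  simp only [Finset.mem_univ, true_implies, ite_mul, zero_mul, mul_ite, mul_zero]

end

section
variable {ν : Radford k n →ₐ[k] k}

include hN hω hs in
-- Only the values at even powers of `a` enter, and there `w` is invisible. The two Gauss invariants
-- have the same ideal, and their weights differ by the factor `α`.
theorem tau_smul_zElem_add (hlam : IsDualRightIntegral lam) (h0 : lam ≠ 0)
    (hν : IsDistinguished ν) {d : ℕ} (hd : d ∈ n.divisors) {α : k} (hα : α ≠ 0) {w : Radford k n}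
    (hw : w ∈ setN lam ν) (L : FramedBraid) :
    tau (rMatrix n ω s β) (twist n ω s) lam (α • zElem k n d + w) L =
      tau (rMatrix n ω s β) (twist n ω s) lam (zElem k n d) L := by
  classical
  have hdn := Nat.dvd_of_mem_divisors hd
  obtain ⟨h1, h2⟩ := (exists_smul_zElem_iff hN hω hlam h0 hν hd α _).mp ⟨w, hw, rfl⟩
  rw [tau_eq_gaussInvariant hN hω hs (phi_zElem_mem_reduced (lam := lam) d)
      (fiber_eq hN hω (phi_zElem_mem_reduced (lam := lam) d) hdn
        fun i hi => phi_zElem_a_pow hN hω hlam hd hi),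
    tau_eq_gaussInvariant hN hω hs h1 (fiber_eq hN hω h1 hdn h2), mul_assoc, mul_div_assoc,
    gaussInvariant_mul hα, mul_div_assoc]

include hN hω hs in
-- The factors to be inverted for blow-ups are the values of the integral at `z_d θ` and `z_d θ⁻¹`,
-- nonzero by the nonvanishing of Gauss sums.
theorem tau_eq_of_kirbyStep (hlam : IsDualRightIntegral lam) (h0 : lam ≠ 0) {d : ℕ}
    (hd : d ∈ n.divisors) {L L' : FramedBraid} (h : KirbyStep L L') :
    tau (rMatrix n ω s β) (twist n ω s) lam (zElem k n d) L =
      tau (rMatrix n ω s β) (twist n ω s) lam (zElem k n d) L' := by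
  classical
  have hdn := Nat.dvd_of_mem_divisors hd
  have hred := phi_zElem_mem_reduced (lam := lam) d
  have hval := fun i (hi : Even i) => phi_zElem_a_pow hN hω hlam hd hi
  have hfib := fiber_eq hN hω hred hdn hval
  have hC := dualRightIntegral_apply_ne_zero hN hω hlam h0
  rw [tau_eq_gaussInvariant hN hω hs hred hfib, tau_eq_gaussInvariant hN hω hs hred hfib]
  refine (h.gaussInvariant_eq fun t => ?_).symm
  cases t
  · rw [← apply_inv_twist_eq hN hω hs hred hfib, ← phi_one_apply, apply_inv_twist hN hω hs hred]
    simpa only [AddChar.inv_apply] using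
      sum_fiber_ne_zero hN hω hred hdn hC hval (signChar hN hω hs)⁻¹
  · rw [← apply_twist_eq hN hω hs hred hfib, ← phi_one_apply, apply_twist hN hω hs hred]
    exact sum_fiber_ne_zero hN hω hred hdn hC hval (signChar hN hω hs)

end

end Radford

theorem mainTheorem11 {k : Type u} [Field k] (n : ℕ) [Fact (Odd n)] (hchar : ((2 * n : ℕ) : k) ≠ 0)
    (ω : k) (hω : IsPrimitiveRoot ω (2 * n)) (s : ℕ) (hs : Odd s) (hs2 : s < 2 * n) (β : k) :
    RibbonHopf.IsRibbon (Radford.rMatrix n ω s β) (Radford.twist n ω s) ∧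
    ¬ RibbonHopf.IsUnimodular k (Radford k n) ∧
    (∃ lam : Module.Dual k (Radford k n), RibbonHopf.IsDualRightIntegral lam ∧ lam ≠ 0) ∧
    (∃! ν : Radford k n →ₐ[k] k, RibbonHopf.IsDistinguished ν) ∧
    ∀ (lam : Module.Dual k (Radford k n)) (ν : Radford k n →ₐ[k] k),
      RibbonHopf.IsDualRightIntegral lam → lam ≠ 0 → RibbonHopf.IsDistinguished ν →
      RibbonHopf.kirbySet (Radford.rMatrix n ω s β) (Radford.twist n ω s) lam =
        ⋃ d ∈ n.divisors, {z | ∃ α : k, ∃ w ∈ RibbonHopf.setN lam ν,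
          z = α • Radford.zElem k n d + w} ∧
      RibbonHopf.kirbySetNorm (Radford.rMatrix n ω s β) (Radford.twist n ω s) lam =
        ⋃ d ∈ n.divisors, {z | ∃ α : k, α ≠ 0 ∧ ∃ w ∈ RibbonHopf.setN lam ν,
          z = α • Radford.zElem k n d + w} ∧
      (∀ z ∈ RibbonHopf.kirbySetNorm (Radford.rMatrix n ω s β) (Radford.twist n ω s) lam, ∃! d, d ∈ n.divisors ∧
        ∃ α : k, α ≠ 0 ∧ ∃ w ∈ RibbonHopf.setN lam ν, z = α • Radford.zElem k n d + w) ∧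
      (∀ d ∈ n.divisors, ∀ α : k, α ≠ 0 → ∀ w ∈ RibbonHopf.setN lam ν, ∀ L : FramedBraid,
        RibbonHopf.tau (Radford.rMatrix n ω s β) (Radford.twist n ω s) lam (α • Radford.zElem k n d + w) L =
          RibbonHopf.tau (Radford.rMatrix n ω s β) (Radford.twist n ω s) lam (Radford.zElem k n d) L) ∧
      (∀ d ∈ n.divisors, ∃ I : SurgeryManifold → k, RibbonHopf.IsHKRType k I ∧
        ∀ L : FramedBraid, I L.surgery = RibbonHopf.tau (Radford.rMatrix n ω s β) (Radford.twist n ω s) lam (Radford.zElem k n d) L) ∧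
      (1 : Radford k n) ∉ RibbonHopf.kirbySet (Radford.rMatrix n ω s β) (Radford.twist n ω s) lam := by
  classical
  refine ⟨Radford.isRibbon hchar hω hs, Radford.not_isUnimodular hchar hω,
    Radford.exists_dualRightIntegral hchar hω, Radford.existsUnique_distinguished hchar hω, ?_⟩
  intro lam ν hlam h0 hν
  have hnorm := Radford.mem_kirbySetNorm_iff (β := β) hchar hω hs hlam h0 hν
  -- The case `α = 1`, `w = 0` of the classification.
  have hmem : ∀ d ∈ n.divisors, Radford.zElem k n d ∈
      RibbonHopf.kirbySetNorm (Radford.rMatrix n ω s β) (Radford.twist n ω s) lam := fun d hd =>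
    (hnorm _).mpr ⟨d, hd, 1, one_ne_zero, 0,
      ⟨fun x => by simp, fun c _ => by simp⟩, by simp⟩
  refine ⟨?_, ?_, ?_, ?_, ?_, Radford.one_notMem_kirbySet hchar hω hs hlam h0⟩
  · ext z
    simp only [Set.mem_iUnion, exists_prop, Set.mem_ofPred_eq]
    exact Radford.mem_kirbySet_iff hchar hω hs hlam h0 hν z
  · ext z
    simp only [Set.mem_iUnion, exists_prop, Set.mem_ofPred_eq]
    exact hnorm z
  · intro z hz
    obtain ⟨d, hd, α, hα, h⟩ := (hnorm z).mp hz
    refine ⟨d, ⟨hd, α, hα, h⟩, ?_⟩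
    rintro d' ⟨hd', α', hα', h'⟩
    exact Radford.divisor_unique hchar hω hlam h0 hν hd' hd hα' hα h' h
  · intro d hd α hα w hw L
    exact Radford.tau_smul_zElem_add hchar hω hs hlam h0 hν hd hα hw L
  · intro d hd
    refine ⟨Quot.lift (RibbonHopf.tau (Radford.rMatrix n ω s β) (Radford.twist n ω s) lam
      (Radford.zElem k n d)) fun _ _ h => Radford.tau_eq_of_kirbyStep hchar hω hs hlam h0 hd h,
      ⟨Radford k n, inferInstance, inferInstance, inferInstance, Radford.rMatrix n ω s β,
        Radford.twist n ω s, lam, Radford.zElem k n d, Radford.isRibbon hchar hω hs, hlam, h0,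
        hmem d hd, fun _ => rfl⟩, fun _ => rfl⟩
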